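/- Throughout, $|\cdot|$ is Lebesgue measure (outer measure, for sets that are not measurable) and $N_\rho(E)$ is the $\rho$-neighborhood of $E$. An $s\times t\times 1$ prism in $\mathbb{R}^3$ is the image of $[-\frac s2,\frac s2]\times[-\frac t2,\frac t2]\times[-\frac12,\frac12]$ under a rigid motion. A finite multi-set $\mathcal{S}$ of subsets of $\mathbb{R}^3$ satisfies the Convex Wolff Axioms with error $C\ge 1$ if $\#\{S\in\mathcal{S}\colon S\subset W\}\leq C|W|(\#\mathcal{S})$ for every convex set $W\subset\mathbb{R}^3$. A $\tau$-dense shading of $\mathcal{S}$ is a choice of a subset $Y(S)\subset S$ for each $S\in\mathcal{S}$ with $\sum_{S\in\mathcal{S}}|Y(S)|\geq\tau\sum_{S\in\mathcal{S}}|S|$. A set $E\subset\mathbb{R}^3$ has discretized Assouad dimension at least $\beta$ at scale $\delta>0$ and scale separation $A\geq 1$ if there are scales $\delta\leq\rho\leq r\leq 1$ with $r\geq A\rho$ and a ball $B$ of radius $r$ so that $|B\cap N_\rho(E)|\geq(\rho/r)^{3-\beta}|B|$. Proposition. For all $\varepsilon>0$ there exist $\eta,\delta_0>0$ so that the following holds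 for all $\delta\in(0,\delta_0]$. Let $s,t\in[\delta,1]$ with $s\leq\delta^{\varepsilon}t$. Let $\mathcal{R}$ be a non-empty finite multi-set of $s\times t\times 1$ prisms contained in the unit ball $B(0,1)\subset\mathbb{R}^3$ that satisfies the Convex Wolff Axioms with error $\delta^{-\eta}$, and let $\{Y(R)\colon R\in\mathcal{R}\}$ be a $\delta^{\eta}$-dense shading of $\mathcal{R}$. Then $\bigcup_{R\in\mathcal{R}}Y(R)$ has discretized Assouad dimension at least $3-\varepsilon$ at scale $\delta$ and scale separation $\delta^{-\eta}$. -/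

import Mathlib

open MeasureTheory Set
open scoped ENNReal

/-- `R` is a rectangular prism of dimensions `a × b × c` in `ℝ³`, not necessarily axis-parallel:
the image of `[-a/2, a/2] × [-b/2, b/2] × [-c/2, c/2]` under a rigid motion. -/
def IsPrism (a b c : ℝ) (R : Set (EuclideanSpace ℝ (Fin 3))) : Prop :=
  ∃ g : EuclideanSpace ℝ (Fin 3) ≃ᵃⁱ[ℝ] EuclideanSpace ℝ (Fin 3),
    R = g '' {x | |x 0| ≤ a / 2 ∧ |x 1| ≤ b / 2 ∧ |x 2| ≤ c / 2}

/-- The finite multi-set of sets `S i`, `i : ι` (indices count multiplicity), satisfies the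
Convex Wolff Axioms with error `C`: every convex set `W` contains at most `C |W| (#S)` of them. -/
def ConvexWolffAxioms {n : ℕ} {ι : Type*} [Fintype ι] (C : ℝ)
    (S : ι → Set (EuclideanSpace ℝ (Fin n))) : Prop :=
  ∀ W : Set (EuclideanSpace ℝ (Fin n)), Convex ℝ W →
    (({i | S i ⊆ W}.ncard : ℕ) : ℝ≥0∞) ≤ ENNReal.ofReal C * volume W * (Fintype.card ι : ℝ≥0∞)

/-- `Y` is a `τ`-dense shading of the finite multi-set of sets `S`: each `Y i` is a subset of
`S i`, and `∑ |Y i| ≥ τ ∑ |S i|`. -/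
def IsDenseShading {n : ℕ} {ι : Type*} [Fintype ι] (τ : ℝ)
    (S Y : ι → Set (EuclideanSpace ℝ (Fin n))) : Prop :=
  (∀ i, Y i ⊆ S i) ∧ ENNReal.ofReal τ * ∑ i, volume (S i) ≤ ∑ i, volume (Y i)

/-- `E ⊆ ℝⁿ` has discretized Assouad dimension at least `β` at scale `δ` and scale
separation `A`. Here `Metric.thickening ρ E` is the `ρ`-neighborhood of `E`. -/
def DiscretizedAssouadDimAtLeast {n : ℕ} (E : Set (EuclideanSpace ℝ (Fin n)))
    (β δ A : ℝ) : Prop :=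
  ∃ ρ r : ℝ, δ ≤ ρ ∧ ρ ≤ r ∧ r ≤ 1 ∧ A * ρ ≤ r ∧
    ∃ x : EuclideanSpace ℝ (Fin n),
      ENNReal.ofReal ((ρ / r) ^ ((n : ℝ) - β)) * volume (Metric.ball x r) ≤
        volume (Metric.ball x r ∩ Metric.thickening ρ E)

/-! After a permutation of coordinates each prism lies in a sheared box `|x₀ - p x₁ - q x₂ - c| ≤
s`, `|x₁ - v x₂ - e| ≤ 6 t`, `|x₂| ≤ 1` with slopes at most `1` (`exists_perm_box`). One of the six
permutations carries a sixth of the shading mass, and from then on only boxes occur.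

The engine is a trichotomy at one scale, `dense_ball_or_enlarge`. For two boxes through a common
point, `spread` is the angle `M` between them inside their planes (at least `t`), and `thickness` is
the width `w` that a slab around the first box needs in order to hold the nearby part of the second.
Both are sorted dyadically and one class is made to dominate most incidences
(`exists_dominatedPart`), at a logarithmic cost.

If `w ≥ 2^k₀ s`, localise to a cell of size `w × t × t/M`. Cauchy–Schwarz with the intersection
bound `s² t² / (M w)` shows that the shadings fill much of the cell, hence much of some ball of
radius `2^k₀ s / 50` (`exists_ball_of_thick`).

If `w` is small but `M ≥ 2^l₀ t`, a Córdoba-type planar argument shows that the boxes crossing a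
given box fill much of a box `2^l₀` times wider, once everything is thickened to `2^l₀ 2^k₀ s`
(`le_measureReal_box_inter_cthickening`). The enlarged boxes then carry a dense shading by the
thickened set.

If both are small, every box of the dominant class meeting a given box lies in a slight enlargement
of it. The Convex Wolff Axioms bound the number of such boxes, and Cauchy–Schwarz gives a unit ball
of density about `2^(-2 l₀ - k₀)`, up to `δ^(-η)` and density losses.

The first and third outcomes finish the proof. The second widens the boxes by `10 * 2^l₀` and is
impossible once `2^l₀ t > 2`, so it is iterated a bounded number of times (`exists_dense_ball`).
Each round costs only `2^k₀` in eccentricity, so the hypothesis `s ≤ δ^ε t` keeps every thickness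
reached below `δ^(ε/2)`. Each round also turns a density `λ` into at least `λ^4`. The exponents are
therefore chosen in a hierarchy: `2^l₀` is a small power of `1/δ`, `2^k₀` a much smaller one, and
the initial density loss smaller still. -/

/-! ### Cauchy–Schwarz and pigeonholing for finite families of sets. -/

section Measure

variable {ι X : Type*} [Fintype ι] [MeasurableSpace X] {μ : Measure X}

/-- Cauchy–Schwarz for the counting function of a finite family of sets, where the number of sets
through a point is controlled by the number of related sets through it. -/
theorem sq_sum_measureReal_le (I Y : ι → Set X) (rel : ι → ι → Prop) [∀ i j, Decidable (rel i j)] {n : ℝ}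
    (hIm : ∀ i, MeasurableSet (I i)) (hYm : ∀ i, MeasurableSet (Y i))
    (hIf : ∀ i, μ (I i) ≠ ∞)
    (hn : ∀ i, ∀ x ∈ I i, ∑ j, (I j).indicator (1 : X → ℝ) x ≤
      n * ∑ j, if rel i j then (Y j).indicator (1 : X → ℝ) x else 0) :
    (∑ i, μ.real (I i)) ^ 2 ≤
      μ.real (⋃ i, I i) * (n * ∑ i, ∑ j, if rel i j then μ.real (I i ∩ Y j) else 0) := by
  set U := ⋃ i, I i
  have hUm : MeasurableSet U := MeasurableSet.iUnion hIm
  have hUf : μ U ≠ ∞ := ((measure_iUnion_fintype_le μ I).trans_lt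
    (ENNReal.sum_lt_top.2 fun i _ => (hIf i).lt_top)).ne
  have hIYf : ∀ i j, μ (I i ∩ Y j) ≠ ∞ := fun i j => measure_ne_top_of_subset inter_subset_left (hIf i)
  have hint : ∀ s : Set X, MeasurableSet s → μ s ≠ ∞ →
      Integrable (s.indicator (1 : X → ℝ)) μ := fun s hs hf =>
    (integrable_indicator_iff hs).2 (integrableOn_const hf)
  -- Cauchy–Schwarz in the form `2 c g ≤ c² + g²` on the union. The choice `c = m / |U|` is optimal.
  have key : ∀ c : ℝ, 0 ≤ c → 2 * c * ∑ i, μ.real (I i) ≤ c ^ 2 * μ.real U +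
      n * ∑ i, ∑ j, if rel i j then μ.real (I i ∩ Y j) else 0 := by
    intro c hc
    have h1 : ∀ x, 2 * c * ∑ i, (I i).indicator (1 : X → ℝ) x ≤
        c ^ 2 * U.indicator (1 : X → ℝ) x +
        n * ∑ i, ∑ j, if rel i j then (I i ∩ Y j).indicator (1 : X → ℝ) x else 0 := by
      intro x
      set g := ∑ i, (I i).indicator (1 : X → ℝ) x with hg
      have h2 : g ^ 2 ≤ n * ∑ i, ∑ j,
          if rel i j then (I i ∩ Y j).indicator (1 : X → ℝ) x else 0 := by
        rw [sq, hg, Finset.sum_mul, Finset.mul_sum]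
        refine Finset.sum_le_sum fun i _ => ?_
        by_cases hx : x ∈ I i
        · have := hn i x hx
          rw [indicator_of_mem hx, Pi.one_apply, one_mul]
          have e : ∀ j, (I i ∩ Y j).indicator (1 : X → ℝ) x = (Y j).indicator (1 : X → ℝ) x := by
            intro j
            by_cases hj : x ∈ Y j <;> simp [hx, hj]
          simpa only [e] using this
        · simp [indicator, hx]
      by_cases hx : x ∈ U
      · rw [indicator_of_mem hx]
        simp only [Pi.one_apply]
        nlinarith [sq_nonneg (c - g)]
      · have hg0 : g = 0 := by
          rw [hg]
          refine Finset.sum_eq_zero fun i _ => ?_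
          rw [indicator_of_notMem]
          exact fun h => hx (mem_iUnion.2 ⟨i, h⟩)
        rw [indicator_of_notMem hx]
        rw [hg0] at h2 ⊢
        linarith
    have hl : Integrable (fun x => 2 * c * ∑ i, (I i).indicator (1 : X → ℝ) x) μ :=
      (integrable_finsetSum _ fun i _ => hint _ (hIm i) (hIf i)).const_mul _
    have hr2 : ∀ i j, Integrable
        (fun x => if rel i j then (I i ∩ Y j).indicator (1 : X → ℝ) x else 0) μ := by
      intro i j
      split_ifs
      · exact hint _ ((hIm i).inter (hYm j)) (hIYf i j)
      · exact integrable_zero _ _ _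
    have hr1 : Integrable (fun x => n * ∑ i, ∑ j,
        if rel i j then (I i ∩ Y j).indicator (1 : X → ℝ) x else 0) μ :=
      (integrable_finsetSum _ fun i _ => integrable_finsetSum _ fun j _ => hr2 i j).const_mul _
    have hr0 : Integrable (fun x => c ^ 2 * U.indicator (1 : X → ℝ) x) μ :=
      (hint _ hUm hUf).const_mul _
    have := integral_mono hl (hr0.add hr1) h1
    simp only [Pi.add_apply] at this
    rw [integral_const_mul, integral_finsetSum _ fun i _ => hint _ (hIm i) (hIf i),
      integral_add hr0 hr1, integral_const_mul, integral_const_mul, integral_indicator_one hUm,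
      integral_finsetSum _ fun i _ => integrable_finsetSum _ fun j _ => hr2 i j] at this
    simp only [integral_indicator_one (hIm _)] at this
    refine this.trans_eq ?_
    congr 2
    refine Finset.sum_congr rfl fun i _ => ?_
    rw [integral_finsetSum _ fun j _ => hr2 i j]
    refine Finset.sum_congr rfl fun j _ => ?_
    split_ifs
    · rw [integral_indicator_one ((hIm i).inter (hYm j))]
    · simp
  set m := ∑ i, μ.real (I i)
  have hm : 0 ≤ m := Finset.sum_nonneg fun i _ => measureReal_nonneg
  rcases (measureReal_nonneg : 0 ≤ μ.real U).eq_or_lt with h0 | h0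
  · have : m = 0 := by
      refine Finset.sum_eq_zero fun i _ => ?_
      exact measureReal_mono_null (subset_iUnion I i) h0.symm hUf
    rw [this, ← h0]; simp
  · have := key (m / μ.real U) (by positivity)
    have h3 : m ^ 2 / μ.real U ≤ n * ∑ i, ∑ j, if rel i j then μ.real (I i ∩ Y j) else 0 := by
      have e1 : 2 * (m / μ.real U) * m = 2 * (m ^ 2 / μ.real U) := by ring
      have e2 : (m / μ.real U) ^ 2 * μ.real U = m ^ 2 / μ.real U := by field_simp
      rw [e1, e2] at this
      linarith
    rwa [div_le_iff₀' h0] at h3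

/-- The part of `Y i` where a fixed fraction of the sets through the point is in class `c`
relative to `i`. -/
def dominatedPart {κ : Type*} [Fintype κ] [DecidableEq κ] (Y : ι → Set X) (cls : ι → ι → κ) (c : κ)
    (i : ι) : Set X :=
  Y i ∩ {x | ∑ j, (Y j).indicator (1 : X → ℝ) x ≤
    Fintype.card κ * ∑ j, if cls i j = c then (Y j).indicator (1 : X → ℝ) x else 0}

theorem measurableSet_dominatedPart {κ : Type*} [Fintype κ] [DecidableEq κ] {Y : ι → Set X}
    (hYm : ∀ i, MeasurableSet (Y i)) (cls : ι → ι → κ) (c : κ) (i : ι) :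
    MeasurableSet (dominatedPart Y cls c i) := by
  refine (hYm i).inter (measurableSet_le ?_ ?_)
  · exact Finset.measurable_fun_sum _ fun j _ => measurable_one.indicator (hYm j)
  · refine (Finset.measurable_fun_sum _ fun j _ => ?_).const_mul _
    split_ifs
    · exact measurable_one.indicator (hYm j)
    · exact measurable_const

/-- At a point of `Y i` the classes partition all sets through the point, so some class holds at
least the average share. Hence the dominated parts cover `Y i`, and one class is then best for the
total mass. -/
theorem exists_dominatedPart {κ : Type*} [Fintype κ] [Nonempty κ] [DecidableEq κ] {Y : ι → Set X}
    (hYf : ∀ i, μ (Y i) ≠ ∞) (cls : ι → ι → κ) :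
    ∃ c, ∑ i, μ.real (Y i) ≤ Fintype.card κ * ∑ i, μ.real (dominatedPart Y cls c i) := by
  have hcov : ∀ i, Y i ⊆ ⋃ c, dominatedPart Y cls c i := by
    intro i x hx
    by_contra hcon
    simp only [mem_iUnion, dominatedPart, mem_inter_iff, mem_ofPred_eq, not_exists, not_and, not_le] at hcon
    have h1 : ∑ c : κ, (Fintype.card κ : ℝ) *
        ∑ j, (if cls i j = c then (Y j).indicator (1 : X → ℝ) x else 0) <
        ∑ c : κ, ∑ j, (Y j).indicator (1 : X → ℝ) x :=
      Finset.sum_lt_sum_of_nonempty Finset.univ_nonempty fun c _ => hcon c hx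
    rw [← Finset.mul_sum, Finset.sum_comm] at h1
    simp at h1
  have h1 : ∑ i, μ.real (Y i) ≤ ∑ c : κ, ∑ i, μ.real (dominatedPart Y cls c i) := by
    rw [Finset.sum_comm]
    refine Finset.sum_le_sum fun i _ => ?_
    have hf : μ (⋃ c, dominatedPart Y cls c i) ≠ ∞ :=
      measure_ne_top_of_subset (iUnion_subset fun c x hx => hx.1) (hYf i)
    exact (measureReal_mono (hcov i) hf).trans (measureReal_iUnion_fintype_le _)
  obtain ⟨c, -, hc⟩ := Finset.exists_max_image Finset.univ
    (fun c : κ => ∑ i, μ.real (dominatedPart Y cls c i)) Finset.univ_nonempty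
  refine ⟨c, h1.trans ?_⟩
  have := Finset.sum_le_card_nsmul Finset.univ _ _ hc
  simpa using this

/-- Pigeonholing incidences `x ∈ I i` according to the value of `⌊u i x / h⌋`, relative to the
number of indices `j` that may contribute to a given value. -/
theorem exists_cell [DecidableEq ι] (I : ι → Set X)
    (hIf : ∀ i, μ (I i) ≠ ∞) (u : ι → X → ℝ) (h : ℝ)
    (S : Finset ι) (T : ι → ℤ → Prop) [∀ j k, Decidable (T j k)] {D : ℝ} (hD : 0 ≤ D)
    (hT : ∀ j ∈ S, ∃ a : ℝ, ∀ k, T j k → |(k : ℝ) - a| ≤ D)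
    (hself : ∀ i, ∀ x ∈ I i, i ∈ S ∧ T i ⌊u i x / h⌋) {l : ℝ} (hl : 0 ≤ l)
    (hmass : l * S.card ≤ ∑ i, μ.real (I i)) (hpos : 0 < ∑ i, μ.real (I i)) :
    ∃ k : ℤ, 0 < ∑ i, μ.real (I i ∩ {x | ⌊u i x / h⌋ = k}) ∧
      l / (2 * (2 * D + 1)) * ((S.filter fun j => T j k).card : ℝ) ≤
        ∑ i, μ.real (I i ∩ {x | ⌊u i x / h⌋ = k}) := by
  choose! a ha using hT
  have hmem : ∀ j ∈ S, ∀ k, T j k → k ∈ Finset.Icc ⌈a j - D⌉ ⌊a j + D⌋ := by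
    intro j hj k hk
    have := abs_le.1 (ha j hj k hk)
    rw [Finset.mem_Icc, Int.ceil_le, Int.le_floor]
    constructor <;> linarith
  set K : Finset ℤ := S.biUnion fun j => Finset.Icc ⌈a j - D⌉ ⌊a j + D⌋ with hK
  have hsum : ∑ i, μ.real (I i) ≤ ∑ k ∈ K, ∑ i, μ.real (I i ∩ {x | ⌊u i x / h⌋ = k}) := by
    rw [Finset.sum_comm]
    refine Finset.sum_le_sum fun i _ => ?_
    have hsub : I i ⊆ ⋃ k ∈ K, I i ∩ {x | ⌊u i x / h⌋ = k} := by
      intro x hx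
      obtain ⟨hi, hTi⟩ := hself i x hx
      simp only [mem_iUnion]
      exact ⟨_, Finset.mem_biUnion.2 ⟨i, hi, hmem i hi _ hTi⟩, hx, rfl⟩
    have hf : μ (⋃ k ∈ K, I i ∩ {x | ⌊u i x / h⌋ = k}) ≠ ∞ :=
      measure_ne_top_of_subset (iUnion₂_subset fun k _ => inter_subset_left) (hIf i)
    exact (measureReal_mono hsub hf).trans (measureReal_biUnion_finset_le _ _)
  -- If every cell fell short, then, since each `j` contributes to at most `2 D + 1` cells, the
  -- total mass would be at most half of itself. This is the reason for the extra factor `2`.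
  by_contra! hcon
  have hle : ∀ k ∈ K, ∑ i, μ.real (I i ∩ {x | ⌊u i x / h⌋ = k}) ≤
      l / (2 * (2 * D + 1)) * ((S.filter fun j => T j k).card : ℝ) := by
    intro k _
    by_cases h0 : 0 < ∑ i, μ.real (I i ∩ {x | ⌊u i x / h⌋ = k})
    · exact (hcon k h0).le
    · exact (not_lt.1 h0).trans (by positivity)
  have hcount : ∑ k ∈ K, ((S.filter fun j => T j k).card : ℝ) ≤ (2 * D + 1) * S.card := by
    have e : ∀ k, ((S.filter fun j => T j k).card : ℝ) = ∑ j ∈ S, if T j k then (1 : ℝ) else 0 := by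
      intro k; simp
    simp only [e]
    rw [Finset.sum_comm, mul_comm, ← nsmul_eq_mul]
    refine Finset.sum_le_card_nsmul _ _ _ fun j hj => ?_
    calc ∑ k ∈ K, (if T j k then (1 : ℝ) else 0) = ((K.filter fun k => T j k).card : ℝ) := by simp
      _ ≤ ((Finset.Icc ⌈a j - D⌉ ⌊a j + D⌋).card : ℝ) := by
        exact_mod_cast Finset.card_le_card fun k hk => hmem j hj k (Finset.mem_filter.1 hk).2
      _ ≤ 2 * D + 1 := by
        rw [Int.card_Icc]
        have h1 : (⌊a j + D⌋ : ℝ) ≤ a j + D := Int.floor_le _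
        have h2 : a j - D ≤ (⌈a j - D⌉ : ℝ) := Int.le_ceil _
        have h3 : (((⌊a j + D⌋ + 1 - ⌈a j - D⌉).toNat : ℤ) : ℝ) ≤ 2 * D + 1 := by
          rcases le_total 0 (⌊a j + D⌋ + 1 - ⌈a j - D⌉) with h4 | h4
          · rw [Int.toNat_of_nonneg h4]; push_cast; linarith
          · rw [Int.toNat_of_nonpos h4]; push_cast; linarith
        exact_mod_cast h3
  have h1 : ∑ i, μ.real (I i) ≤ l * S.card / 2 := by
    refine hsum.trans ((Finset.sum_le_sum hle).trans ?_)
    rw [← Finset.mul_sum]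
    refine (mul_le_mul_of_nonneg_left hcount (by positivity)).trans_eq ?_
    field_simp
  linarith

end Measure

/-! ### Averaging over balls and volumes of parallelepipeds. -/

/-- By Tonelli, the integral over `x` of `|B(x, r) ∩ G|` is `|B(0, r)| |G|`, and the integrand
vanishes off `Z`. It is applied by contradiction, to find a ball in which `G` is dense. -/
theorem measureReal_ball_mul_le {G Z : Set (EuclideanSpace ℝ (Fin 3))} (hG : MeasurableSet G)
    (hGf : volume G ≠ ∞) (hZm : MeasurableSet Z) (hZf : volume Z ≠ ∞) {r : ℝ}
    (hZ : ∀ x, ∀ y ∈ G, dist x y < r → x ∈ Z) {τ : ℝ} (hτ : 0 ≤ τ)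
    (h : ∀ x, volume.real (Metric.ball x r ∩ G) ≤ τ) :
    volume.real (Metric.ball (0 : EuclideanSpace ℝ (Fin 3)) r) * volume.real G ≤
      τ * volume.real Z := by
  have h1 : ∫⁻ x, volume (Metric.ball x r ∩ G) =
      volume (Metric.ball (0 : EuclideanSpace ℝ (Fin 3)) r) * volume G := by
    have hm : MeasurableSet {p : EuclideanSpace ℝ (Fin 3) × EuclideanSpace ℝ (Fin 3) |
        p.2 ∈ Metric.ball p.1 r ∩ G} := by
      refine MeasurableSet.inter ?_ (measurable_snd hG)
      exact measurableSet_lt (measurable_snd.dist measurable_fst) measurable_const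
    have e1 := Measure.prod_apply (μ := (volume : Measure (EuclideanSpace ℝ (Fin 3))))
      (ν := (volume : Measure (EuclideanSpace ℝ (Fin 3)))) hm
    have e2 := Measure.prod_apply_symm (μ := (volume : Measure (EuclideanSpace ℝ (Fin 3))))
      (ν := (volume : Measure (EuclideanSpace ℝ (Fin 3)))) hm
    have e3 : ∀ x : EuclideanSpace ℝ (Fin 3), Prod.mk x ⁻¹'
        {p : EuclideanSpace ℝ (Fin 3) × EuclideanSpace ℝ (Fin 3) |
          p.2 ∈ Metric.ball p.1 r ∩ G} = Metric.ball x r ∩ G := fun x => rfl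
    simp only [e3] at e1
    rw [← e1, e2, ← setLIntegral_const G, ← lintegral_indicator hG]
    refine lintegral_congr fun y => ?_
    by_cases hy : y ∈ G
    · rw [indicator_of_mem hy]
      have : (fun x => (x, y)) ⁻¹' {p : EuclideanSpace ℝ (Fin 3) × EuclideanSpace ℝ (Fin 3) |
          p.2 ∈ Metric.ball p.1 r ∩ G} = Metric.ball y r := by
        ext x
        simp [hy, dist_comm]
      rw [this, Measure.addHaar_ball_center]
    · rw [indicator_of_notMem hy]
      have : (fun x => (x, y)) ⁻¹' {p : EuclideanSpace ℝ (Fin 3) × EuclideanSpace ℝ (Fin 3) |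
          p.2 ∈ Metric.ball p.1 r ∩ G} = ∅ := by
        ext x
        simp [hy]
      rw [this, measure_empty]
  have h2 : ∫⁻ x, volume (Metric.ball x r ∩ G) ≤ ENNReal.ofReal τ * volume Z := by
    rw [← setLIntegral_const, ← lintegral_indicator hZm]
    refine lintegral_mono fun x => ?_
    by_cases hx : x ∈ Z
    · rw [indicator_of_mem hx]
      have hf : volume (Metric.ball x r ∩ G) ≠ ∞ := measure_ne_top_of_subset inter_subset_right hGf
      rw [← ENNReal.ofReal_toReal hf]
      exact ENNReal.ofReal_le_ofReal (h x)
    · rw [indicator_of_notMem hx, nonpos_iff_eq_zero]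
      convert measure_empty (μ := (volume : Measure (EuclideanSpace ℝ (Fin 3))))
      refine eq_empty_of_forall_notMem fun y hy => hx (hZ x y hy.2 ?_)
      rw [dist_comm]; exact hy.1
  rw [h1] at h2
  have := ENNReal.toReal_mono (ENNReal.mul_ne_top ENNReal.ofReal_ne_top hZf) h2
  rwa [ENNReal.toReal_mul, ENNReal.toReal_mul, ENNReal.toReal_ofReal hτ] at this

/-- The volume of a parallelepiped. -/
theorem volume_parallelepiped (A : Matrix (Fin 3) (Fin 3) ℝ) (hA : A.det ≠ 0) (c h : Fin 3 → ℝ)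
    (hh : ∀ k, 0 ≤ h k) :
    volume {x : EuclideanSpace ℝ (Fin 3) | ∀ k, |∑ j, A k j * x j - c k| ≤ h k} =
      ENNReal.ofReal (8 * (h 0 * h 1 * h 2) / |A.det|) := by
  have e1 := (EuclideanSpace.volume_preserving_symm_measurableEquiv_toLp (Fin 3)).measure_preimage_equiv
    {x : Fin 3 → ℝ | ∀ k, |∑ j, A k j * x j - c k| ≤ h k}
  have e2 : {x : Fin 3 → ℝ | ∀ k, |∑ j, A k j * x j - c k| ≤ h k} =
      (Matrix.toLin' A) ⁻¹' (Icc (fun k => c k - h k) (fun k => c k + h k)) := by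
    ext x
    simp only [mem_ofPred_eq, mem_preimage, mem_Icc, Pi.le_def, Matrix.toLin'_apply, Matrix.mulVec,
      dotProduct, abs_le, ← forall_and]
    refine forall_congr' fun k => ?_
    constructor <;> rintro ⟨h1, h2⟩ <;> constructor <;> linarith
  rw [e2, Measure.addHaar_preimage_linearMap _ (by rwa [LinearMap.det_toLin']), Real.volume_Icc_pi,
    LinearMap.det_toLin', ← e2] at e1
  refine Eq.trans ?_ (e1.trans ?_)
  · rfl
  · have h3 : ∀ k, c k + h k - (c k - h k) = 2 * h k := fun k => by ring
    simp only [h3, Fin.prod_univ_three]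
    rw [← ENNReal.ofReal_mul (by linarith [hh 0]), ← ENNReal.ofReal_mul (by
      have := hh 0; have := hh 1; positivity), ← ENNReal.ofReal_mul (abs_nonneg _), abs_inv]
    congr 1
    ring

/-- The scalar form in which box volumes and overlaps are estimated: three slabs and the determinant
of their normals. -/
theorem volume_ne_top_and_measureReal_le {S : Set (EuclideanSpace ℝ (Fin 3))}
    {a₀ a₁ a₂ a b₀ b₁ b₂ b c₀ c₁ c₂ c h₀ h₁ h₂ d : ℝ}
    (ha : ∀ x ∈ S, |a₀ * x 0 + a₁ * x 1 + a₂ * x 2 - a| ≤ h₀)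
    (hb : ∀ x ∈ S, |b₀ * x 0 + b₁ * x 1 + b₂ * x 2 - b| ≤ h₁)
    (hc : ∀ x ∈ S, |c₀ * x 0 + c₁ * x 1 + c₂ * x 2 - c| ≤ h₂)
    (hh₀ : 0 ≤ h₀) (hh₁ : 0 ≤ h₁) (hh₂ : 0 ≤ h₂)
    (hd : a₀ * (b₁ * c₂ - b₂ * c₁) - a₁ * (b₀ * c₂ - b₂ * c₀) + a₂ * (b₀ * c₁ - b₁ * c₀) = d)
    (hd0 : d ≠ 0) :
    volume S ≠ ∞ ∧ volume.real S ≤ 8 * (h₀ * h₁ * h₂) / |d| := by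
  have hdet : (!![a₀, a₁, a₂; b₀, b₁, b₂; c₀, c₁, c₂] : Matrix (Fin 3) (Fin 3) ℝ).det = d := by
    rw [Matrix.det_fin_three, ← hd]
    simp
    ring
  have hv := volume_parallelepiped !![a₀, a₁, a₂; b₀, b₁, b₂; c₀, c₁, c₂] (by rwa [hdet])
    ![a, b, c] ![h₀, h₁, h₂] (by intro k; fin_cases k <;> simpa)
  rw [hdet] at hv
  have hsub : S ⊆ {x : EuclideanSpace ℝ (Fin 3) | ∀ k,
      |∑ j, (!![a₀, a₁, a₂; b₀, b₁, b₂; c₀, c₁, c₂] : Matrix (Fin 3) (Fin 3) ℝ) k j * x j -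
        ![a, b, c] k| ≤ ![h₀, h₁, h₂] k} := by
    intro x hx k
    have h0 := ha x hx
    have h1 := hb x hx
    have h2 := hc x hx
    fin_cases k <;> simpa [Fin.sum_univ_three]
  have hle := measure_mono (μ := volume) hsub
  rw [hv] at hle
  refine ⟨ne_top_of_le_ne_top ENNReal.ofReal_ne_top hle, ?_⟩
  have := ENNReal.toReal_mono ENNReal.ofReal_ne_top hle
  rwa [ENNReal.toReal_ofReal (by simp; positivity)] at this

/-! ### Sheared boxes: volume, intersections, mutual position. -/

/-- Parameters of a sheared box in `ℝ³`. -/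
structure ShearParam where
  p : ℝ
  q : ℝ
  c : ℝ
  v : ℝ
  e : ℝ

namespace ShearParam

variable (P Q : ShearParam) {s t : ℝ} {x y : EuclideanSpace ℝ (Fin 3)}

def f₀ (x : EuclideanSpace ℝ (Fin 3)) : ℝ := x 0 - P.p * x 1 - P.q * x 2 - P.c

def f₁ (x : EuclideanSpace ℝ (Fin 3)) : ℝ := x 1 - P.v * x 2 - P.e

/-- The sheared box of half-thickness `s`, half-width `t` and height `2`. -/
def box (s t : ℝ) : Set (EuclideanSpace ℝ (Fin 3)) :=
  {x | |P.f₀ x| ≤ s ∧ |P.f₁ x| ≤ t ∧ |x 2| ≤ 1}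

variable {P Q}

theorem continuous_f₀ : Continuous P.f₀ := by unfold f₀; fun_prop

theorem continuous_f₁ : Continuous P.f₁ := by unfold f₁; fun_prop

theorem measurableSet_box : MeasurableSet (P.box s t) := by
  have e : P.box s t = {x | |P.f₀ x| ≤ s} ∩ ({x | |P.f₁ x| ≤ t} ∩ {x | |x 2| ≤ 1}) := rfl
  have h2 : Continuous fun x : EuclideanSpace ℝ (Fin 3) => |x 2| := by fun_prop
  rw [e]
  exact ((isClosed_le continuous_f₀.abs continuous_const).inter
    ((isClosed_le continuous_f₁.abs continuous_const).inter
      (isClosed_le h2 continuous_const))).measurableSet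

theorem volume_inter_slab_le {z h : ℝ} (hs : 0 ≤ s) (ht : 0 ≤ t) (hh : 0 ≤ h)
    {S : Set (EuclideanSpace ℝ (Fin 3))} (hS : S ⊆ P.box s t) (hz : ∀ x ∈ S, |x 2 - z| ≤ h) :
    volume S ≠ ∞ ∧ volume.real S ≤ 8 * s * t * h := by
  have := volume_ne_top_and_measureReal_le (S := S) (a₀ := 1) (a₁ := -P.p) (a₂ := -P.q)
    (a := P.c) (b₀ := 0) (b₁ := 1) (b₂ := -P.v) (b := P.e) (c₀ := 0) (c₁ := 0) (c₂ := 1) (c := z)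
    (h₀ := s) (h₁ := t) (h₂ := h) (d := 1)
    (fun x hx => by
      have := (hS hx).1
      unfold f₀ at this
      convert this using 2; ring)
    (fun x hx => by
      have := (hS hx).2.1
      unfold f₁ at this
      convert this using 2; ring)
    (fun x hx => by convert hz x hx using 2; ring) hs ht hh (by ring) one_ne_zero
  refine ⟨this.1, this.2.trans_eq ?_⟩
  simp; ring

theorem volume_box_ne_top (hs : 0 ≤ s) (ht : 0 ≤ t) : volume (P.box s t) ≠ ∞ :=
  (volume_inter_slab_le (z := 0) hs ht zero_le_one subset_rfl
    (fun x hx => by simpa using hx.2.2)).1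

theorem measureReal_box_le (hs : 0 ≤ s) (ht : 0 ≤ t) : volume.real (P.box s t) ≤ 8 * s * t := by
  have := (volume_inter_slab_le (P := P) (z := 0) hs ht zero_le_one subset_rfl
    (fun x hx => by simpa using hx.2.2)).2
  linarith

theorem convex_box : Convex ℝ (P.box s t) := by
  intro x hx y hy a b ha hb hab
  obtain ⟨hx0, hx1, hx2⟩ := hx
  obtain ⟨hy0, hy1, hy2⟩ := hy
  simp only [f₀, f₁, abs_le] at *
  refine ⟨?_, ?_, ?_⟩
  · have e : (a • x + b • y) 0 - P.p * (a • x + b • y) 1 - P.q * (a • x + b • y) 2 - P.c =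
        a * (x 0 - P.p * x 1 - P.q * x 2 - P.c) + b * (y 0 - P.p * y 1 - P.q * y 2 - P.c) := by
      have : b = 1 - a := by linarith
      subst this
      simp; ring
    simp only [f₀]
    rw [e, abs_le]
    have : b = 1 - a := by linarith
    subst this
    constructor <;> nlinarith
  · have e : (a • x + b • y) 1 - P.v * (a • x + b • y) 2 - P.e =
        a * (x 1 - P.v * x 2 - P.e) + b * (y 1 - P.v * y 2 - P.e) := by
      have : b = 1 - a := by linarith
      subst this
      simp; ring
    simp only [f₁]
    rw [e, abs_le]
    have : b = 1 - a := by linarith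
    subst this
    constructor <;> nlinarith
  · have : b = 1 - a := by linarith
    subst this
    rw [abs_le]
    simp
    constructor <;> nlinarith

variable (P Q)

/-- The angular separation of two sheared boxes within their planes, at least `t`. -/
noncomputable def spread (t : ℝ) : ℝ := max t |Q.v - P.v|

/-- The thickness of the smallest box around `P`, of length `t / spread`, which contains the part of
`Q` near an intersection point. -/
noncomputable def thickness (s t : ℝ) : ℝ :=
  max s (max (|Q.p - P.p| * t) (|Q.q - P.q + P.v * (Q.p - P.p)| * t / P.spread Q t))

variable {P Q}

/-- Subtracting the two `f₀` conditions leaves a slab of half-width `2 s` in `(x₁, x₂)`. If the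
`p`-difference realises the thickness, the third slab is a range of `x₂` of half-width `2 t / M`,
which comes from the two `f₁` conditions, or from `|x₂| ≤ 1` when `M = t`. Otherwise the third slab
is `f₁` of `P`. Strict inequality in `h` rules out a thickness realised by `s` itself. -/
theorem measureReal_box_inter_box_le (hs : 0 < s) (ht : 0 < t) (h : s < P.thickness Q s t) :
    volume.real (P.box s t ∩ Q.box s t) ≤ 32 * s ^ 2 * t ^ 2 / (P.spread Q t * P.thickness Q s t) := by
  set M := P.spread Q t with hM
  set w := P.thickness Q s t with hw
  have hMt : t ≤ M := le_max_left _ _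
  have hM0 : 0 < M := ht.trans_le hMt
  have hw0 : 0 < w := hs.trans h
  have hdiff : ∀ x ∈ P.box s t ∩ Q.box s t, |0 * x 0 + (Q.p - P.p) * x 1 + (Q.q - P.q) * x 2 -
      (P.c - Q.c)| ≤ 2 * s := by
    rintro x ⟨hx, hy⟩
    have h1 := abs_le.1 hx.1
    have h2 := abs_le.1 hy.1
    simp only [f₀] at h1 h2
    rw [abs_le]; constructor <;> linarith
  have hf0 : ∀ x ∈ P.box s t ∩ Q.box s t, |1 * x 0 + (-P.p) * x 1 + (-P.q) * x 2 - P.c| ≤ s := by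
    rintro x ⟨hx, -⟩
    have := hx.1
    simp only [f₀] at this
    convert this using 2; ring
  have hf1 : ∀ x ∈ P.box s t ∩ Q.box s t, |0 * x 0 + 1 * x 1 + (-P.v) * x 2 - P.e| ≤ t := by
    rintro x ⟨hx, -⟩
    have := hx.2.1
    simp only [f₁] at this
    convert this using 2; ring
  have hcases : w = |Q.p - P.p| * t ∨ w = |Q.q - P.q + P.v * (Q.p - P.p)| * t / M := by
    rcases max_choice s (max (|Q.p - P.p| * t) (|Q.q - P.q + P.v * (Q.p - P.p)| * t / M)) with h1 | h1
    · exact absurd h1 h.ne'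
    · rcases max_choice (|Q.p - P.p| * t) (|Q.q - P.q + P.v * (Q.p - P.p)| * t / M) with h2 | h2
      · exact Or.inl (h1.trans h2)
      · exact Or.inr (h1.trans h2)
  rcases hcases with h1 | h1
  · have hθ : Q.p - P.p ≠ 0 := by
      intro h0
      rw [h0, abs_zero, zero_mul] at h1
      exact hw0.ne' h1
    have hx2 : ∃ z, ∀ x ∈ P.box s t ∩ Q.box s t, |0 * x 0 + 0 * x 1 + 1 * x 2 - z| ≤ 2 * t / M := by
      rcases max_choice t |Q.v - P.v| with h2 | h2
      · refine ⟨0, fun x hx => ?_⟩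
        have : M = t := h2
        rw [this, mul_div_assoc, div_self ht.ne']
        have h5 := abs_le.1 hx.1.2.2
        rw [abs_le]; constructor <;> linarith
      · have hM' : M = |Q.v - P.v| := h2
        have hv : Q.v - P.v ≠ 0 := by
          intro h0
          rw [h0, abs_zero] at hM'
          exact hM0.ne' hM'
        refine ⟨(P.e - Q.e) / (Q.v - P.v), fun x hx => ?_⟩
        rw [le_div_iff₀ hM0, hM', ← abs_mul]
        have e : (0 * x 0 + 0 * x 1 + 1 * x 2 - (P.e - Q.e) / (Q.v - P.v)) * (Q.v - P.v) =
            P.f₁ x - Q.f₁ x := by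
          simp only [f₁]
          field_simp
          ring
        rw [e]
        have h3 := abs_le.1 hx.1.2.1
        have h4 := abs_le.1 hx.2.2.1
        rw [abs_le]; constructor <;> linarith
    obtain ⟨z, hz⟩ := hx2
    refine (volume_ne_top_and_measureReal_le (d := Q.p - P.p) hf0 hdiff hz hs.le (by positivity)
      (by positivity) (by ring) hθ).2.trans_eq ?_
    have : |Q.p - P.p| ≠ 0 := abs_ne_zero.2 hθ
    rw [h1]
    field_simp
    ring
  · have hα : Q.q - P.q + P.v * (Q.p - P.p) ≠ 0 := by
      intro h0
      rw [h0, abs_zero, zero_mul, zero_div] at h1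
      exact hw0.ne' h1
    refine (volume_ne_top_and_measureReal_le (d := -(Q.q - P.q + P.v * (Q.p - P.p))) hf0 hdiff hf1
      hs.le (by positivity) ht.le (by ring) (neg_ne_zero.2 hα)).2.trans ?_
    rw [abs_neg, h1]
    have : |Q.q - P.q + P.v * (Q.p - P.p)| ≠ 0 := abs_ne_zero.2 hα
    have e : 32 * s ^ 2 * t ^ 2 / (M * (|Q.q - P.q + P.v * (Q.p - P.p)| * t / M)) =
      32 * s ^ 2 * t / |Q.q - P.q + P.v * (Q.p - P.p)| := by
      field_simp
    rw [e]
    refine div_le_div_of_nonneg_right ?_ (abs_nonneg _)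
    nlinarith [mul_pos (pow_pos hs 2) ht]

/-- Points of `Q` at height at most `l` from an intersection point lie near `P`. -/
theorem abs_f₀_le_of_mem_of_mem (hs : 0 < s) (ht : 0 < t) {l : ℝ}
    (hx : x ∈ P.box s t) (hx' : x ∈ Q.box s t) (hy : y ∈ Q.box s t) (hxy : |y 2 - x 2| ≤ l) :
    |P.f₀ y| ≤ 3 * s + 2 * P.thickness Q s t + 2 * P.thickness Q s t * P.spread Q t * l / t := by
  set M := P.spread Q t with hM
  set w := P.thickness Q s t with hw
  have hM0 : 0 < M := ht.trans_le (le_max_left _ _)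
  have hw0 : 0 < w := hs.trans_le (le_max_left _ _)
  have hv : |Q.v - P.v| ≤ M := le_max_right _ _
  have hp : |Q.p - P.p| * t ≤ w := (le_max_left _ _).trans (le_max_right _ _)
  have hq : |Q.q - P.q + P.v * (Q.p - P.p)| * t ≤ w * M := by
    rw [← div_le_iff₀ hM0]
    exact (le_max_right _ _).trans (le_max_right _ _)
  -- Exact expansion of `P.f₀` along `Q`. The two entries of `thickness` control the coefficients,
  -- and the last term is their interaction with the angle.
  have e : P.f₀ y = P.f₀ x + (Q.f₀ y - Q.f₀ x) + (Q.p - P.p) * (Q.f₁ y - Q.f₁ x) +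
      (Q.q - P.q + P.v * (Q.p - P.p)) * (y 2 - x 2) +
      (Q.v - P.v) * (Q.p - P.p) * (y 2 - x 2) := by
    simp only [f₀, f₁]; ring
  have h1 : |Q.f₀ y - Q.f₀ x| ≤ s + s := (abs_sub _ _).trans (add_le_add hy.1 hx'.1)
  have h2 : |(Q.p - P.p) * (Q.f₁ y - Q.f₁ x)| ≤ 2 * w := by
    rw [abs_mul]
    have h3 : |Q.f₁ y - Q.f₁ x| ≤ t + t := (abs_sub _ _).trans (add_le_add hy.2.1 hx'.2.1)
    calc _ ≤ |Q.p - P.p| * (t + t) := by gcongr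
      _ ≤ _ := by linarith
  have h3 : |(Q.q - P.q + P.v * (Q.p - P.p)) * (y 2 - x 2)| ≤ w * M / t * l := by
    rw [abs_mul]
    exact mul_le_mul ((le_div_iff₀ ht).2 hq) hxy (abs_nonneg _) (by positivity)
  have h4 : |(Q.v - P.v) * (Q.p - P.p) * (y 2 - x 2)| ≤ M * (w / t) * l := by
    rw [abs_mul, abs_mul]
    exact mul_le_mul (mul_le_mul hv ((le_div_iff₀ ht).2 hp) (abs_nonneg _) hM0.le) hxy
      (abs_nonneg _) (by positivity)
  have h0 := hx.1
  rw [e]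
  have e2 : 2 * w * M * l / t = w * M / t * l + M * (w / t) * l := by ring
  rw [e2]
  have a1 := abs_add_le (P.f₀ x + (Q.f₀ y - Q.f₀ x) + (Q.p - P.p) * (Q.f₁ y - Q.f₁ x) +
      (Q.q - P.q + P.v * (Q.p - P.p)) * (y 2 - x 2)) ((Q.v - P.v) * (Q.p - P.p) * (y 2 - x 2))
  have a2 := abs_add_le (P.f₀ x + (Q.f₀ y - Q.f₀ x) + (Q.p - P.p) * (Q.f₁ y - Q.f₁ x))
      ((Q.q - P.q + P.v * (Q.p - P.p)) * (y 2 - x 2))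
  have a3 := abs_add_le (P.f₀ x + (Q.f₀ y - Q.f₀ x)) ((Q.p - P.p) * (Q.f₁ y - Q.f₁ x))
  have a4 := abs_add_le (P.f₀ x) (Q.f₀ y - Q.f₀ x)
  linarith

/-- The quantity equals `P.f₁ x + Q.f₁ y - Q.f₁ x`: along `Q`, the function `P.f₁` drifts with slope
`Q.v - P.v`. -/
theorem abs_f₁_sub_le_of_mem_of_mem
    (hx : x ∈ P.box s t) (hx' : x ∈ Q.box s t) (hy : y ∈ Q.box s t) :
    |P.f₁ y - (Q.v - P.v) * (y 2 - x 2)| ≤ 3 * t := by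
  have h1 := abs_le.1 hx.2.1
  have h2 := abs_le.1 hx'.2.1
  have h3 := abs_le.1 hy.2.1
  simp only [f₁] at *
  rw [abs_le]; constructor <;> nlinarith

end ShearParam

/-! ### Localising incidences to an anisotropic cell. -/

theorem floor_div_eq_iff_mem {u h : ℝ} (hh : 0 < h) {k : ℤ} (hk : ⌊u / h⌋ = k) :
    k * h ≤ u ∧ u < (k + 1) * h := by
  rw [Int.floor_eq_iff, le_div_iff₀ hh, div_lt_iff₀ hh] at hk
  exact hk

theorem measurableSet_floor_div_eq {X : Type*} [MeasurableSpace X] {u : X → ℝ} (hu : Measurable u)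
    (h : ℝ) (k : ℤ) : MeasurableSet {x | ⌊u x / h⌋ = k} :=
  (Int.measurable_floor.comp (hu.div_const h)) (measurableSet_singleton k)

namespace ShearParam

section Close

variable {P Q : ShearParam} {s t M w : ℝ}

theorem abs_v_sub_le (h : P.spread Q t ≤ 2 * M) : |Q.v - P.v| ≤ 2 * M := (le_max_right _ _).trans h

theorem abs_p_sub_le (ht : 0 < t) (h : P.thickness Q s t ≤ 2 * w) :
    |Q.p - P.p| ≤ 2 * (w / t) := by
  rw [← mul_div_assoc, le_div_iff₀ ht]
  exact ((le_max_left _ _).trans (le_max_right _ _)).trans h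

theorem abs_q_sub_le (ht : 0 < t) (hM : 0 < M) (hw : 0 < w) (h : P.spread Q t ≤ 2 * M)
    (h' : P.thickness Q s t ≤ 2 * w) :
    |Q.q - P.q + P.v * (Q.p - P.p)| ≤ 4 * (w / (t / M)) := by
  have h0 : 0 < P.spread Q t := ht.trans_le (le_max_left _ _)
  have h1 : |Q.q - P.q + P.v * (Q.p - P.p)| * t / P.spread Q t ≤ 2 * w :=
    ((le_max_right _ _).trans (le_max_right _ _)).trans h'
  rw [div_le_iff₀ h0] at h1
  have e : 4 * (w / (t / M)) = 2 * w * (2 * M) / t := by field_simp; ring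
  rw [e, le_div_iff₀ ht]
  exact h1.trans (by gcongr)

end Close

/-- The accumulated loss of six applications of `exists_cell`, with `D = 3, 3, 7, 2 / r, 4, 7`. Only
the height loses more than a constant. -/
theorem cell_constant_le {l r : ℝ} (hl : 0 ≤ l) (hr0 : 0 < r) (hr1 : r ≤ 1) :
    l * r / 31752000 ≤ l / (2 * (2 * 3 + 1)) / (2 * (2 * 3 + 1)) / (2 * (2 * 7 + 1)) /
      (2 * (2 * (2 / r) + 1)) / (2 * (2 * 4 + 1)) / (2 * (2 * 7 + 1)) := by
  have h1 : 2 * (2 * (2 / r) + 1) ≤ 10 / r := by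
    rw [le_div_iff₀ hr0]
    have : 2 * (2 * (2 / r) + 1) * r = 8 + 2 * r := by field_simp; ring
    linarith
  have e : l * r / 31752000 = l / (2 * (2 * 3 + 1)) / (2 * (2 * 3 + 1)) / (2 * (2 * 7 + 1)) /
      (10 / r) / (2 * (2 * 4 + 1)) / (2 * (2 * 7 + 1)) := by
    field_simp; ring
  rw [e]
  gcongr

-- Pigeonholing successively in three parameters and three coordinates, always relative to the
-- number of boxes still able to contribute, so that the surviving mass is compared with `S.card`
-- rather than with the whole family. Since `p x₁ + q x₂ = p (x₁ - V x₂) + (q + V p) x₂`, the slope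
-- to fix is `q + V p`: its tolerance `w / (t / M)` over height `t / M`, like the tolerance `w / t`
-- of `p` over width `t`, produces an error of size `w`.
set_option maxHeartbeats 1000000 in
theorem exists_anisotropic_cell {ι : Type*} [Fintype ι] (P : ι → ShearParam) {s t M w : ℝ}
    (hs : 0 < s) (ht : 0 < t) (hM : t ≤ M) (hw : s ≤ w)
    (I : ι → Set (EuclideanSpace ℝ (Fin 3))) (hIm : ∀ i, MeasurableSet (I i))
    (hIb : ∀ i, I i ⊆ (P i).box s t) {l : ℝ} (hl : 0 ≤ l)
    (hmass : l * Fintype.card ι ≤ ∑ i, volume.real (I i)) (hpos : 0 < ∑ i, volume.real (I i)) :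
    ∃ (I' : ι → Set (EuclideanSpace ℝ (Fin 3))) (S : Finset ι) (V p q a₀ a₁ a₂ : ℝ),
      (∀ i, MeasurableSet (I' i)) ∧ (∀ i, I' i ⊆ I i) ∧
      (∀ i, ∀ x ∈ I' i, i ∈ S) ∧
      (∀ i, ∀ x ∈ I' i, ∀ j, (P i).spread (P j) t ≤ 2 * M → (P i).thickness (P j) s t ≤ 2 * w →
        x ∈ (P j).box s t → j ∈ S) ∧
      0 < ∑ i, volume.real (I' i) ∧
      l * (t / M) / 31752000 * S.card ≤ ∑ i, volume.real (I' i) ∧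
      (∀ i, ∀ x ∈ I' i, |(P i).v - V| ≤ M ∧ |(P i).p - p| ≤ w / t ∧
        |(P i).q + V * (P i).p - (q + V * p)| ≤ w / (t / M) ∧
        |x 0 - p * x 1 - q * x 2 - a₀| ≤ w ∧ |x 1 - V * x 2 - a₁| ≤ t ∧ |x 2 - a₂| ≤ t / M) := by
  classical
  set r := t / M with hr
  have hM0 : 0 < M := ht.trans_le hM
  have hw0 : 0 < w := hs.trans_le hw
  have hr0 : 0 < r := by positivity
  have hr1 : r ≤ 1 := (div_le_one hM0).2 hM
  have hMr : M * r = t := by rw [hr]; field_simp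
  have hwt : w / t * t = w := by field_simp
  have hwr : w / r * r = w := by field_simp
  have hMr' : 3 * M * (r / 2) = 3 / 2 * t := by rw [← hMr]; ring
  have hwt' : 3 * (w / t) * (t / 2) = 3 / 2 * w := by rw [← hwt]; field_simp
  have hwr' : 7 * (w / r) * (r / 2) = 7 / 2 * w := by rw [← hwr]; field_simp
  have hwt0 : 0 < w / t := by positivity
  have hwr0 : 0 < w / r := by positivity
  have hwtM : M * (w / t) = w / r := by rw [hr]; field_simp
  have hfin : ∀ J : ι → Set (EuclideanSpace ℝ (Fin 3)), (∀ i, J i ⊆ I i) → ∀ i,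
      volume (J i) ≠ ∞ := fun J hJ i =>
    measure_ne_top_of_subset ((hJ i).trans (hIb i)) (volume_box_ne_top hs.le ht.le)
  -- pigeonhole on `v`
  obtain ⟨k₁, hp₁, hm₁⟩ := exists_cell (μ := volume) I (hfin I fun i => subset_rfl)
    (fun i _ => (P i).v) M Finset.univ (fun j k => |(P j).v - k * M| ≤ 3 * M) (D := 3)
    (by norm_num)
    (fun j _ => ⟨(P j).v / M, fun k hk => by
      rw [abs_sub_comm, ← mul_le_mul_iff_of_pos_right hM0, ← abs_of_pos hM0, ← abs_mul,
        abs_of_pos hM0, sub_mul, div_mul_cancel₀ _ hM0.ne']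
      exact hk⟩)
    (fun i x _ => ⟨Finset.mem_univ _, by
      have := floor_div_eq_iff_mem hM0 (rfl : ⌊(P i).v / M⌋ = _)
      rw [abs_le]; constructor <;> linarith⟩) hl (by simpa using hmass) hpos
  set V : ℝ := k₁ * M with hV
  set I₁ := fun i => I i ∩ {x | ⌊(P i).v / M⌋ = k₁} with hI₁
  have hI₁V : ∀ i, ∀ x ∈ I₁ i, |(P i).v - V| ≤ M := by
    intro i x hx
    have := floor_div_eq_iff_mem hM0 hx.2
    rw [abs_le]; constructor <;> linarith
  have hI₁I : ∀ i, I₁ i ⊆ I i := fun i => inter_subset_left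
  have hI₁m : ∀ i, MeasurableSet (I₁ i) := fun i =>
    (hIm i).inter (measurableSet_floor_div_eq measurable_const _ _)
  set S₁ := Finset.univ.filter fun j => |(P j).v - k₁ * M| ≤ 3 * M with hS₁
  -- pigeonhole on `p`
  obtain ⟨k₂, hp₂, hm₂⟩ := exists_cell (μ := volume) I₁ (hfin I₁ hI₁I)
    (fun i _ => (P i).p) (w / t) S₁ (fun j k => |(P j).p - k * (w / t)| ≤ 3 * (w / t)) (D := 3)
    (by norm_num)
    (fun j _ => ⟨(P j).p / (w / t), fun k hk => by
      rw [abs_sub_comm, ← mul_le_mul_iff_of_pos_right hwt0, ← abs_of_pos hwt0, ← abs_mul,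
        abs_of_pos hwt0, sub_mul, div_mul_cancel₀ _ hwt0.ne']
      exact hk⟩)
    (fun i x hx => ⟨by
      have := hI₁V i x hx
      simp only [hS₁, Finset.mem_filter, Finset.mem_univ, true_and]
      linarith, by
      have := floor_div_eq_iff_mem hwt0 (rfl : ⌊(P i).p / (w / t)⌋ = _)
      rw [abs_le]; constructor <;> linarith⟩) (by positivity) hm₁ hp₁
  set p : ℝ := k₂ * (w / t) with hp
  set I₂ := fun i => I₁ i ∩ {x | ⌊(P i).p / (w / t)⌋ = k₂} with hI₂
  have hI₂p : ∀ i, ∀ x ∈ I₂ i, |(P i).p - p| ≤ w / t := by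
    intro i x hx
    have := floor_div_eq_iff_mem hwt0 hx.2
    rw [abs_le]; constructor <;> linarith
  have hI₂I₁ : ∀ i, I₂ i ⊆ I₁ i := fun i => inter_subset_left
  have hI₂m : ∀ i, MeasurableSet (I₂ i) := fun i =>
    (hI₁m i).inter (measurableSet_floor_div_eq measurable_const _ _)
  have hI₂S : ∀ i, ∀ x ∈ I₂ i, i ∈ S₁ := fun i x hx => by
    have := hI₁V i x (hI₂I₁ i hx)
    simp only [hS₁, Finset.mem_filter, Finset.mem_univ, true_and]
    linarith
  set S₂ := S₁.filter fun j => |(P j).p - k₂ * (w / t)| ≤ 3 * (w / t) with hS₂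
  -- pigeonhole on `q + V p`
  obtain ⟨k₃, hp₃, hm₃⟩ := exists_cell (μ := volume) I₂
    (hfin I₂ fun i => (hI₂I₁ i).trans (hI₁I i))
    (fun i _ => (P i).q + V * (P i).p) (w / r) S₂
    (fun j k => |(P j).q + V * (P j).p - k * (w / r)| ≤ 7 * (w / r)) (D := 7)
    (by norm_num)
    (fun j _ => ⟨((P j).q + V * (P j).p) / (w / r), fun k hk => by
      rw [abs_sub_comm, ← mul_le_mul_iff_of_pos_right hwr0, ← abs_of_pos hwr0, ← abs_mul,
        abs_of_pos hwr0, sub_mul, div_mul_cancel₀ _ hwr0.ne']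
      exact hk⟩)
    (fun i x hx => ⟨by
      have := hI₂p i x hx
      simp only [hS₂, Finset.mem_filter]
      exact ⟨hI₂S i x hx, by linarith⟩, by
      have := floor_div_eq_iff_mem hwr0 (rfl : ⌊((P i).q + V * (P i).p) / (w / r)⌋ = _)
      rw [abs_le]; constructor <;> linarith⟩) (by positivity) hm₂ hp₂
  set q : ℝ := k₃ * (w / r) - V * p with hq
  have hqV : q + V * p = k₃ * (w / r) := by rw [hq]; ring
  set I₃ := fun i => I₂ i ∩ {x | ⌊((P i).q + V * (P i).p) / (w / r)⌋ = k₃} with hI₃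
  have hI₃q : ∀ i, ∀ x ∈ I₃ i, |(P i).q + V * (P i).p - (q + V * p)| ≤ w / r := by
    intro i x hx
    have := floor_div_eq_iff_mem hwr0 hx.2
    rw [hqV, abs_le]; constructor <;> linarith
  have hI₃I₂ : ∀ i, I₃ i ⊆ I₂ i := fun i => inter_subset_left
  have hI₃m : ∀ i, MeasurableSet (I₃ i) := fun i =>
    (hI₂m i).inter (measurableSet_floor_div_eq measurable_const _ _)
  set S₃ := S₂.filter fun j => |(P j).q + V * (P j).p - k₃ * (w / r)| ≤ 7 * (w / r) with hS₃
  have hS₃mem : ∀ j, |(P j).v - V| ≤ 3 * M → |(P j).p - p| ≤ 3 * (w / t) →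
      |(P j).q + V * (P j).p - (q + V * p)| ≤ 7 * (w / r) → j ∈ S₃ := by
    intro j h1 h2 h3
    rw [hqV] at h3
    simp only [hS₃, hS₂, hS₁, Finset.mem_filter, Finset.mem_univ, true_and]
    exact ⟨⟨h1, h2⟩, h3⟩
  have hmemS₃ : ∀ j ∈ S₃, |(P j).v - V| ≤ 3 * M ∧ |(P j).p - p| ≤ 3 * (w / t) ∧
      |(P j).q + V * (P j).p - (q + V * p)| ≤ 7 * (w / r) := by
    intro j hj
    rw [hqV]
    simp only [hS₃, hS₂, hS₁, Finset.mem_filter, Finset.mem_univ, true_and] at hj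
    exact ⟨hj.1.1, hj.1.2, hj.2⟩
  have hI₃S : ∀ i, ∀ x ∈ I₃ i, i ∈ S₃ := fun i x hx => by
    have h1 := hI₁V i x (hI₂I₁ i (hI₃I₂ i hx))
    have h2 := hI₂p i x (hI₃I₂ i hx)
    have h3 := hI₃q i x hx
    exact hS₃mem i (by linarith) (by linarith) (by linarith)
  have hI₃I : ∀ i, I₃ i ⊆ I i := fun i => (hI₃I₂ i).trans ((hI₂I₁ i).trans (hI₁I i))
  -- pigeonhole on `x 2`
  have hT₄ : ∀ x : EuclideanSpace ℝ (Fin 3), |x 2| ≤ 1 → |(⌊x 2 / r⌋ : ℝ)| ≤ 2 / r := by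
    intro x hx
    have h1 := floor_div_eq_iff_mem hr0 (rfl : ⌊x 2 / r⌋ = _)
    rw [le_div_iff₀ hr0, ← abs_of_pos hr0, ← abs_mul, abs_of_pos hr0]
    rw [abs_le] at hx ⊢
    constructor <;> nlinarith
  -- A box may meet all of the `O(1 / r)` slabs, so the condition does not involve `j`. This
  -- produces the factor `t / M` in the mass bound.
  obtain ⟨k₄, hp₄, hm₄⟩ := exists_cell (μ := volume) I₃ (hfin I₃ hI₃I)
    (fun _ x => x 2) r S₃ (fun _ k => |(k : ℝ)| ≤ 2 / r) (D := 2 / r) (by positivity)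
    (fun j _ => ⟨0, fun k hk => by simpa using hk⟩)
    (fun i x hx => ⟨hI₃S i x hx, hT₄ x (hIb i (hI₃I i hx)).2.2⟩) (by positivity) hm₃ hp₃
  set I₄ := fun i => I₃ i ∩ {x | ⌊x 2 / r⌋ = k₄} with hI₄
  have hI₄I₃ : ∀ i, I₄ i ⊆ I₃ i := fun i => inter_subset_left
  have hI₄m : ∀ i, MeasurableSet (I₄ i) := fun i =>
    (hI₃m i).inter (measurableSet_floor_div_eq
      (by fun_prop : Continuous fun x : EuclideanSpace ℝ (Fin 3) => x 2).measurable _ _)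
  set S₄ := S₃.filter fun _ => |(k₄ : ℝ)| ≤ 2 / r with hS₄
  have hS₄mem : ∀ j ∈ S₃, ∀ x ∈ (P j).box s t, ⌊x 2 / r⌋ = k₄ → j ∈ S₄ := by
    intro j hj x hx hk
    simp only [hS₄, Finset.mem_filter]
    exact ⟨hj, hk ▸ hT₄ x hx.2.2⟩
  -- pigeonhole on `x 1 - V x 2`
  obtain ⟨k₅, hp₅, hm₅⟩ := exists_cell (μ := volume) I₄
    (hfin I₄ fun i => (hI₄I₃ i).trans (hI₃I i))
    (fun _ x => x 1 - V * x 2) t S₄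
    (fun j k => ∃ x ∈ (P j).box s t, ⌊x 2 / r⌋ = k₄ ∧ ⌊(x 1 - V * x 2) / t⌋ = k) (D := 4)
    (by norm_num)
    -- The centre line of box `j` at mid-height of the slab. The deviation is `t` from the box, `3 t
    -- / 2` from the slope and `t` from the floor, within `D = 4`.
    (fun j hj => ⟨((P j).e + ((P j).v - V) * ((k₄ + 1 / 2) * r)) / t, by
      rintro k ⟨x, hx, hx4, hx5⟩
      obtain ⟨h1, -, -⟩ := hmemS₃ j (Finset.mem_filter.1 hj).1
      obtain ⟨h2, h3⟩ := floor_div_eq_iff_mem hr0 hx4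
      obtain ⟨h4, h5⟩ := floor_div_eq_iff_mem ht hx5
      have h6 := abs_le.1 hx.2.1
      simp only [f₁] at h6
      have h7 : |((P j).v - V) * (x 2 - (k₄ + 1 / 2) * r)| ≤ 3 * M * (r / 2) := by
        rw [abs_mul]
        exact mul_le_mul h1 (by rw [abs_le]; constructor <;> linarith) (abs_nonneg _) (by positivity)
      rw [hMr'] at h7
      rw [← mul_le_mul_iff_of_pos_right ht, ← abs_of_pos ht, ← abs_mul, abs_of_pos ht, sub_mul,
        div_mul_cancel₀ _ ht.ne']
      rw [abs_le] at h7 ⊢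
      constructor <;> linarith⟩)
    (fun i x hx => by
      have hxb := hIb i (hI₃I i (hI₄I₃ i hx))
      exact ⟨hS₄mem i (hI₃S i x (hI₄I₃ i hx)) x hxb hx.2, x, hxb, hx.2, rfl⟩)
    (by positivity) hm₄ hp₄
  set I₅ := fun i => I₄ i ∩ {x | ⌊(x 1 - V * x 2) / t⌋ = k₅} with hI₅
  have hI₅I₄ : ∀ i, I₅ i ⊆ I₄ i := fun i => inter_subset_left
  have hI₅m : ∀ i, MeasurableSet (I₅ i) := fun i =>
    (hI₄m i).inter (measurableSet_floor_div_eq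
      (by fun_prop : Continuous fun x : EuclideanSpace ℝ (Fin 3) => x 1 - V * x 2).measurable _ _)
  set S₅ := S₄.filter fun j =>
    ∃ x ∈ (P j).box s t, ⌊x 2 / r⌋ = k₄ ∧ ⌊(x 1 - V * x 2) / t⌋ = k₅ with hS₅
  -- pigeonhole on `x 0 - p x 1 - q x 2`
  obtain ⟨k₆, hp₆, hm₆⟩ := exists_cell (μ := volume) I₅
    (hfin I₅ fun i => (hI₅I₄ i).trans ((hI₄I₃ i).trans (hI₃I i)))
    (fun _ x => x 0 - p * x 1 - q * x 2) w S₅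
    (fun j k => ∃ x ∈ (P j).box s t, ⌊x 2 / r⌋ = k₄ ∧ ⌊(x 1 - V * x 2) / t⌋ = k₅ ∧
      ⌊(x 0 - p * x 1 - q * x 2) / w⌋ = k) (D := 7)
    (by norm_num)
    -- The central plane of box `j` at the midpoint of the cell. The deviations `s ≤ w`, `3 w / 2`,
    -- `7 w / 2` and `w` add up to at most `7 w`.
    (fun j hj => ⟨((P j).c + ((P j).p - p) * ((k₅ + 1 / 2) * t) +
        ((P j).q + V * (P j).p - (q + V * p)) * ((k₄ + 1 / 2) * r)) / w, by
      rintro k ⟨x, hx, hx4, hx5, hx6⟩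
      obtain ⟨-, h1, h1'⟩ := hmemS₃ j (Finset.mem_filter.1 (Finset.mem_filter.1 hj).1).1
      obtain ⟨h2, h3⟩ := floor_div_eq_iff_mem hr0 hx4
      obtain ⟨h4, h5⟩ := floor_div_eq_iff_mem ht hx5
      obtain ⟨h8, h9⟩ := floor_div_eq_iff_mem hw0 hx6
      have h6 := abs_le.1 hx.1
      simp only [f₀] at h6
      have h7 : |((P j).p - p) * (x 1 - V * x 2 - (k₅ + 1 / 2) * t)| ≤ 3 * (w / t) * (t / 2) := by
        rw [abs_mul]
        exact mul_le_mul h1 (by rw [abs_le]; constructor <;> linarith) (abs_nonneg _) (by positivity)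
      have h7' : |((P j).q + V * (P j).p - (q + V * p)) * (x 2 - (k₄ + 1 / 2) * r)| ≤
          7 * (w / r) * (r / 2) := by
        rw [abs_mul]
        exact mul_le_mul h1' (by rw [abs_le]; constructor <;> linarith) (abs_nonneg _)
          (by positivity)
      rw [hwt'] at h7
      rw [hwr'] at h7'
      rw [← mul_le_mul_iff_of_pos_right hw0, ← abs_of_pos hw0, ← abs_mul, abs_of_pos hw0, sub_mul,
        div_mul_cancel₀ _ hw0.ne']
      rw [abs_le] at h7 h7' ⊢
      constructor <;> linarith⟩)
    (fun i x hx => by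
      have hxb := hIb i (hI₃I i (hI₄I₃ i (hI₅I₄ i hx)))
      refine ⟨?_, x, hxb, hx.1.2, hx.2, rfl⟩
      rw [hS₅, Finset.mem_filter]
      exact ⟨hS₄mem i (hI₃S i x (hI₄I₃ i (hI₅I₄ i hx))) x hxb hx.1.2, x, hxb, hx.1.2, hx.2⟩)
    (by positivity) hm₅ hp₅
  set I₆ := fun i => I₅ i ∩ {x | ⌊(x 0 - p * x 1 - q * x 2) / w⌋ = k₆} with hI₆
  have hI₆m : ∀ i, MeasurableSet (I₆ i) := fun i =>
    (hI₅m i).inter (measurableSet_floor_div_eq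
      (by fun_prop : Continuous fun x : EuclideanSpace ℝ (Fin 3) =>
        x 0 - p * x 1 - q * x 2).measurable _ _)
  set S₆ := S₅.filter fun j =>
    ∃ x ∈ (P j).box s t, ⌊x 2 / r⌋ = k₄ ∧ ⌊(x 1 - V * x 2) / t⌋ = k₅ ∧
      ⌊(x 0 - p * x 1 - q * x 2) / w⌋ = k₆ with hS₆
  have hS₆mem : ∀ i, ∀ x ∈ I₆ i, ∀ j ∈ S₃, x ∈ (P j).box s t → j ∈ S₆ := by
    intro i x hx j hj hxj
    rw [hS₆, Finset.mem_filter, hS₅, Finset.mem_filter]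
    exact ⟨⟨hS₄mem j hj x hxj hx.1.1.2, x, hxj, hx.1.1.2, hx.1.2⟩, x, hxj, hx.1.1.2, hx.1.2, hx.2⟩
  refine ⟨I₆, S₆, V, p, q, k₆ * w, k₅ * t, k₄ * r, hI₆m, fun i x hx => hI₃I i hx.1.1.1,
    fun i x hx => hS₆mem i x hx i (hI₃S i x hx.1.1.1) (hIb i (hI₃I i hx.1.1.1)), ?_, hp₆, ?_, ?_⟩
  -- A box related to a surviving one has parameters within the tolerances that define `S₃`: `3 = 1
  -- + 2` for `v` and `p`, and `7 = 1 + 4 + 2` for the combined slope, where the last `2` comes from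
  -- replacing `(P i).v` by `V`.
  · intro i x hx j h1 h2 hxj
    refine hS₆mem i x hx j ?_ hxj
    have a1 := hI₁V i x hx.1.1.1.1.1
    have a2 := hI₂p i x hx.1.1.1.1
    have a3 := hI₃q i x hx.1.1.1
    have b1 := abs_v_sub_le h1
    have b2 := abs_p_sub_le ht h2
    have b3 := abs_q_sub_le ht hM0 hw0 h1 h2
    rw [← hr] at b3
    refine hS₃mem j ?_ ?_ ?_
    · rw [abs_le] at *; constructor <;> linarith
    · rw [abs_le] at *; constructor <;> linarith
    · have c1 : |(V - (P i).v) * ((P j).p - (P i).p)| ≤ M * (2 * (w / t)) := by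
        rw [abs_mul]
        exact mul_le_mul (by rwa [abs_sub_comm]) b2 (abs_nonneg _) hM0.le
      have c2 : M * (2 * (w / t)) = 2 * (w / r) := by rw [← hwtM]; ring
      rw [c2] at c1
      have e : (P j).q + V * (P j).p - (q + V * p) =
        ((P i).q + V * (P i).p - (q + V * p)) +
        ((P j).q - (P i).q + (P i).v * ((P j).p - (P i).p)) +
        (V - (P i).v) * ((P j).p - (P i).p) := by ring
      rw [e]
      have := abs_add_three ((P i).q + V * (P i).p - (q + V * p))
        ((P j).q - (P i).q + (P i).v * ((P j).p - (P i).p))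
        ((V - (P i).v) * ((P j).p - (P i).p))
      linarith
  · exact (mul_le_mul_of_nonneg_right (cell_constant_le hl hr0 hr1) (Nat.cast_nonneg _)).trans hm₆
  · intro i x hx
    obtain ⟨h4, h4'⟩ := floor_div_eq_iff_mem hr0 hx.1.1.2
    obtain ⟨h5, h5'⟩ := floor_div_eq_iff_mem ht hx.1.2
    obtain ⟨h6, h6'⟩ := floor_div_eq_iff_mem hw0 hx.2
    refine ⟨hI₁V i x hx.1.1.1.1.1, hI₂p i x hx.1.1.1.1, hI₃q i x hx.1.1.1, ?_, ?_, ?_⟩ <;>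
    · rw [abs_le]; constructor <;> linarith

end ShearParam

/-! ### Thick intersections: a dense ball. -/

theorem abs_coord_sub_le_dist (x y : EuclideanSpace ℝ (Fin 3)) (k : Fin 3) :
    |x k - y k| ≤ dist x y := by
  rw [dist_eq_norm, ← Real.norm_eq_abs]
  exact PiLp.norm_apply_le (x - y) k

namespace ShearParam

/-- If most pairs of boxes meeting at a point meet at a definite angle, the union of the shadings is
dense in some ball. -/
theorem exists_ball_of_thick {ι : Type*} [Fintype ι] (P : ι → ShearParam)
    (hPp : ∀ i, |(P i).p| ≤ 1) (hPq : ∀ i, |(P i).q| ≤ 1) (hPv : ∀ i, |(P i).v| ≤ 1)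
    {s t M w ϱ n l : ℝ} (hs : 0 < s) (ht : 0 < t) (hM : t ≤ M) (hM20 : M ≤ 20) (hw : s < w)
    (hϱ : 0 < ϱ) (hϱw : 50 * ϱ ≤ w) (hϱt : 50 * ϱ ≤ t) (hϱr : ϱ ≤ t / M) (hn : 0 < n) (hl : 0 < l)
    (I Y : ι → Set (EuclideanSpace ℝ (Fin 3)))
    (hIm : ∀ i, MeasurableSet (I i)) (hYm : ∀ i, MeasurableSet (Y i))
    (hIY : ∀ i, I i ⊆ Y i) (hYb : ∀ i, Y i ⊆ (P i).box s t)
    (rel : ι → ι → Prop) [∀ i j, Decidable (rel i j)]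
    (hrel : ∀ i j, rel i j → M ≤ (P i).spread (P j) t ∧ (P i).spread (P j) t ≤ 2 * M ∧
      w ≤ (P i).thickness (P j) s t ∧ (P i).thickness (P j) s t ≤ 2 * w)
    (hdom : ∀ i, ∀ x ∈ I i, ∑ j, (Y j).indicator (1 : EuclideanSpace ℝ (Fin 3) → ℝ) x ≤
      n * ∑ j, if rel i j then (Y j).indicator (1 : EuclideanSpace ℝ (Fin 3) → ℝ) x else 0)
    (hmass : l * Fintype.card ι ≤ ∑ i, volume.real (I i)) (hpos : 0 < ∑ i, volume.real (I i)) :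
    ∃ x, l ^ 2 / (10 ^ 19 * n * s ^ 2 * t ^ 2) *
        volume.real (Metric.ball (0 : EuclideanSpace ℝ (Fin 3)) ϱ) ≤
      volume.real (Metric.ball x ϱ ∩ ⋃ i, I i) := by
  classical
  obtain ⟨I', S, V, p, q, a₀, a₁, a₂, hI'm, hI'I, hI'S, hSrel, hpos', hmass', hgeo⟩ :=
    exists_anisotropic_cell P hs ht hM hw.le I hIm (fun i => (hIY i).trans (hYb i)) hl.le hmass hpos
  have hM0 : 0 < M := ht.trans_le hM
  have hw0 : 0 < w := hs.trans hw
  set r := t / M with hr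
  have hr0 : 0 < r := by positivity
  have hI'Y : ∀ i, I' i ⊆ Y i := fun i => (hI'I i).trans (hIY i)
  have hboxf : ∀ i, volume ((P i).box s t) ≠ ∞ := fun i => volume_box_ne_top hs.le ht.le
  have hI'f : ∀ i, volume (I' i) ≠ ∞ := fun i =>
    measure_ne_top_of_subset ((hI'Y i).trans (hYb i)) (hboxf i)
  set U := ⋃ i, I' i with hU
  have hUf : volume U ≠ ∞ := ((measure_iUnion_fintype_le volume I').trans_lt
    (ENNReal.sum_lt_top.2 fun i _ => (hI'f i).lt_top)).ne
  have hcs := sq_sum_measureReal_le (μ := volume) I' Y rel (n := n) hI'm hYm hI'f (by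
    intro i x hx
    refine (Finset.sum_le_sum fun j _ => ?_).trans (hdom i x (hI'I i hx))
    exact indicator_le_indicator_of_subset (hI'Y j) (fun _ => zero_le_one) x)
  rw [← hU] at hcs
  -- Only pairs with both indices in `S` contribute: a point of `I' i ∩ Y j` puts `j` into `S` by
  -- `hSrel`.
  have hpair : ∑ i, ∑ j, (if rel i j then volume.real (I' i ∩ Y j) else 0) ≤
      (S.card : ℝ) * (S.card * (32 * s ^ 2 * t ^ 2 / (M * w))) := by
    have h1 : ∀ i j, (if rel i j then volume.real (I' i ∩ Y j) else 0) ≤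
        if i ∈ S ∧ j ∈ S then 32 * s ^ 2 * t ^ 2 / (M * w) else 0 := by
      intro i j
      by_cases hij : rel i j
      · rw [if_pos hij]
        obtain ⟨h1, h2, h3, h4⟩ := hrel i j hij
        rcases (I' i ∩ Y j).eq_empty_or_nonempty with he | ⟨x, hx⟩
        · rw [he, measureReal_empty]
          split_ifs <;> positivity
        · rw [if_pos ⟨hI'S i x hx.1, hSrel i x hx.1 j h2 h4 (hYb j hx.2)⟩]
          calc volume.real (I' i ∩ Y j) ≤ volume.real ((P i).box s t ∩ (P j).box s t) :=
                measureReal_mono (inter_subset_inter ((hI'Y i).trans (hYb i)) (hYb j))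
                  (measure_ne_top_of_subset inter_subset_left (hboxf i))
            _ ≤ 32 * s ^ 2 * t ^ 2 / ((P i).spread (P j) t * (P i).thickness (P j) s t) :=
                measureReal_box_inter_box_le hs ht (hw.trans_le h3)
            _ ≤ _ := div_le_div_of_nonneg_left (by positivity) (by positivity)
                (mul_le_mul h1 h3 hw0.le (hM0.le.trans h1))
      · rw [if_neg hij]
        split_ifs <;> positivity
    refine (Finset.sum_le_sum fun i _ => Finset.sum_le_sum fun j _ => h1 i j).trans_eq ?_
    simp only [ite_and]
    simp [Finset.sum_ite_mem]
  have hSpos : 0 < (S.card : ℝ) := by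
    obtain ⟨i, -, hi⟩ := Finset.exists_lt_of_sum_lt (s := Finset.univ) (f := fun _ => (0 : ℝ))
      (g := fun i => volume.real (I' i)) (by simpa using hpos')
    have hne : (I' i).Nonempty := by
      by_contra hcon
      rw [not_nonempty_iff_eq_empty] at hcon
      rw [hcon, measureReal_empty] at hi
      exact lt_irrefl _ hi
    obtain ⟨x, hx⟩ := hne
    exact_mod_cast Finset.card_pos.2 ⟨i, hI'S i x hx⟩
  -- This is the cell volume `w t r` up to a constant and the factor `l² / (n s² t²)`; the
  -- cardinality of `S` cancels.
  have hUlow : l ^ 2 * r * t * w / (32 * 31752000 ^ 2 * n * s ^ 2 * t ^ 2) ≤ volume.real U := by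
    have h1 : (l * r / 31752000 * S.card) ^ 2 ≤
        volume.real U * (n * ((S.card : ℝ) * (S.card * (32 * s ^ 2 * t ^ 2 / (M * w))))) := by
      refine (pow_le_pow_left₀ (by positivity) hmass' 2).trans (hcs.trans ?_)
      exact mul_le_mul_of_nonneg_left (mul_le_mul_of_nonneg_left hpair hn.le) measureReal_nonneg
    have e1 : (l * r / 31752000 * S.card) ^ 2 =
      (l ^ 2 * r * t * w / (32 * 31752000 ^ 2 * n * s ^ 2 * t ^ 2)) *
        (n * ((S.card : ℝ) * (S.card * (32 * s ^ 2 * t ^ 2 / (M * w))))) := by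
      rw [hr]; field_simp
    rw [e1] at h1
    exact le_of_mul_le_mul_right h1 (by positivity)
  -- the cell and its neighborhood
  have hV : ∀ i, ∀ x ∈ I' i, |V| ≤ 21 := by
    intro i x hx
    have h1 := abs_le.1 (hgeo i x hx).1
    have h2 := abs_le.1 (hPv i)
    rw [abs_le]; constructor <;> linarith
  have hp : ∀ i, ∀ x ∈ I' i, |p| ≤ 1 + w / t := by
    intro i x hx
    have h1 := abs_le.1 (hgeo i x hx).2.1
    have h2 := abs_le.1 (hPp i)
    rw [abs_le]; constructor <;> linarith
  have hq : ∀ i, ∀ x ∈ I' i, |q| ≤ 43 + w / r + 21 * (w / t) := by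
    intro i x hx
    have h1 := abs_le.1 (hgeo i x hx).2.2.1
    have h2 := abs_le.1 (hPq i)
    have h3 : |V * (P i).p| ≤ 21 * 1 := by
      rw [abs_mul]; exact mul_le_mul (hV i x hx) (hPp i) (abs_nonneg _) (by norm_num)
    have h4 : |V * p| ≤ 21 * (1 + w / t) := by
      rw [abs_mul]; exact mul_le_mul (hV i x hx) (hp i x hx) (abs_nonneg _) (by norm_num)
    rw [abs_le] at h3 h4 ⊢
    constructor <;> linarith
  -- The cell enlarged to contain the centres of all `ϱ`-balls that meet `U`. The slopes satisfy
  -- `|V| ≤ 21`, `|p| ≤ 1 + w / t` and `|q| ≤ 43 + w / r + 21 w / t`, so `50 ϱ ≤ w`, `50 ϱ ≤ t` and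
  -- `ϱ ≤ r` keep the drift of the first form below `3 w`.
  set Z : Set (EuclideanSpace ℝ (Fin 3)) := {x | |1 * x 0 + (-p) * x 1 + (-q) * x 2 - a₀| ≤ 4 * w} ∩
    ({x | |0 * x 0 + 1 * x 1 + (-V) * x 2 - a₁| ≤ 2 * t} ∩
      {x | |0 * x 0 + 0 * x 1 + 1 * x 2 - a₂| ≤ 2 * r}) with hZ
  have hZm : MeasurableSet Z := by
    have hc : ∀ a b c d e : ℝ,
        MeasurableSet {x : EuclideanSpace ℝ (Fin 3) | |a * x 0 + b * x 1 + c * x 2 - d| ≤ e} := by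
      intro a b c d e
      exact (isClosed_le (by fun_prop : Continuous fun x : EuclideanSpace ℝ (Fin 3) =>
        |a * x 0 + b * x 1 + c * x 2 - d|) continuous_const).measurableSet
    exact (hc _ _ _ _ _).inter ((hc _ _ _ _ _).inter (hc _ _ _ _ _))
  obtain ⟨hZf, hZv⟩ := volume_ne_top_and_measureReal_le (S := Z) (d := 1) (fun x hx => hx.1)
    (fun x hx => hx.2.1) (fun x hx => hx.2.2) (by positivity) (by positivity) (by positivity)
    (by ring) one_ne_zero
  have hnear : ∀ x, ∀ y ∈ U, dist x y < ϱ → x ∈ Z := by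
    intro x y hy hxy
    obtain ⟨i, hi⟩ := mem_iUnion.1 hy
    obtain ⟨-, -, -, g0, g1, g2⟩ := hgeo i y hi
    have d0 := (abs_coord_sub_le_dist x y 0).trans hxy.le
    have d1 := (abs_coord_sub_le_dist x y 1).trans hxy.le
    have d2 := (abs_coord_sub_le_dist x y 2).trans hxy.le
    have e1 : |V * (x 2 - y 2)| ≤ 21 * ϱ := by
      rw [abs_mul]; exact mul_le_mul (hV i y hi) d2 (abs_nonneg _) (by norm_num)
    have e2 : |p * (x 1 - y 1)| ≤ (1 + w / t) * ϱ := by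
      rw [abs_mul]; exact mul_le_mul (hp i y hi) d1 (abs_nonneg _) (by positivity)
    have e3 : |q * (x 2 - y 2)| ≤ (43 + w / r + 21 * (w / t)) * ϱ := by
      rw [abs_mul]; exact mul_le_mul (hq i y hi) d2 (abs_nonneg _) (by positivity)
    have f1 : w / t * ϱ ≤ w / 50 := by
      rw [div_mul_eq_mul_div, div_le_div_iff₀ ht (by norm_num)]
      nlinarith
    have f2 : w / r * ϱ ≤ w := by
      rw [div_mul_eq_mul_div, div_le_iff₀ hr0]
      exact mul_le_mul_of_nonneg_left hϱr hw0.le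
    rw [abs_le] at *
    refine ⟨?_, ?_, ?_⟩
    · rw [mem_ofPred_eq, abs_le]; constructor <;> linarith
    · rw [mem_ofPred_eq, abs_le]; constructor <;> linarith
    · rw [mem_ofPred_eq, abs_le]; constructor <;> linarith
  by_contra! hcon
  have hball : 0 < volume.real (Metric.ball (0 : EuclideanSpace ℝ (Fin 3)) ϱ) :=
    ENNReal.toReal_pos (Metric.measure_ball_pos _ _ hϱ).ne' measure_ball_lt_top.ne
  have hfinal := measureReal_ball_mul_le (G := U) (Z := Z) (MeasurableSet.iUnion hI'm) hUf hZm hZf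
    hnear (τ := l ^ 2 / (10 ^ 19 * n * s ^ 2 * t ^ 2) *
        volume.real (Metric.ball (0 : EuclideanSpace ℝ (Fin 3)) ϱ)) (by positivity) (by
      intro x
      refine le_trans ?_ (hcon x).le
      exact measureReal_mono (inter_subset_inter_right _ (iUnion_mono hI'I))
        (measure_ne_top_of_subset inter_subset_left measure_ball_lt_top.ne))
  have h2 : volume.real (Metric.ball (0 : EuclideanSpace ℝ (Fin 3)) ϱ) *
      (l ^ 2 * r * t * w / (32 * 31752000 ^ 2 * n * s ^ 2 * t ^ 2)) ≤
      l ^ 2 / (10 ^ 19 * n * s ^ 2 * t ^ 2) *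
        volume.real (Metric.ball (0 : EuclideanSpace ℝ (Fin 3)) ϱ) *
        (8 * (4 * w * (2 * t) * (2 * r)) / |1|) := by
    refine (mul_le_mul_of_nonneg_left hUlow hball.le).trans (hfinal.trans ?_)
    exact mul_le_mul_of_nonneg_left hZv (by positivity)
  have h3 : volume.real (Metric.ball (0 : EuclideanSpace ℝ (Fin 3)) ϱ) *
      (l ^ 2 * r * t * w / (n * s ^ 2 * t ^ 2)) * (1 / (32 * 31752000 ^ 2)) ≤
      volume.real (Metric.ball (0 : EuclideanSpace ℝ (Fin 3)) ϱ) *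
      (l ^ 2 * r * t * w / (n * s ^ 2 * t ^ 2)) * (128 / 10 ^ 19) := by
    refine le_of_eq_of_le ?_ (h2.trans_eq ?_)
    · field_simp
    · rw [abs_one]; field_simp; ring
  -- The constant `10 ^ 19` was chosen to exceed `128 * 32 * 31752000 ^ 2`.
  have h4 := le_of_mul_le_mul_left h3 (by positivity)
  norm_num at h4

end ShearParam

/-! ### Crossing boxes: Córdoba's overlap argument inside a box. -/

theorem sq_sum_measureReal_le_of_finset {κ X : Type*} [MeasurableSpace X] {μ : Measure X}
    (Z : Finset κ) (G : κ → Set X) (hGm : ∀ m ∈ Z, MeasurableSet (G m))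
    (hGf : ∀ m ∈ Z, μ (G m) ≠ ∞) :
    (∑ m ∈ Z, μ.real (G m)) ^ 2 ≤
      μ.real (⋃ m ∈ Z, G m) * ∑ m ∈ Z, ∑ m' ∈ Z, μ.real (G m ∩ G m') := by
  have := sq_sum_measureReal_le (μ := μ) (ι := Z) (fun m => G m) (fun m => G m) (fun _ _ => True)
    (n := 1) (fun m => hGm m m.2) (fun m => hGm m m.2) (fun m => hGf m m.2) (by simp)
  simp only [if_true, one_mul] at this
  rw [Finset.sum_coe_sort Z fun m => μ.real (G m)] at this
  rw [iUnion_subtype] at this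
  refine this.trans_eq ?_
  congr 1
  rw [← Finset.sum_coe_sort Z fun m => ∑ m' ∈ Z, μ.real (G m ∩ G m')]
  refine Finset.sum_congr rfl fun m _ => ?_
  exact Finset.sum_coe_sort Z fun m' => μ.real (G m ∩ G m')

theorem sum_inv_abs_sub_add_one_le (Z : Finset ℤ) (m : ℤ) {N : ℕ}
    (h : ∀ m' ∈ Z, (m - m').natAbs < N) :
    ∑ m' ∈ Z, (1 : ℝ) / (|(m : ℝ) - m'| + 1) ≤ 2 * (1 + Real.log N) := by
  have h1 : ∀ m' : ℤ, (1 : ℝ) / (|(m : ℝ) - m'| + 1) = ((((m - m').natAbs : ℝ)) + 1)⁻¹ := by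
    intro m'
    rw [one_div, Nat.cast_natAbs]
    push_cast
    rfl
  simp only [h1]
  rw [← Finset.sum_fiberwise_of_maps_to (t := Finset.range N) (g := fun m' => (m - m').natAbs)
    (fun m' hm' => Finset.mem_range.2 (h m' hm'))]
  have h2 : ∀ k ∈ Finset.range N,
      ∑ m' ∈ Z with (m - m').natAbs = k, ((((m - m').natAbs : ℝ)) + 1)⁻¹ ≤
      2 * ((k : ℝ) + 1)⁻¹ := by
    intro k _
    have h3 : ∀ m' ∈ Z.filter fun m' => (m - m').natAbs = k,
        ((((m - m').natAbs : ℝ)) + 1)⁻¹ ≤ ((k : ℝ) + 1)⁻¹ := by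
      intro m' hm'
      rw [(Finset.mem_filter.1 hm').2]
    refine (Finset.sum_le_card_nsmul _ _ _ h3).trans ?_
    rw [nsmul_eq_mul]
    have h4 : (Z.filter fun m' => (m - m').natAbs = k) ⊆ {m - k, m + k} := by
      intro m' hm'
      have := (Finset.mem_filter.1 hm').2
      simp only [Finset.mem_insert, Finset.mem_singleton]
      omega
    have h5 : ((Z.filter fun m' => (m - m').natAbs = k).card : ℝ) ≤ 2 := by
      exact_mod_cast (Finset.card_le_card h4).trans Finset.card_le_two
    gcongr
  refine (Finset.sum_le_sum h2).trans ?_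
  rw [← Finset.mul_sum]
  have := harmonic_le_one_add_log N
  rw [harmonic] at this
  push_cast at this
  gcongr

namespace ShearParam

set_option maxHeartbeats 1000000 in
/-- A box whose points are met by boxes with a definite angle in its plane: the union of the latter
fills a definite portion of an enlarged box. -/
theorem le_measureReal_box_inter_cthickening (P : ShearParam) {s t M a b lam : ℝ}
    (hs : 0 < s) (ht : 0 < t) (htb : t ≤ b) (hbM : b ≤ M) (ha : 6 * s ≤ a) (hlam : 0 < lam)
    {F G : Set (EuclideanSpace ℝ (Fin 3))} (hGb : G ⊆ P.box s t)
    (h : ∀ x ∈ G, ∃ (Q : ShearParam) (Y : Set (EuclideanSpace ℝ (Fin 3))),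
      MeasurableSet Y ∧ Y ⊆ Q.box s t ∧ Y ⊆ F ∧ x ∈ Y ∧
      M ≤ |Q.v - P.v| ∧ |Q.v - P.v| ≤ 2 * M ∧
      3 * s + 2 * P.thickness Q s t + 2 * P.thickness Q s t * P.spread Q t * (b / M) / t ≤ 9 * a ∧
      lam * s * t * (b / M) ≤ volume.real (Y ∩ {y | ⌊y 2 / (b / M)⌋ = ⌊x 2 / (b / M)⌋})) :
    lam ^ 2 * a * b / (12441600 * s * t * (1 + Real.log (8 * (M / t)))) * volume.real G ≤
      volume.real (P.box (10 * a) (5 * b) ∩ Metric.cthickening a F) := by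
  classical
  have hb0 : 0 < b := ht.trans_le htb
  have hM0 : 0 < M := hb0.trans_le hbM
  have ha0 : 0 < a := by linarith
  set ℓ := b / M with hℓ
  have hℓ0 : 0 < ℓ := by positivity
  have hℓM : ℓ * M = b := by rw [hℓ]; field_simp
  set r := t / M with hr
  have hr0 : 0 < r := by positivity
  have hrM : r * M = t := by rw [hr]; field_simp
  have hMt1 : 1 ≤ M / t := (one_le_div ht).2 (htb.trans hbM)
  -- One crossing box is kept per height cell. The strips have half-width `3 t`, which blurs base
  -- points by about `6 r` in total; cells of height `12 r` separate non-adjacent ones beyond that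
  -- error.
  set hh := 12 * r with hhh
  have hh0 : 0 < hh := by positivity
  have hlog : 0 < 1 + Real.log (8 * (M / t)) := by
    have := Real.log_nonneg (by linarith : 1 ≤ 8 * (M / t)); linarith
  -- the occupied cells in the last coordinate
  set D : ℕ := ⌈1 / hh⌉₊ + 1 with hD
  have hDle : (D : ℝ) ≤ 3 * (M / t) := by
    have h1 : (⌈1 / hh⌉₊ : ℝ) < 1 / hh + 1 := Nat.ceil_lt_add_one (by positivity)
    have h2 : 1 / hh = M / t / 12 := by rw [hhh, hr]; field_simp
    rw [hD]; push_cast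
    linarith
  set Z : Finset ℤ := (Finset.Icc (-D : ℤ) D).filter fun m =>
    (G ∩ {x | ⌊x 2 / hh⌋ = m}).Nonempty with hZ
  have hcell : ∀ x ∈ G, ⌊x 2 / hh⌋ ∈ Z := by
    intro x hx
    rw [hZ, Finset.mem_filter]
    refine ⟨?_, x, hx, rfl⟩
    have h1 := abs_le.1 (hGb hx).2.2
    have h2 : |x 2 / hh| ≤ 1 / hh := by
      rw [abs_div, abs_of_pos hh0]; exact div_le_div_of_nonneg_right (hGb hx).2.2 hh0.le
    have h3 : (1 / hh : ℝ) ≤ ⌈1 / hh⌉₊ := Nat.le_ceil _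
    rw [abs_le] at h2
    rw [Finset.mem_Icc, Int.le_floor, ← Int.lt_add_one_iff, Int.floor_lt, hD]
    push_cast
    constructor <;> linarith
  have hGcard : volume.real G ≤ Z.card * (4 * s * t * hh) := by
    have hsub : G ⊆ ⋃ m ∈ Z, G ∩ {x | ⌊x 2 / hh⌋ = m} := by
      intro x hx
      simp only [mem_iUnion]
      exact ⟨_, hcell x hx, hx, rfl⟩
    have hf : volume (⋃ m ∈ Z, G ∩ {x | ⌊x 2 / hh⌋ = m}) ≠ ∞ :=
      measure_ne_top_of_subset (iUnion₂_subset fun m _ => inter_subset_left.trans hGb)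
        (volume_box_ne_top hs.le ht.le)
    refine (measureReal_mono hsub hf).trans ((measureReal_biUnion_finset_le _ _).trans ?_)
    rw [← nsmul_eq_mul]
    refine Finset.sum_le_card_nsmul _ _ _ fun m _ => ?_
    refine (volume_inter_slab_le (P := P) (z := (m + 1 / 2) * hh) (h := hh / 2) hs.le ht.le
      (by positivity) (inter_subset_left.trans hGb) fun x hx => ?_).2.trans_eq (by ring)
    have := floor_div_eq_iff_mem hh0 hx.2
    rw [abs_le]; constructor <;> linarith
  -- choose an intersecting box for each cell
  have hch : ∀ m ∈ Z, ∃ (x : EuclideanSpace ℝ (Fin 3)) (Q : ShearParam)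
      (Y : Set (EuclideanSpace ℝ (Fin 3))), x ∈ P.box s t ∧ ⌊x 2 / hh⌋ = m ∧
      MeasurableSet Y ∧ Y ⊆ Q.box s t ∧ Y ⊆ F ∧ x ∈ Y ∧
      M ≤ |Q.v - P.v| ∧ |Q.v - P.v| ≤ 2 * M ∧
      3 * s + 2 * P.thickness Q s t + 2 * P.thickness Q s t * P.spread Q t * ℓ / t ≤ 9 * a ∧
      lam * s * t * ℓ ≤ volume.real (Y ∩ {y | ⌊y 2 / ℓ⌋ = ⌊x 2 / ℓ⌋}) := by
    intro m hm
    obtain ⟨x, hx, hxm⟩ := (Finset.mem_filter.1 hm).2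
    obtain ⟨Q, Y, h1⟩ := h x hx
    exact ⟨x, Q, Y, hGb hx, hxm, h1⟩
  have : Nonempty ShearParam := ⟨P⟩
  choose! x Q Y hxP hxm hYm hYQ hYF hxY hψ hψ' hthick hYvol using hch
  -- Within a slab of height `ℓ = b / M` a crossing box drifts by at most `2 M ℓ = 2 b`, so it stays
  -- inside the enlarged width.
  set R : ℤ → Set (EuclideanSpace ℝ (Fin 3)) := fun m =>
    Y m ∩ {y | ⌊y 2 / ℓ⌋ = ⌊x m 2 / ℓ⌋} with hR
  have hRm : ∀ m ∈ Z, MeasurableSet (R m) := fun m hm => (hYm m hm).inter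
    (measurableSet_floor_div_eq
      (by fun_prop : Continuous fun x : EuclideanSpace ℝ (Fin 3) => x 2).measurable _ _)
  have hRf : ∀ m ∈ Z, volume (R m) ≠ ∞ := fun m hm =>
    measure_ne_top_of_subset (inter_subset_left.trans (hYQ m hm)) (volume_box_ne_top hs.le ht.le)
  have hR2 : ∀ m ∈ Z, ∀ y ∈ R m, |y 2 - x m 2| ≤ ℓ := by
    intro m hm y hy
    have h1 := floor_div_eq_iff_mem hℓ0 hy.2
    have h2 := floor_div_eq_iff_mem hℓ0 (rfl : ⌊x m 2 / ℓ⌋ = _)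
    rw [abs_le]; constructor <;> linarith
  have hR0 : ∀ m ∈ Z, ∀ y ∈ R m, |P.f₀ y| ≤ 9 * a := fun m hm y hy =>
    (abs_f₀_le_of_mem_of_mem hs ht (hxP m hm) (hYQ m hm (hxY m hm)) (hYQ m hm hy.1)
      (hR2 m hm y hy)).trans (hthick m hm)
  have hR1 : ∀ m ∈ Z, ∀ y ∈ R m, |P.f₁ y - ((Q m).v - P.v) * (y 2 - x m 2)| ≤ 3 * t :=
    fun m hm y hy => abs_f₁_sub_le_of_mem_of_mem (hxP m hm) (hYQ m hm (hxY m hm)) (hYQ m hm hy.1)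
  have hR1' : ∀ m ∈ Z, ∀ y ∈ R m, |P.f₁ y| ≤ 5 * b := by
    intro m hm y hy
    have h1 : |((Q m).v - P.v) * (y 2 - x m 2)| ≤ 2 * M * ℓ := by
      rw [abs_mul]
      exact mul_le_mul (hψ' m hm) (hR2 m hm y hy) (abs_nonneg _) (by positivity)
    have h2 := hR1 m hm y hy
    have h3 : 2 * M * ℓ = 2 * b := by rw [← hℓM]; ring
    rw [h3] at h1
    rw [abs_le] at *
    constructor <;> linarith
  -- thicken by translations
  set n : ℕ := ⌊a / (3 * s)⌋₊ with hn
  have hn1 : (n : ℝ) * (3 * s) ≤ a := by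
    rw [← le_div_iff₀ (by positivity)]; exact Nat.floor_le (by positivity)
  have hn2 : a / (6 * s) ≤ n := by
    have h1 : a / (3 * s) < n + 1 := Nat.lt_floor_add_one _
    have h2 : a / (3 * s) = 2 * (a / (6 * s)) := by field_simp; norm_num
    have h3 : 1 ≤ a / (6 * s) := (one_le_div (by positivity)).2 ha
    linarith
  -- A shift of `3 s` exceeds the box thickness `2 s`, so the translates are disjoint. All shifts
  -- are at most `a`, so the translates stay in the thickening.
  set τ : ℕ → EuclideanSpace ℝ (Fin 3) := fun k => EuclideanSpace.single 0 (3 * s * k) with hτ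
  have hτ0 : ∀ k, τ k 0 = 3 * s * k := fun k => by simp [hτ]
  have hτ1 : ∀ k, τ k 1 = 0 := fun k => by simp [hτ]
  have hτ2 : ∀ k, τ k 2 = 0 := fun k => by simp [hτ]
  have hf0τ : ∀ (A : ShearParam) y k, A.f₀ (y - τ k) = A.f₀ y - 3 * s * k := by
    intro A y k
    simp only [f₀, PiLp.sub_apply, hτ0, hτ1, hτ2]; ring
  have hf1τ : ∀ (A : ShearParam) y k, A.f₁ (y - τ k) = A.f₁ y := by
    intro A y k
    simp only [f₁, PiLp.sub_apply, hτ1, hτ2]; ring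
  have hy2τ : ∀ (y : EuclideanSpace ℝ (Fin 3)) k, (y - τ k) 2 = y 2 := by
    intro y k
    simp only [PiLp.sub_apply, hτ2]; ring
  set T : ℤ → Set (EuclideanSpace ℝ (Fin 3)) := fun m =>
    ⋃ k ∈ Finset.range n, (fun y => y - τ k) ⁻¹' (R m) with hT
  have hTpre : ∀ m ∈ Z, ∀ k, MeasurableSet ((fun y => y - τ k) ⁻¹' (R m)) := fun m hm k =>
    (measurable_id.sub_const (τ k)) (hRm m hm)
  have hTm : ∀ m ∈ Z, MeasurableSet (T m) := fun m hm =>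
    Finset.measurableSet_biUnion _ fun k _ => hTpre m hm k
  have hTmem : ∀ m ∈ Z, ∀ y ∈ T m, |P.f₀ y| ≤ 10 * a ∧ |P.f₁ y| ≤ 5 * b ∧
      |P.f₁ y - ((Q m).v - P.v) * (y 2 - x m 2)| ≤ 3 * t ∧ |y 2| ≤ 1 ∧
      y ∈ Metric.cthickening a F := by
    intro m hm y hy
    simp only [hT, mem_iUnion, Finset.mem_range, mem_preimage] at hy
    obtain ⟨k, hk, hy⟩ := hy
    have h0 := hR0 m hm _ hy
    have h1 := hR1 m hm _ hy
    have h1' := hR1' m hm _ hy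
    have h2 := (hYQ m hm hy.1).2.2
    rw [hf0τ] at h0
    rw [hf1τ, hy2τ] at h1
    rw [hf1τ] at h1'
    rw [hy2τ] at h2
    have hk' : 3 * s * k ≤ a := by
      have : (k : ℝ) ≤ n := by exact_mod_cast hk.le
      nlinarith
    have hk0 : 0 ≤ 3 * s * k := by positivity
    refine ⟨?_, h1', h1, h2, ?_⟩
    · rw [abs_le] at *; constructor <;> linarith
    · refine Metric.mem_cthickening_of_dist_le y (y - τ k) a F (hYF m hm hy.1) ?_
      rw [dist_eq_norm, sub_sub_cancel, hτ, PiLp.norm_single, Real.norm_eq_abs,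
        abs_of_nonneg hk0]
      exact hk'
  have hTvol : ∀ m ∈ Z, lam * a * t * ℓ / 6 ≤ volume.real (T m) := by
    intro m hm
    have h0 : ∀ k, volume ((fun y => y - τ k) ⁻¹' (R m)) = volume (R m) := by
      intro k
      simp only [sub_eq_add_neg, measure_preimage_add_right]
    have h1 : ∀ k, volume.real ((fun y => y - τ k) ⁻¹' (R m)) = volume.real (R m) := by
      intro k
      rw [measureReal_def, h0, measureReal_def]
    have h2 : volume.real (T m) = n * volume.real (R m) := by
      rw [hT]
      simp only
      rw [measureReal_biUnion_finset (h := fun k _ => by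
        rw [h0]; exact hRf m hm) ?_ (fun k _ => hTpre m hm k)]
      · simp only [h1, Finset.sum_const, Finset.card_range, nsmul_eq_mul]
      · intro k _ k' _ hkk'
        rw [Function.onFun, Set.disjoint_left]
        intro y hy hy'
        have e1 := abs_le.1 (hYQ m hm hy.1).1
        have e2 := abs_le.1 (hYQ m hm hy'.1).1
        rw [hf0τ] at e1 e2
        rcases lt_or_gt_of_ne hkk' with h3 | h3
        · have : (k : ℝ) + 1 ≤ k' := by exact_mod_cast h3
          nlinarith
        · have : (k' : ℝ) + 1 ≤ k := by exact_mod_cast h3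
          nlinarith
    rw [h2]
    calc lam * a * t * ℓ / 6 = a / (6 * s) * (lam * s * t * ℓ) := by field_simp
      _ ≤ n * volume.real (R m) := mul_le_mul hn2 (hYvol m hm) (by positivity) (Nat.cast_nonneg _)
  -- In the plane of `P` these are strips of half-width `3 t`. Base cells at distance `|m - m'| ≥ 2`
  -- force intersecting strips to differ in slope by at least a multiple of `(|m - m'| - 1) t M /
  -- b`, so the overlaps decay like `1 / (|m - m'| + 1)` and sum to a logarithm. Nearby cells use
  -- only the angle `M` with `P`.
  have hTov : ∀ m ∈ Z, ∀ m' ∈ Z, volume (T m ∩ T m') ≠ ∞ ∧ volume.real (T m ∩ T m') ≤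
      3600 * a * t * ℓ * (1 / (|(m : ℝ) - m'| + 1)) := by
    intro m hm m' hm'
    have g0 : ∀ y ∈ T m ∩ T m', |1 * y 0 + (-P.p) * y 1 + (-P.q) * y 2 - P.c| ≤ 10 * a := by
      intro y hy
      have := (hTmem m hm y hy.1).1
      simp only [f₀] at this
      convert this using 2; ring
    have g1 : ∀ y ∈ T m ∩ T m', |0 * y 0 + 1 * y 1 + (-P.v) * y 2 - P.e| ≤ 5 * b := by
      intro y hy
      have := (hTmem m hm y hy.1).2.1
      simp only [f₁] at this
      convert this using 2; ring
    have g2 : ∀ y ∈ T m ∩ T m', |0 * y 0 + 1 * y 1 + (-(Q m).v) * y 2 -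
        (P.e - ((Q m).v - P.v) * x m 2)| ≤ 3 * t := by
      intro y hy
      have := (hTmem m hm y hy.1).2.2.1
      simp only [f₁] at this
      convert this using 2; ring
    have g3 : ∀ y ∈ T m ∩ T m', |0 * y 0 + 1 * y 1 + (-(Q m').v) * y 2 -
        (P.e - ((Q m').v - P.v) * x m' 2)| ≤ 3 * t := by
      intro y hy
      have := (hTmem m' hm' y hy.2).2.2.1
      simp only [f₁] at this
      convert this using 2; ring
    have hψm := hψ m hm
    have hψm' := hψ m' hm'
    have hψ0 : (Q m).v - P.v ≠ 0 := abs_pos.1 (hM0.trans_le hψm)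
    obtain ⟨hfin, hv1⟩ := volume_ne_top_and_measureReal_le (d := -((Q m).v - P.v)) g0 g1 g2
      (by positivity) (by positivity) (by positivity) (by ring) (neg_ne_zero.2 hψ0)
    refine ⟨hfin, ?_⟩
    set κ : ℝ := |(m : ℝ) - m'| with hκ
    have hκ0 : 0 ≤ κ := abs_nonneg _
    rcases lt_or_ge κ 2 with hk | hk
    · refine hv1.trans ?_
      rw [abs_neg]
      calc 8 * (10 * a * (5 * b) * (3 * t)) / |(Q m).v - P.v|
          ≤ 8 * (10 * a * (5 * b) * (3 * t)) / M := by gcongr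
        _ = 3600 * a * t * ℓ * (1 / 3) := by rw [hℓ]; field_simp; ring
        _ ≤ _ := by
          have : 1 / 3 ≤ 1 / (κ + 1) := one_div_le_one_div_of_le (by linarith) (by linarith)
          gcongr
    · rcases (T m ∩ T m').eq_empty_or_nonempty with he | ⟨y, hy⟩
      · rw [he, measureReal_empty]; positivity
      · obtain ⟨-, k1, k2, -⟩ := hTmem m hm y hy.1
        obtain ⟨-, -, k3, -⟩ := hTmem m' hm' y hy.2
        set ψ := (Q m).v - P.v with hψd
        set ψ' := (Q m').v - P.v with hψd'
        -- the base points are separated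
        have hsep : (κ - 1) * hh ≤ |x m 2 - x m' 2| := by
          have e1 := floor_div_eq_iff_mem hh0 (hxm m hm)
          have e2 := floor_div_eq_iff_mem hh0 (hxm m' hm')
          have e3 : |((m : ℝ) - m') * hh| ≤ |x m 2 - x m' 2| + hh := by
            have e4 : |((m : ℝ) - m') * hh - (x m 2 - x m' 2)| ≤ hh := by
              rw [abs_le]; constructor <;> linarith
            have := abs_sub_abs_le_abs_sub (((m : ℝ) - m') * hh) (x m 2 - x m' 2)
            linarith
          rw [abs_mul, abs_of_pos hh0, ← hκ] at e3
          linarith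
        -- Strips of equal slope through a common point would have nearly equal base points. The
        -- identity quantifies this by eliminating `y 2`.
        have hid : ψ * ψ' * (x m 2 - x m' 2) = ψ' * (P.f₁ y - ψ * (y 2 - x m 2)) -
            ψ * (P.f₁ y - ψ' * (y 2 - x m' 2)) + P.f₁ y * (ψ - ψ') := by ring
        have hbd : |ψ| * |ψ'| * |x m 2 - x m' 2| ≤
            |ψ'| * (3 * t) + |ψ| * (3 * t) + 5 * b * |ψ - ψ'| := by
          rw [← abs_mul, ← abs_mul, hid]
          refine (abs_add_le _ _).trans (add_le_add ((abs_sub _ _).trans (add_le_add ?_ ?_)) ?_) <;>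
            rw [abs_mul] <;> gcongr
        have hprod : M ^ 2 ≤ |ψ| * |ψ'| := by
          rw [sq]; exact mul_le_mul hψm hψm' hM0.le (abs_nonneg _)
        have hu1 : |ψ'| * (3 * t) ≤ |ψ| * |ψ'| * (3 * r) := by
          rw [← hrM]
          have := mul_le_mul_of_nonneg_right hψm (by positivity : 0 ≤ |ψ'| * (3 * r))
          linarith
        have hu2 : |ψ| * (3 * t) ≤ |ψ| * |ψ'| * (3 * r) := by
          rw [← hrM]
          have := mul_le_mul_of_nonneg_right hψm' (by positivity : 0 ≤ |ψ| * (3 * r))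
          linarith
        have hlow : M ^ 2 * (6 * (κ - 1) * r) ≤ 5 * b * |ψ - ψ'| := by
          have e1 : |ψ| * |ψ'| * (6 * (κ - 1) * r) ≤ 5 * b * |ψ - ψ'| := by
            have e2 : |ψ| * |ψ'| * ((κ - 1) * hh) ≤ |ψ| * |ψ'| * |x m 2 - x m' 2| := by gcongr
            have e3 : 6 * (κ - 1) * r + 6 * r ≤ (κ - 1) * hh := by
              rw [hhh]; nlinarith
            have e4 := mul_le_mul_of_nonneg_left e3 (by positivity : 0 ≤ |ψ| * |ψ'|)
            linarith
          refine le_trans ?_ e1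
          have : 0 ≤ 6 * (κ - 1) * r := by
            have : 0 ≤ κ - 1 := by linarith
            positivity
          gcongr
        have hk1 : 0 < κ - 1 := by linarith
        have hdiff : 0 < |ψ - ψ'| := by
          have : 0 < M ^ 2 * (6 * (κ - 1) * r) := by positivity
          by_contra hcon
          have h0 : |ψ - ψ'| = 0 := le_antisymm (not_lt.1 hcon) (abs_nonneg _)
          rw [h0] at hlow
          linarith
        have hne : ψ - ψ' ≠ 0 := abs_pos.1 hdiff
        refine (volume_ne_top_and_measureReal_le (d := ψ - ψ') g0 g2 g3
          (by positivity) (by positivity) (by positivity) (by rw [hψd, hψd']; ring) hne).2.trans ?_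
        rw [div_le_iff₀ hdiff]
        have e1 : 8 * (10 * a * (3 * t) * (3 * t)) =
            600 * a * t * ℓ / (κ - 1) * (M ^ 2 * (6 * (κ - 1) * r) / (5 * b)) := by
          rw [hℓ, hr]; field_simp; ring
        rw [e1]
        have e2 : M ^ 2 * (6 * (κ - 1) * r) / (5 * b) ≤ |ψ - ψ'| := by
          rw [div_le_iff₀ (by positivity)]; linarith
        have e3 : 600 * a * t * ℓ / (κ - 1) ≤ 3600 * a * t * ℓ * (1 / (κ + 1)) := by
          rw [mul_one_div, div_le_div_iff₀ hk1 (by linarith)]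
          have : 0 < a * t * ℓ := by positivity
          nlinarith
        exact mul_le_mul e3 e2 (by positivity) (by positivity)
  have hTf : ∀ m ∈ Z, volume (T m) ≠ ∞ := fun m hm => by
    have := (hTov m hm m hm).1
    rwa [inter_self] at this
  have hcs := sq_sum_measureReal_le_of_finset Z T hTm hTf
  set U := ⋃ m ∈ Z, T m with hU
  have hUsub : U ⊆ P.box (10 * a) (5 * b) ∩ Metric.cthickening a F := by
    refine iUnion₂_subset fun m hm y hy => ?_
    obtain ⟨h1, h2, -, h3, h4⟩ := hTmem m hm y hy
    exact ⟨⟨h1, h2, h3⟩, h4⟩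
  refine le_trans ?_ (measureReal_mono hUsub (measure_ne_top_of_subset inter_subset_left
    (volume_box_ne_top (by positivity) (by positivity))))
  rcases Z.card.eq_zero_or_pos with hZ0 | hZ0
  · rw [hZ0] at hGcard
    have h0 : volume.real G = 0 := le_antisymm (by simpa using hGcard) measureReal_nonneg
    rw [h0, mul_zero]
    exact measureReal_nonneg
  have hZp : 0 < (Z.card : ℝ) := by exact_mod_cast hZ0
  have hsum : ∑ m ∈ Z, ∑ m' ∈ Z, volume.real (T m ∩ T m') ≤
      Z.card * (3600 * a * t * ℓ * (2 * (1 + Real.log (8 * (M / t))))) := by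
    rw [← nsmul_eq_mul]
    refine Finset.sum_le_card_nsmul _ _ _ fun m hm => ?_
    refine (Finset.sum_le_sum fun m' hm' => (hTov m hm m' hm').2).trans ?_
    rw [← Finset.mul_sum]
    have h1 := sum_inv_abs_sub_add_one_le Z m (N := 2 * D + 1) (fun m' hm' => by
      have e1 := Finset.mem_Icc.1 (Finset.mem_filter.1 hm).1
      have e2 := Finset.mem_Icc.1 (Finset.mem_filter.1 hm').1
      omega)
    have h2 : Real.log ((2 * D + 1 : ℕ) : ℝ) ≤ Real.log (8 * (M / t)) := by
      apply Real.log_le_log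
      · positivity
      · push_cast; linarith
    refine mul_le_mul_of_nonneg_left (h1.trans ?_) (by positivity)
    linarith
  have hlowsum : Z.card * (lam * a * t * ℓ / 6) ≤ ∑ m ∈ Z, volume.real (T m) := by
    rw [← nsmul_eq_mul]
    exact Finset.card_nsmul_le_sum _ _ _ hTvol
  set Λ := 1 + Real.log (8 * (M / t)) with hΛ
  have h1 : (Z.card * (lam * a * t * ℓ / 6)) ^ 2 ≤
      volume.real U * (Z.card * (3600 * a * t * ℓ * (2 * Λ))) :=
    (pow_le_pow_left₀ (by positivity) hlowsum 2).trans
      (hcs.trans (mul_le_mul_of_nonneg_left hsum measureReal_nonneg))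
  have e1 : (Z.card * (lam * a * t * ℓ / 6)) ^ 2 =
      (Z.card * (lam ^ 2 * a * t * ℓ / (259200 * Λ))) *
        (Z.card * (3600 * a * t * ℓ * (2 * Λ))) := by
    field_simp; norm_num
  rw [e1] at h1
  have h2 := le_of_mul_le_mul_right h1 (by positivity)
  refine le_trans ?_ h2
  calc lam ^ 2 * a * b / (12441600 * s * t * Λ) * volume.real G
      ≤ lam ^ 2 * a * b / (12441600 * s * t * Λ) * (Z.card * (4 * s * t * hh)) := by gcongr
    _ = _ := by rw [hhh, hr, hℓ]; field_simp; norm_num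

end ShearParam

/-! ### Regular shadings. -/

/-- The points of `Y` near which `Y` has mass at least `c * 2⁻ᵐ` in the horizontal slab of
height `2⁻ᵐ`, for all `m < L`. -/
def regularPart (c : ℝ) (L : ℕ) (Y : Set (EuclideanSpace ℝ (Fin 3))) :
    Set (EuclideanSpace ℝ (Fin 3)) :=
  Y ∩ {x | ∀ m < L, c * (1 / 2 ^ m) ≤
    volume.real (Y ∩ {y | ⌊y 2 / (1 / 2 ^ m)⌋ = ⌊x 2 / (1 / 2 ^ m)⌋})}

theorem measurableSet_regularPart (c : ℝ) (L : ℕ) {Y : Set (EuclideanSpace ℝ (Fin 3))}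
    (hY : MeasurableSet Y) : MeasurableSet (regularPart c L Y) := by
  refine hY.inter ?_
  have e : {x : EuclideanSpace ℝ (Fin 3) | ∀ m < L, c * (1 / 2 ^ m) ≤
      volume.real (Y ∩ {y | ⌊y 2 / (1 / 2 ^ m)⌋ = ⌊x 2 / (1 / 2 ^ m)⌋})} =
      ⋂ m ∈ Finset.range L, {x | c * (1 / 2 ^ m) ≤
      volume.real (Y ∩ {y | ⌊y 2 / (1 / 2 ^ m)⌋ = ⌊x 2 / (1 / 2 ^ m)⌋})} := by
    ext x; simp
  rw [e]
  refine Finset.measurableSet_biInter _ fun m _ => ?_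
  refine measurableSet_le measurable_const ?_
  have h1 : Measurable fun x : EuclideanSpace ℝ (Fin 3) => ⌊x 2 / (1 / 2 ^ m : ℝ)⌋ :=
    Int.measurable_floor.comp ((by fun_prop :
      Continuous fun x : EuclideanSpace ℝ (Fin 3) => x 2).measurable.div_const _)
  have h2 : Measurable fun k : ℤ => volume.real (Y ∩ {y | ⌊y 2 / (1 / 2 ^ m : ℝ)⌋ = k}) :=
    measurable_from_top
  exact h2.comp h1

/-- At level `m` at most `2 * 2^m + 1` slabs meet `|x₂| ≤ 1`, and each light one costs less than `c
/ 2^m`. Every level therefore discards at most `3 c`. -/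
theorem measureReal_le_regularPart {c : ℝ} (hc : 0 ≤ c) (L : ℕ)
    {Y : Set (EuclideanSpace ℝ (Fin 3))} (hYf : volume Y ≠ ∞) (hY : ∀ x ∈ Y, |x 2| ≤ 1) :
    volume.real Y ≤ volume.real (regularPart c L Y) + 3 * L * c := by
  classical
  set slice : ℕ → ℤ → Set (EuclideanSpace ℝ (Fin 3)) := fun m k =>
    Y ∩ {y | ⌊y 2 / (1 / 2 ^ m : ℝ)⌋ = k} with hslice
  set bad : ℕ → ℤ → Set (EuclideanSpace ℝ (Fin 3)) := fun m k =>
    if volume.real (slice m k) < c * (1 / 2 ^ m) then slice m k else ∅ with hbad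
  have hbadv : ∀ m k, volume.real (bad m k) ≤ c * (1 / 2 ^ m) := by
    intro m k
    rw [hbad]
    simp only
    split_ifs with h
    · exact h.le
    · rw [measureReal_empty]; positivity
  have hbadY : ∀ m k, bad m k ⊆ Y := by
    intro m k
    rw [hbad]
    simp only
    split_ifs with h
    · exact inter_subset_left
    · exact empty_subset _
  set B := ⋃ m ∈ Finset.range L, ⋃ k ∈ Finset.Icc (-(2 ^ m) : ℤ) (2 ^ m), bad m k with hB
  have hBY : B ⊆ Y := iUnion₂_subset fun m _ => iUnion₂_subset fun k _ => hbadY m k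
  have hcov : Y ⊆ regularPart c L Y ∪ B := by
    intro x hx
    by_cases h : ∀ m < L, c * (1 / 2 ^ m) ≤
        volume.real (Y ∩ {y | ⌊y 2 / (1 / 2 ^ m : ℝ)⌋ = ⌊x 2 / (1 / 2 ^ m : ℝ)⌋})
    · exact Or.inl ⟨hx, h⟩
    · push Not at h
      obtain ⟨m, hm, hlt⟩ := h
      right
      simp only [hB, mem_iUnion]
      refine ⟨m, Finset.mem_range.2 hm, ⌊x 2 / (1 / 2 ^ m : ℝ)⌋, ?_, ?_⟩
      · have h1 := abs_le.1 (hY x hx)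
        have h2 : (0 : ℝ) < 2 ^ m := by positivity
        have h3 : x 2 / (1 / 2 ^ m : ℝ) = x 2 * 2 ^ m := by field_simp
        rw [h3, Finset.mem_Icc, Int.le_floor, ← Int.lt_add_one_iff, Int.floor_lt]
        push_cast
        constructor <;> nlinarith
      · rw [hbad]
        simp only
        rw [if_pos hlt]
        exact ⟨hx, rfl⟩
  have hBv : volume.real B ≤ 3 * L * c := by
    refine (measureReal_biUnion_finset_le _ _).trans ?_
    have h1 : ∀ m ∈ Finset.range L, volume.real
        (⋃ k ∈ Finset.Icc (-(2 ^ m) : ℤ) (2 ^ m), bad m k) ≤ 3 * c := by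
      intro m _
      refine (measureReal_biUnion_finset_le _ _).trans
        ((Finset.sum_le_card_nsmul _ _ _ fun k _ => hbadv m k).trans ?_)
      rw [nsmul_eq_mul, Int.card_Icc]
      have h2 : (((2 ^ m + 1 - -(2 ^ m) : ℤ).toNat : ℤ) : ℝ) = 2 * 2 ^ m + 1 := by
        have h0 : (0 : ℤ) < 2 ^ m := by positivity
        rw [Int.toNat_of_nonneg (by linarith)]; push_cast; ring
      have h3 : (((2 ^ m + 1 - -(2 ^ m) : ℤ).toNat : ℕ) : ℝ) = 2 * 2 ^ m + 1 := by exact_mod_cast h2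
      rw [h3]
      have h4 : (1 : ℝ) ≤ 2 ^ m := one_le_pow₀ (by norm_num)
      have e : (2 * 2 ^ m + 1) * (c * (1 / 2 ^ m)) = c * (2 + 1 / 2 ^ m) := by field_simp
      have h5 : (1 : ℝ) / 2 ^ m ≤ 1 := by rw [div_le_one (by positivity)]; exact h4
      rw [e]
      nlinarith
    refine (Finset.sum_le_card_nsmul _ _ _ h1).trans_eq ?_
    rw [Finset.card_range, nsmul_eq_mul]; ring
  have hf : volume (regularPart c L Y ∪ B) ≠ ∞ :=
    measure_ne_top_of_subset (union_subset inter_subset_left hBY) hYf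
  exact (measureReal_mono hcov hf).trans ((measureReal_union_le _ _).trans (by linarith))

/-! ### The trichotomy at one scale. -/

theorem measureReal_ball_one_le :
    volume.real (Metric.ball (0 : EuclideanSpace ℝ (Fin 3)) 1) ≤ 8 := by
  have h : ∀ k, ∀ x ∈ Metric.ball (0 : EuclideanSpace ℝ (Fin 3)) 1, |x k| ≤ 1 := by
    intro k x hx
    have := (abs_coord_sub_le_dist x 0 k).trans (Metric.mem_ball.1 hx).le
    simpa using this
  have := (volume_ne_top_and_measureReal_le (S := Metric.ball (0 : EuclideanSpace ℝ (Fin 3)) 1)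
    (a₀ := 1) (a₁ := 0) (a₂ := 0) (a := 0) (b₀ := 0) (b₁ := 1) (b₂ := 0) (b := 0) (c₀ := 0)
    (c₁ := 0) (c₂ := 1) (c := 0) (h₀ := 1) (h₁ := 1) (h₂ := 1) (d := 1)
    (fun x hx => by simpa using h 0 x hx) (fun x hx => by simpa using h 1 x hx)
    (fun x hx => by simpa using h 2 x hx) zero_le_one zero_le_one zero_le_one (by ring)
    one_ne_zero).2
  simpa using this

/-- Averaging over centres in the ball of radius `50`; `10 ^ 6 = 8 * 50 ^ 3` bounds its volume. -/
theorem exists_ball_one_of_subset {U : Set (EuclideanSpace ℝ (Fin 3))} (hUm : MeasurableSet U)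
    (hU : U ⊆ Metric.closedBall 0 41) {d : ℝ} (hd : 0 < d) (h : 10 ^ 6 * d < volume.real U) :
    ∃ x, d * volume.real (Metric.ball (0 : EuclideanSpace ℝ (Fin 3)) 1) ≤
      volume.real (Metric.ball x 1 ∩ U) := by
  by_contra! hcon
  have hball : 0 < volume.real (Metric.ball (0 : EuclideanSpace ℝ (Fin 3)) 1) :=
    ENNReal.toReal_pos (Metric.measure_ball_pos _ _ zero_lt_one).ne' measure_ball_lt_top.ne
  have h1 := measureReal_ball_mul_le (G := U) (Z := Metric.ball 0 50) hUm
    (measure_ne_top_of_subset hU measure_closedBall_lt_top.ne) measurableSet_ball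
    measure_ball_lt_top.ne (r := 1) (fun x y hy hxy => by
      have h1 := Metric.mem_closedBall.1 (hU hy)
      have h2 := dist_triangle x y 0
      rw [Metric.mem_ball]; linarith)
    (τ := d * volume.real (Metric.ball (0 : EuclideanSpace ℝ (Fin 3)) 1)) (by positivity)
    (fun x => (hcon x).le)
  have h2 : volume.real (Metric.ball (0 : EuclideanSpace ℝ (Fin 3)) 50) =
      50 ^ 3 * volume.real (Metric.ball (0 : EuclideanSpace ℝ (Fin 3)) 1) := by
    have := Measure.addHaar_ball (μ := (volume : Measure (EuclideanSpace ℝ (Fin 3)))) 0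
      (by norm_num : (0 : ℝ) ≤ 50)
    rw [measureReal_def, this, ENNReal.toReal_mul, ENNReal.toReal_ofReal (by positivity),
      measureReal_def]
    simp
  rw [h2] at h1
  have h3 : volume.real (Metric.ball (0 : EuclideanSpace ℝ (Fin 3)) 1) * volume.real U ≤
      volume.real (Metric.ball (0 : EuclideanSpace ℝ (Fin 3)) 1) * (10 ^ 6 * d) := by
    refine h1.trans ?_
    have := mul_le_mul_of_nonneg_left measureReal_ball_one_le
      (by positivity : 0 ≤ d * volume.real (Metric.ball (0 : EuclideanSpace ℝ (Fin 3)) 1) * 50 ^ 3)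
    linarith
  exact absurd (le_of_mul_le_mul_left h3 hball) (not_le.2 h)

namespace ShearParam

variable {P Q : ShearParam} {s t : ℝ}

theorem le_spread : t ≤ P.spread Q t := le_max_left _ _

theorem le_thickness : s ≤ P.thickness Q s t := le_max_left _ _

theorem abs_v_sub_le_two (hP : |P.v| ≤ 1) (hQ : |Q.v| ≤ 1) : |Q.v - P.v| ≤ 2 := by
  rw [abs_le] at *; constructor <;> linarith

theorem spread_le (ht20 : t ≤ 20) (hP : |P.v| ≤ 1) (hQ : |Q.v| ≤ 1) : P.spread Q t ≤ 20 :=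
  max_le ht20 ((abs_v_sub_le_two hP hQ).trans (by norm_num))

theorem thickness_le (ht : 0 < t) (hst : s ≤ t) (ht20 : t ≤ 20) (hPp : |P.p| ≤ 1) (hPq : |P.q| ≤ 1)
    (hPv : |P.v| ≤ 1) (hQp : |Q.p| ≤ 1) (hQq : |Q.q| ≤ 1) : P.thickness Q s t ≤ 40 := by
  have h1 : |Q.p - P.p| ≤ 2 := by rw [abs_le] at *; constructor <;> linarith
  have h2 : |P.v * (Q.p - P.p)| ≤ 1 * 2 := by
    rw [abs_mul]; exact mul_le_mul hPv h1 (abs_nonneg _) zero_le_one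
  have h3 : |Q.q - P.q + P.v * (Q.p - P.p)| ≤ 4 := by
    rw [abs_le] at *; constructor <;> linarith
  refine max_le (by linarith) (max_le ?_ ?_)
  · nlinarith [abs_nonneg (Q.p - P.p)]
  · rw [div_le_iff₀ (ht.trans_le le_spread)]
    have : t ≤ P.spread Q t := le_spread
    nlinarith [abs_nonneg (Q.q - P.q + P.v * (Q.p - P.p))]

/-- Thickness lies in `[s, 40]` and spread in `[t, 20]`, so `L` dyadic levels suffice for each. -/
theorem exists_class {ι : Type*} (P : ι → ShearParam) (hPp : ∀ i, |(P i).p| ≤ 1)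
    (hPq : ∀ i, |(P i).q| ≤ 1) (hPv : ∀ i, |(P i).v| ≤ 1) {s t : ℝ} (hs : 0 < s) (hst : s ≤ t)
    (ht20 : t ≤ 20) {L : ℕ} (hL : 40 < 2 ^ L * s) :
    ∃ cls : ι → ι → Fin L × Fin L, ∀ i j,
      2 ^ (cls i j).1.1 * s ≤ (P i).thickness (P j) s t ∧
      (P i).thickness (P j) s t ≤ 2 * (2 ^ (cls i j).1.1 * s) ∧
      2 ^ (cls i j).2.1 * t ≤ (P i).spread (P j) t ∧
      (P i).spread (P j) t ≤ 2 * (2 ^ (cls i j).2.1 * t) := by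
  have ht : 0 < t := hs.trans_le hst
  have h : ∀ i j, ∃ c : Fin L × Fin L,
      2 ^ c.1.1 * s ≤ (P i).thickness (P j) s t ∧
      (P i).thickness (P j) s t ≤ 2 * (2 ^ c.1.1 * s) ∧
      2 ^ c.2.1 * t ≤ (P i).spread (P j) t ∧ (P i).spread (P j) t ≤ 2 * (2 ^ c.2.1 * t) := by
    intro i j
    obtain ⟨k, hk1, hk2⟩ := exists_nat_pow_near
      ((one_le_div hs).2 (le_thickness : s ≤ (P i).thickness (P j) s t)) one_lt_two
    obtain ⟨l, hl1, hl2⟩ := exists_nat_pow_near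
      ((one_le_div ht).2 (le_spread : t ≤ (P i).spread (P j) t)) one_lt_two
    rw [le_div_iff₀ hs] at hk1
    rw [div_lt_iff₀ hs] at hk2
    rw [le_div_iff₀ ht] at hl1
    rw [div_lt_iff₀ ht] at hl2
    have hkL : k < L := by
      rw [← pow_lt_pow_iff_right₀ (one_lt_two : (1 : ℝ) < 2), ← mul_lt_mul_iff_of_pos_right hs]
      exact (hk1.trans (thickness_le ht hst ht20 (hPp i) (hPq i) (hPv i) (hPp j) (hPq j))).trans_lt hL
    have hlL : l < L := by
      rw [← pow_lt_pow_iff_right₀ (one_lt_two : (1 : ℝ) < 2), ← mul_lt_mul_iff_of_pos_right ht]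
      refine (hl1.trans (spread_le ht20 (hPv i) (hPv j))).trans_lt ?_
      have : (2 : ℝ) ^ L * s ≤ 2 ^ L * t := by gcongr
      linarith
    refine ⟨(⟨k, hkL⟩, ⟨l, hlL⟩), hk1, ?_, hl1, ?_⟩
    · rw [pow_succ] at hk2; linarith
    · rw [pow_succ] at hl2; linarith
  choose cls hcls using h
  exact ⟨cls, hcls⟩

set_option maxHeartbeats 1000000 in
/-- Either the union of the shadings is dense in some ball, at scale `s`, or the boxes may be
replaced by larger ones with the same eccentricity, up to the factor `2 ^ k₀`. -/
theorem dense_ball_or_enlarge {ι : Type*} [Fintype ι] [Nonempty ι] (P : ι → ShearParam)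
    (hPp : ∀ i, |(P i).p| ≤ 1) (hPq : ∀ i, |(P i).q| ≤ 1) (hPv : ∀ i, |(P i).v| ≤ 1)
    {s t lam K : ℝ} {k₀ l₀ L : ℕ} (hs : 0 < s) (ht20 : t ≤ 20) (hk₀ : 1 ≤ k₀) (hl₀ : 2 ≤ l₀)
    (hst : 2 ^ k₀ * s ≤ t) (hL : 40 < 2 ^ L * s) (hlam : 0 < lam) (hK : 0 < K)
    {F : Set (EuclideanSpace ℝ (Fin 3))} (hFm : MeasurableSet F) (hF : F ⊆ Metric.closedBall 0 41)
    (hmass : lam * s * t * Fintype.card ι ≤ ∑ i, volume.real ((P i).box s t ∩ F))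
    (hCW : ∀ i, ({j | (P j).box s t ⊆ (P i).box (9 * (2 ^ l₀ * 2 ^ k₀ * s)) (5 * (2 ^ l₀ * t))}.ncard
      : ℝ) ≤ K * (2 ^ l₀ * 2 ^ k₀ * s) * (2 ^ l₀ * t) * Fintype.card ι) :
    (∃ x, lam ^ 2 / (10 ^ 10 * K * L ^ 6 * (2 ^ l₀) ^ 2 * 2 ^ k₀) *
        volume.real (Metric.ball (0 : EuclideanSpace ℝ (Fin 3)) 1) ≤
        volume.real (Metric.ball x 1 ∩ F)) ∨
    (∃ x, lam ^ 2 / (10 ^ 20 * L ^ 6) *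
        volume.real (Metric.ball (0 : EuclideanSpace ℝ (Fin 3)) (2 ^ k₀ * s / 50)) ≤
        volume.real (Metric.ball x (2 ^ k₀ * s / 50) ∩ F)) ∨
    (2 ^ l₀ * t ≤ 2 ∧ lam ^ 3 / (10 ^ 10 * L ^ 5) * (2 ^ l₀ * 2 ^ k₀ * s) * (2 ^ l₀ * t) *
        Fintype.card ι ≤
      ∑ i, volume.real ((P i).box (10 * (2 ^ l₀ * 2 ^ k₀ * s)) (5 * (2 ^ l₀ * t)) ∩
        Metric.cthickening (2 ^ l₀ * 2 ^ k₀ * s) F)) := by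
  classical
  have hX' : (2 : ℝ) ≤ 2 ^ k₀ := by
    calc (2 : ℝ) = 2 ^ 1 := by norm_num
      _ ≤ 2 ^ k₀ := pow_le_pow_right₀ (by norm_num) hk₀
  have hX : (4 : ℝ) ≤ 2 ^ l₀ := by
    calc (4 : ℝ) = 2 ^ 2 := by norm_num
      _ ≤ 2 ^ l₀ := pow_le_pow_right₀ (by norm_num) hl₀
  have hst' : s ≤ t := by nlinarith
  have ht : 0 < t := hs.trans_le hst'
  have hL1 : 1 ≤ L := by
    by_contra hcon
    have : L = 0 := by omega
    rw [this, pow_zero] at hL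
    linarith
  have hL1' : (1 : ℝ) ≤ L := by exact_mod_cast hL1
  have hN : 0 < (Fintype.card ι : ℝ) := by exact_mod_cast Fintype.card_pos
  have hboxf : ∀ i, volume ((P i).box s t) ≠ ∞ := fun i => volume_box_ne_top hs.le ht.le
  obtain ⟨cls, hcls⟩ := exists_class P hPp hPq hPv hs hst' ht20 hL
  set Y : ι → Set (EuclideanSpace ℝ (Fin 3)) := fun i => (P i).box s t ∩ F with hY
  have hYm : ∀ i, MeasurableSet (Y i) := fun i => measurableSet_box.inter hFm
  have hYb : ∀ i, Y i ⊆ (P i).box s t := fun i => inter_subset_left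
  have hYf : ∀ i, volume (Y i) ≠ ∞ := fun i => measure_ne_top_of_subset (hYb i) (hboxf i)
  -- Passing to regular parts loses `3 L c` per box, which is half of the average mass `lam s t`.
  set c := lam / (6 * L) * s * t with hc
  have hc0 : 0 < c := by positivity
  set Y' : ι → Set (EuclideanSpace ℝ (Fin 3)) := fun i => regularPart c L (Y i) with hY'
  have hY'Y : ∀ i, Y' i ⊆ Y i := fun i => inter_subset_left
  have hY'm : ∀ i, MeasurableSet (Y' i) := fun i => measurableSet_regularPart c L (hYm i)
  have hY'f : ∀ i, volume (Y' i) ≠ ∞ := fun i => measure_ne_top_of_subset (hY'Y i) (hYf i)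
  have hmass' : lam * s * t / 2 * Fintype.card ι ≤ ∑ i, volume.real (Y' i) := by
    have h1 : ∑ i, volume.real (Y i) ≤ ∑ i, (volume.real (Y' i) + 3 * L * c) :=
      Finset.sum_le_sum fun i _ => measureReal_le_regularPart hc0.le L (hYf i)
        fun x hx => (hYb i hx).2.2
    rw [Finset.sum_add_distrib, Finset.sum_const, Finset.card_univ, nsmul_eq_mul] at h1
    have h2 : 3 * L * c = lam * s * t / 2 := by rw [hc]; field_simp; norm_num
    rw [h2] at h1
    linarith
  have : Nonempty (Fin L) := ⟨⟨0, hL1⟩⟩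
  obtain ⟨⟨k, l⟩, hdom⟩ := exists_dominatedPart (μ := volume) hY'f cls
  set G := dominatedPart Y' cls (k, l) with hG
  have hcard : (Fintype.card (Fin L × Fin L) : ℝ) = (L : ℝ) ^ 2 := by
    simp [sq]
  rw [hcard] at hdom
  have hGm : ∀ i, MeasurableSet (G i) := fun i => measurableSet_dominatedPart hY'm cls (k, l) i
  have hGY : ∀ i, G i ⊆ Y' i := fun i => inter_subset_left
  have hGf : ∀ i, volume (G i) ≠ ∞ := fun i => measure_ne_top_of_subset (hGY i) (hY'f i)
  have hGdom : ∀ i, ∀ x ∈ G i, ∑ j, (Y' j).indicator (1 : EuclideanSpace ℝ (Fin 3) → ℝ) x ≤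
      (L : ℝ) ^ 2 * ∑ j, if cls i j = (k, l) then
        (Y' j).indicator (1 : EuclideanSpace ℝ (Fin 3) → ℝ) x else 0 := by
    intro i x hx
    have := hx.2
    rwa [mem_ofPred_eq, hcard] at this
  have hGmass : lam * s * t / (2 * L ^ 2) * Fintype.card ι ≤ ∑ i, volume.real (G i) := by
    have h1 := hmass'.trans hdom
    have e : lam * s * t / (2 * L ^ 2) * Fintype.card ι =
      (lam * s * t / 2 * Fintype.card ι) / (L : ℝ) ^ 2 := by field_simp
    rw [e, div_le_iff₀' (by positivity)]
    exact h1
  have hGpos : 0 < ∑ i, volume.real (G i) := lt_of_lt_of_le (by positivity) hGmass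
  have hGU : (⋃ i, G i) ⊆ F := iUnion_subset fun i => (hGY i).trans ((hY'Y i).trans inter_subset_right)
  have hrelc : ∀ i j, cls i j = (k, l) →
      2 ^ k.1 * s ≤ (P i).thickness (P j) s t ∧ (P i).thickness (P j) s t ≤ 2 * (2 ^ k.1 * s) ∧
      2 ^ l.1 * t ≤ (P i).spread (P j) t ∧ (P i).spread (P j) t ≤ 2 * (2 ^ l.1 * t) := by
    intro i j hij
    have := hcls i j
    rwa [hij] at this
  -- every point of `G i` lies on a related box
  have hGrel : ∀ i, ∀ x ∈ G i, ∃ j, cls i j = (k, l) ∧ x ∈ Y' j := by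
    intro i x hx
    by_contra! hcon
    have h1 := hGdom i x hx
    have h2 : ∑ j, (if cls i j = (k, l) then
        (Y' j).indicator (1 : EuclideanSpace ℝ (Fin 3) → ℝ) x else 0) = 0 := by
      refine Finset.sum_eq_zero fun j _ => ?_
      split_ifs with hj
      · exact indicator_of_notMem (hcon j hj) _
      · rfl
    rw [h2, mul_zero] at h1
    have h3 : (Y' i).indicator (1 : EuclideanSpace ℝ (Fin 3) → ℝ) x ≤
        ∑ j, (Y' j).indicator (1 : EuclideanSpace ℝ (Fin 3) → ℝ) x :=
      Finset.single_le_sum (f := fun j => (Y' j).indicator (1 : EuclideanSpace ℝ (Fin 3) → ℝ) x)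
        (fun j _ => indicator_nonneg (fun _ _ => zero_le_one) x) (Finset.mem_univ i)
    rw [indicator_of_mem (hGY i hx)] at h3
    simp only [Pi.one_apply] at h3
    linarith
  obtain ⟨i₁, x₁, hx₁⟩ : ∃ i, (G i).Nonempty := by
    obtain ⟨i, -, hi⟩ := Finset.exists_lt_of_sum_lt (s := Finset.univ) (f := fun _ => (0 : ℝ))
      (g := fun i => volume.real (G i)) (by simpa using hGpos)
    refine ⟨i, ?_⟩
    by_contra hcon
    rw [not_nonempty_iff_eq_empty] at hcon
    rw [hcon, measureReal_empty] at hi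
    exact lt_irrefl _ hi
  obtain ⟨j₁, hj₁, -⟩ := hGrel i₁ x₁ hx₁
  rcases le_or_gt k₀ k.1 with hk | hk
  · -- thick intersections
    right; left
    have hwX : (2 : ℝ) ^ k₀ * s ≤ 2 ^ k.1 * s := by
      have : (2 : ℝ) ^ k₀ ≤ 2 ^ k.1 := pow_le_pow_right₀ (by norm_num) hk
      gcongr
    have hl1 : (1 : ℝ) ≤ 2 ^ l.1 := one_le_pow₀ (by norm_num)
    have hM20 : 2 ^ l.1 * t ≤ 20 := (hrelc i₁ j₁ hj₁).2.2.1.trans (spread_le ht20 (hPv i₁) (hPv j₁))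
    obtain ⟨x, hx⟩ := exists_ball_of_thick P hPp hPq hPv (s := s) (t := t) (M := 2 ^ l.1 * t)
      (w := 2 ^ k.1 * s) (ϱ := 2 ^ k₀ * s / 50) (n := (L : ℝ) ^ 2) (l := lam * s * t / (2 * L ^ 2))
      hs ht (by nlinarith) hM20 (by nlinarith) (by positivity) (by linarith) (by linarith)
      (by
        rw [le_div_iff₀ (by positivity)]
        have : 2 ^ k₀ * s / 50 * (2 ^ l.1 * t) ≤ t / 50 * 20 := by gcongr
        linarith) (by positivity) (by positivity) G Y' hGm hY'm hGY
      (fun i => (hY'Y i).trans (hYb i)) (fun i j => cls i j = (k, l))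
      (fun i j hij => ⟨(hrelc i j hij).2.2.1, (hrelc i j hij).2.2.2, (hrelc i j hij).1,
        (hrelc i j hij).2.1⟩) hGdom hGmass hGpos
    refine ⟨x, le_trans ?_ (hx.trans (measureReal_mono (inter_subset_inter_right _ hGU)
      (measure_ne_top_of_subset inter_subset_left measure_ball_lt_top.ne)))⟩
    refine mul_le_mul_of_nonneg_right ?_ measureReal_nonneg
    have e : (lam * s * t / (2 * L ^ 2)) ^ 2 / (10 ^ 19 * (L : ℝ) ^ 2 * s ^ 2 * t ^ 2) =
        lam ^ 2 / (4 * 10 ^ 19 * L ^ 6) := by field_simp; norm_num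
    rw [e]
    refine div_le_div_of_nonneg_left (by positivity) (by positivity) ?_
    refine mul_le_mul_of_nonneg_right (by norm_num) (by positivity)
  have hwX : 2 * (2 ^ k.1 * s) ≤ 2 ^ k₀ * s := by
    have : (2 : ℝ) ^ (k.1 + 1) ≤ 2 ^ k₀ := pow_le_pow_right₀ (by norm_num) hk
    rw [pow_succ] at this
    nlinarith
  set X : ℝ := 2 ^ l₀ with hXd
  set X' : ℝ := 2 ^ k₀ with hX'd
  have hXX'8 : 8 ≤ X * X' := by nlinarith
  rcases le_or_gt l₀ l.1 with hl | hl
  · -- intersections at a large angle within the planes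
    right; right
    have hMX : X * t ≤ 2 ^ l.1 * t := by
      have : X ≤ 2 ^ l.1 := pow_le_pow_right₀ (by norm_num) hl
      gcongr
    have hspread : ∀ i j, cls i j = (k, l) → (P i).spread (P j) t = |(P j).v - (P i).v| := by
      intro i j hij
      have h1 := (hrelc i j hij).2.2.1
      rcases max_choice t |(P j).v - (P i).v| with h2 | h2
      · have h3 : (P i).spread (P j) t = t := h2
        rw [h3] at h1
        nlinarith
      · exact h2
    refine ⟨hMX.trans ?_, ?_⟩
    · have := (hrelc i₁ j₁ hj₁).2.2.1
      rw [hspread i₁ j₁ hj₁] at this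
      exact this.trans (abs_v_sub_le_two (hPv i₁) (hPv j₁))
    -- The slab height needed is exactly dyadic, one of those at which `regularPart` guarantees
    -- mass.
    have hℓ : X * t / (2 ^ l.1 * t) = 1 / 2 ^ (l.1 - l₀) := by
      have : (2 : ℝ) ^ l.1 = 2 ^ (l.1 - l₀) * 2 ^ l₀ := by rw [← pow_add]; congr 1; omega
      rw [this, hXd]
      field_simp
    have hM0 : 0 < 2 ^ l.1 * t := by positivity
    have hmain : ∀ i, (lam / (6 * L)) ^ 2 * (X * X' * s) * (X * t) /
        (12441600 * s * t * (1 + Real.log (8 * (2 ^ l.1 * t / t)))) * volume.real (G i) ≤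
        volume.real ((P i).box (10 * (X * X' * s)) (5 * (X * t)) ∩
          Metric.cthickening (X * X' * s) F) := by
      intro i
      refine le_measureReal_box_inter_cthickening (P i) hs ht (by nlinarith) hMX (by nlinarith)
        (by positivity) (G := G i) ((hGY i).trans ((hY'Y i).trans (hYb i))) ?_
      intro x hx
      obtain ⟨j, hj, hxj⟩ := hGrel i x hx
      obtain ⟨r1, r2, r3, r4⟩ := hrelc i j hj
      refine ⟨P j, Y j, hYm j, hYb j, inter_subset_right, hY'Y j hxj, ?_, ?_, ?_, ?_⟩
      · rw [← hspread i j hj]; exact r3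
      · rw [← hspread i j hj]; exact r4
      · have w0 : 0 < (P i).thickness (P j) s t := hs.trans_le le_thickness
        have w1 : (P i).thickness (P j) s t ≤ X' * s := r2.trans hwX
        have e1 : 2 * (P i).thickness (P j) s t * (P i).spread (P j) t * (X * t / (2 ^ l.1 * t)) / t ≤
            2 * (X' * s) * (2 * (2 ^ l.1 * t)) * (X * t / (2 ^ l.1 * t)) / t := by
          have : 0 ≤ (P i).spread (P j) t := ht.le.trans le_spread
          gcongr
        have e2 : 2 * (X' * s) * (2 * (2 ^ l.1 * t)) * (X * t / (2 ^ l.1 * t)) / t =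
            4 * (X * X' * s) := by field_simp; norm_num
        rw [e2] at e1
        have e3 : X' * s ≤ X * X' * s := by nlinarith [mul_pos (by positivity : 0 < X') hs]
        nlinarith
      · rw [hℓ]
        have := hxj.2 (l.1 - l₀) (by have := l.2; omega)
        rwa [hc] at this
    refine le_trans ?_ (Finset.sum_le_sum fun i _ => hmain i)
    rw [← Finset.mul_sum]
    have hlog0 : 0 < 1 + Real.log (8 * (2 ^ l.1 * t / t)) := by
      have : (1 : ℝ) ≤ 2 ^ l.1 := one_le_pow₀ (by norm_num)
      have e : (2 : ℝ) ^ l.1 * t / t = 2 ^ l.1 := by field_simp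
      rw [e]
      have := Real.log_nonneg (by linarith : (1 : ℝ) ≤ 8 * 2 ^ l.1)
      linarith
    have hlog : 1 + Real.log (8 * (2 ^ l.1 * t / t)) ≤ 5 * L := by
      have e : (8 : ℝ) * (2 ^ l.1 * t / t) = 2 ^ (l.1 + 3) := by rw [pow_add]; field_simp; norm_num
      rw [e, Real.log_pow]
      have h1 : Real.log 2 ≤ 1 := by
        have := Real.log_le_sub_one_of_pos (by norm_num : (0 : ℝ) < 2); linarith
      have h2 : ((l.1 + 3 : ℕ) : ℝ) ≤ L + 3 := by
        have := l.2.le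
        push_cast
        have : (l.1 : ℝ) ≤ L := by exact_mod_cast this
        linarith
      have h3 : 0 ≤ Real.log 2 := Real.log_nonneg (by norm_num)
      nlinarith [(Nat.cast_nonneg (l.1 + 3) : (0 : ℝ) ≤ ((l.1 + 3 : ℕ) : ℝ))]
    -- Two factors of `lam` are the slab densities of the crossing boxes, and the third is the total
    -- mass of the `G i`.
    calc lam ^ 3 / (10 ^ 10 * L ^ 5) * (X * X' * s) * (X * t) * Fintype.card ι
        ≤ lam ^ 3 / (36 * 12441600 * 5 * 2 * L ^ 5) * (X * X' * s) * (X * t) * Fintype.card ι := by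
          gcongr
          norm_num
      _ = (lam / (6 * L)) ^ 2 * (X * X' * s) * (X * t) / (12441600 * s * t * (5 * L)) *
          (lam * s * t / (2 * L ^ 2) * Fintype.card ι) := by field_simp; norm_num
      _ ≤ _ := by gcongr
  · -- all intersecting boxes are nearly parallel
    left
    have hMX : 2 * (2 ^ l.1 * t) ≤ X * t := by
      have : (2 : ℝ) ^ (l.1 + 1) ≤ X := pow_le_pow_right₀ (by norm_num) hl
      rw [pow_succ] at this
      nlinarith
    -- Heights differ by at most `2`, so a small thickness and a small spread confine the whole of
    -- box `j`, not only the part near the common point.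
    have hcont : ∀ i j, cls i j = (k, l) → (G i ∩ Y' j).Nonempty →
        (P j).box s t ⊆ (P i).box (9 * (X * X' * s)) (5 * (X * t)) := by
      intro i j hij ⟨x, hxi, hxj⟩ y hy
      obtain ⟨r1, r2, r3, r4⟩ := hrelc i j hij
      have hxi' := hYb i (hY'Y i (hGY i hxi))
      have hxj' := hYb j (hY'Y j hxj)
      have hxy : |y 2 - x 2| ≤ 2 := by
        have h1 := abs_le.1 hy.2.2
        have h2 := abs_le.1 hxi'.2.2
        rw [abs_le]; constructor <;> linarith
      refine ⟨(abs_f₀_le_of_mem_of_mem hs ht hxi' hxj' hy hxy).trans ?_, ?_, hy.2.2⟩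
      · have w0 : 0 < (P i).thickness (P j) s t := hs.trans_le le_thickness
        have w1 : (P i).thickness (P j) s t ≤ X' * s := r2.trans hwX
        have e1 : 2 * (P i).thickness (P j) s t * (P i).spread (P j) t * 2 / t ≤
            2 * (X' * s) * (X * t) * 2 / t := by
          have : 0 ≤ (P i).spread (P j) t := ht.le.trans le_spread
          have := r4.trans hMX
          gcongr
        have e2 : 2 * (X' * s) * (X * t) * 2 / t = 4 * (X * X' * s) := by field_simp; norm_num
        rw [e2] at e1
        have e3 : X' * s ≤ X * X' * s := by nlinarith [mul_pos (by positivity : 0 < X') hs]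
        nlinarith
      · have h1 := abs_f₁_sub_le_of_mem_of_mem hxi' hxj' hy
        have h2 : |((P j).v - (P i).v) * (y 2 - x 2)| ≤ X * t * 2 := by
          rw [abs_mul]
          refine mul_le_mul ((le_max_right _ _).trans (r4.trans hMX)) hxy (abs_nonneg _) (by positivity)
        have h3 : 3 * t ≤ 3 * (X * t) := by nlinarith
        rw [abs_le] at *
        constructor <;> linarith
    have hcs := sq_sum_measureReal_le (μ := volume) G Y' (fun i j => cls i j = (k, l))
      (n := (L : ℝ) ^ 2) hGm hY'm hGf (by
        intro i x hx
        refine (Finset.sum_le_sum fun j _ => ?_).trans (hGdom i x hx)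
        exact indicator_le_indicator_of_subset (hGY j) (fun _ => zero_le_one) x)
    set a := X * X' * s with ha
    set b := X * t with hb
    have hpair : ∑ i, ∑ j, (if cls i j = (k, l) then volume.real (G i ∩ Y' j) else 0) ≤
        Fintype.card ι * (K * a * b * Fintype.card ι * (8 * s * t)) := by
      rw [← nsmul_eq_mul, ← Finset.card_univ]
      refine Finset.sum_le_card_nsmul _ _ _ fun i _ => ?_
      have h1 : ∀ j, (if cls i j = (k, l) then volume.real (G i ∩ Y' j) else 0) ≤
          if (P j).box s t ⊆ (P i).box (9 * a) (5 * b) then 8 * s * t else 0 := by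
        intro j
        by_cases hij : cls i j = (k, l)
        · rw [if_pos hij]
          rcases (G i ∩ Y' j).eq_empty_or_nonempty with he | hne
          · rw [he, measureReal_empty]
            split_ifs <;> positivity
          · rw [if_pos (hcont i j hij hne)]
            exact (measureReal_mono (inter_subset_right.trans ((hY'Y j).trans (hYb j)))
              (hboxf j)).trans (measureReal_box_le hs.le ht.le)
        · rw [if_neg hij]
          split_ifs <;> positivity
      refine (Finset.sum_le_sum fun j _ => h1 j).trans ?_
      rw [← Finset.sum_filter, Finset.sum_const, nsmul_eq_mul, Finset.card_univ]
      refine mul_le_mul_of_nonneg_right ?_ (by positivity)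
      refine le_trans (le_of_eq ?_) (hCW i)
      rw [← Set.ncard_coe_finset]
      simp
    -- Each `i` has at most `K a b N` partners of overlap at most `8 s t`. As `a b = X² X' s t`, the
    -- dimensions of the boxes and `N` cancel.
    have hU : lam ^ 2 / (1440 * K * L ^ 6 * X ^ 2 * X') ≤ volume.real (⋃ i, G i) := by
      have h1 : (lam * s * t / (2 * L ^ 2) * Fintype.card ι) ^ 2 ≤ volume.real (⋃ i, G i) *
          ((L : ℝ) ^ 2 * (Fintype.card ι * (K * a * b * Fintype.card ι * (8 * s * t)))) := by
        refine (pow_le_pow_left₀ (by positivity) hGmass 2).trans (hcs.trans ?_)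
        exact mul_le_mul_of_nonneg_left (mul_le_mul_of_nonneg_left hpair (by positivity))
          measureReal_nonneg
      have e : (lam * s * t / (2 * L ^ 2) * Fintype.card ι) ^ 2 =
          lam ^ 2 / (32 * K * L ^ 6 * X ^ 2 * X') *
          ((L : ℝ) ^ 2 * (Fintype.card ι * (K * a * b * Fintype.card ι * (8 * s * t)))) := by
        rw [ha, hb]; field_simp; norm_num
      rw [e] at h1
      refine le_trans ?_ (le_of_mul_le_mul_right h1 (by positivity))
      gcongr
      norm_num
    obtain ⟨x, hx⟩ := exists_ball_one_of_subset (U := ⋃ i, G i) (MeasurableSet.iUnion hGm)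
      (hGU.trans hF) (d := lam ^ 2 / (10 ^ 10 * K * L ^ 6 * X ^ 2 * X')) (by positivity) (by
        refine lt_of_lt_of_le ?_ hU
        have e : 10 ^ 6 * (lam ^ 2 / (10 ^ 10 * K * L ^ 6 * X ^ 2 * X')) =
            (lam ^ 2 / (K * L ^ 6 * X ^ 2 * X')) * (1 / 10 ^ 4) := by field_simp
        have e2 : lam ^ 2 / (1440 * K * L ^ 6 * X ^ 2 * X') =
            (lam ^ 2 / (K * L ^ 6 * X ^ 2 * X')) * (1 / 1440) := by field_simp
        rw [e, e2]
        exact mul_lt_mul_of_pos_left (by norm_num) (by positivity))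
    exact ⟨x, hx.trans (measureReal_mono (inter_subset_inter_right _ hGU)
      (measure_ne_top_of_subset inter_subset_left measure_ball_lt_top.ne))⟩

end ShearParam

/-! ### Iteration over scales. -/

theorem cthickening_subset_closedBall {E : Set (EuclideanSpace ℝ (Fin 3))}
    (hE : E ⊆ Metric.closedBall 0 1) {s : ℝ} (hs : s ≤ 20) :
    Metric.cthickening s E ⊆ Metric.closedBall 0 41 := by
  intro x hx
  have h1 := Metric.cthickening_subset_thickening' (δ₁ := s) (δ₂ := 40) (by norm_num)
    (lt_of_le_of_lt hs (by norm_num)) E hx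
  obtain ⟨z, hz, hxz⟩ := Metric.mem_thickening_iff.1 h1
  have h2 := hE hz
  rw [Metric.mem_closedBall] at h2 ⊢
  have := dist_triangle x z 0
  linarith

namespace ShearParam

theorem box_mono (P : ShearParam) {s t s' t' : ℝ} (hs : s ≤ s') (ht : t ≤ t') :
    P.box s t ⊆ P.box s' t' := fun _ hx => ⟨hx.1.trans hs, hx.2.1.trans ht, hx.2.2⟩

/-- The trichotomy in iterable form, with the `s`-thickening of a fixed `E` as shading. The Wolff
bound is needed only for the initial boxes, because larger boxes contain them; `45 = 9 * 5` comes
from the enlargement factors. The factor `10` absorbs both dilations and the sum of successive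
thickenings. -/
theorem dense_ball_or_next_scale {ι : Type*} [Fintype ι] [Nonempty ι] (P : ι → ShearParam)
    (hPp : ∀ i, |(P i).p| ≤ 1) (hPq : ∀ i, |(P i).q| ≤ 1) (hPv : ∀ i, |(P i).v| ≤ 1)
    {E : Set (EuclideanSpace ℝ (Fin 3))} (hE : E ⊆ Metric.closedBall 0 1)
    {s₀ t₀ s t lam K : ℝ} {k₀ l₀ L : ℕ} (hs₀ : 0 < s₀) (ht₀ : 0 < t₀) (hk₀ : 1 ≤ k₀) (hl₀ : 2 ≤ l₀)
    (hL : 40 < 2 ^ L * s₀) (hK : 0 < K)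
    (hCW : ∀ i, ∀ A B : ℝ, 0 < A → 0 < B →
      ({j | (P j).box s₀ t₀ ⊆ (P i).box A B}.ncard : ℝ) ≤ K * A * B * Fintype.card ι)
    (hs : s₀ ≤ s) (ht : t₀ ≤ t) (ht20 : t ≤ 20) (hst : 2 ^ k₀ * s ≤ t) (hlam : 0 < lam)
    (hmass : lam * s * t * Fintype.card ι ≤
      ∑ i, volume.real ((P i).box s t ∩ Metric.cthickening s E)) :
    (∃ x, lam ^ 2 / (10 ^ 10 * (45 * K) * L ^ 6 * (2 ^ l₀) ^ 2 * 2 ^ k₀) *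
        volume.real (Metric.ball (0 : EuclideanSpace ℝ (Fin 3)) 1) ≤
        volume.real (Metric.ball x 1 ∩ Metric.cthickening s E)) ∨
    (∃ x, lam ^ 2 / (10 ^ 20 * L ^ 6) *
        volume.real (Metric.ball (0 : EuclideanSpace ℝ (Fin 3)) (2 ^ k₀ * s / 50)) ≤
        volume.real (Metric.ball x (2 ^ k₀ * s / 50) ∩ Metric.cthickening s E)) ∨
    (10 * 2 ^ l₀ * t ≤ 20 ∧ lam ^ 3 / (10 ^ 12 * L ^ 5) * (10 * 2 ^ l₀ * 2 ^ k₀ * s) *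
        (10 * 2 ^ l₀ * t) * Fintype.card ι ≤
      ∑ i, volume.real ((P i).box (10 * 2 ^ l₀ * 2 ^ k₀ * s) (10 * 2 ^ l₀ * t) ∩
        Metric.cthickening (10 * 2 ^ l₀ * 2 ^ k₀ * s) E)) := by
  have hs' : 0 < s := hs₀.trans_le hs
  have ht' : 0 < t := ht₀.trans_le ht
  have hk1 : (1 : ℝ) ≤ 2 ^ k₀ := one_le_pow₀ (by norm_num)
  have hl1 : (1 : ℝ) ≤ 2 ^ l₀ := one_le_pow₀ (by norm_num)
  have hs20 : s ≤ 20 := by nlinarith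
  rcases dense_ball_or_enlarge P hPp hPq hPv (K := 45 * K) hs' ht20 hk₀ hl₀ hst
    (hL.trans_le (by gcongr)) hlam (by positivity)
    (Metric.isClosed_cthickening (δ := s) (E := E)).measurableSet
    (cthickening_subset_closedBall hE hs20) hmass (fun i => by
      have h1 := hCW i (9 * (2 ^ l₀ * 2 ^ k₀ * s)) (5 * (2 ^ l₀ * t)) (by positivity) (by positivity)
      have h2 : ({j | (P j).box s t ⊆ (P i).box (9 * (2 ^ l₀ * 2 ^ k₀ * s)) (5 * (2 ^ l₀ * t))}.ncard
          : ℝ) ≤ ({j | (P j).box s₀ t₀ ⊆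
            (P i).box (9 * (2 ^ l₀ * 2 ^ k₀ * s)) (5 * (2 ^ l₀ * t))}.ncard : ℝ) := by
        exact_mod_cast Set.ncard_le_ncard (fun j hj => (box_mono _ hs ht).trans hj) (Set.toFinite _)
      refine (h2.trans h1).trans_eq (by ring)) with h | h | ⟨h1, h2⟩
  · exact Or.inl h
  · exact Or.inr (Or.inl h)
  · refine Or.inr (Or.inr ⟨by linarith, ?_⟩)
    have e : lam ^ 3 / (10 ^ 12 * L ^ 5) * (10 * 2 ^ l₀ * 2 ^ k₀ * s) * (10 * 2 ^ l₀ * t) *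
        Fintype.card ι = lam ^ 3 / (10 ^ 10 * L ^ 5) * (2 ^ l₀ * 2 ^ k₀ * s) * (2 ^ l₀ * t) *
        Fintype.card ι := by
      rw [show (10 : ℝ) ^ 12 * L ^ 5 = 100 * (10 ^ 10 * L ^ 5) by ring, ← div_div,
        div_right_comm]
      ring
    rw [e]
    refine h2.trans (Finset.sum_le_sum fun i _ => measureReal_mono (inter_subset_inter ?_ ?_) ?_)
    · exact box_mono _ (by apply le_of_eq; ring) (by nlinarith)
    · have h3 : 2 ^ l₀ * 2 ^ k₀ * s + s ≤ 10 * 2 ^ l₀ * 2 ^ k₀ * s := by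
        have : 1 ≤ (2 : ℝ) ^ l₀ * 2 ^ k₀ := one_le_mul_of_one_le_of_one_le hl1 hk1
        nlinarith
      exact (Metric.cthickening_cthickening_subset (by positivity) hs'.le E).trans
        (Metric.cthickening_mono h3 E)
    · exact measure_ne_top_of_subset inter_subset_left
        (volume_box_ne_top (by positivity) (by positivity))

/-- Iterating `dense_ball_or_next_scale` until the boxes would exceed unit size. -/
theorem exists_dense_ball {ι : Type*} [Fintype ι] [Nonempty ι] (P : ι → ShearParam)
    (hPp : ∀ i, |(P i).p| ≤ 1) (hPq : ∀ i, |(P i).q| ≤ 1) (hPv : ∀ i, |(P i).v| ≤ 1)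
    {E : Set (EuclideanSpace ℝ (Fin 3))} (hE : E ⊆ Metric.closedBall 0 1)
    {s₀ t₀ mu K : ℝ} {k₀ l₀ L n : ℕ} (hs₀ : 0 < s₀) (ht₀ : 0 < t₀) (hk₀ : 1 ≤ k₀) (hl₀ : 2 ≤ l₀)
    (hL : 40 < 2 ^ L * s₀) (hK : 0 < K)
    (hCW : ∀ i, ∀ A B : ℝ, 0 < A → 0 < B →
      ({j | (P j).box s₀ t₀ ⊆ (P i).box A B}.ncard : ℝ) ≤ K * A * B * Fintype.card ι)
    (ht20 : t₀ ≤ 20) (hmu : 0 < mu) (hmu1 : mu ≤ 1) (hLmu : mu * (10 ^ 12 * L ^ 5) ≤ 1)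
    (hmass : mu * s₀ * t₀ * Fintype.card ι ≤
      ∑ i, volume.real ((P i).box s₀ t₀ ∩ Metric.cthickening s₀ E))
    (hn : (2 ^ k₀) ^ n * s₀ ≤ t₀) (hn20 : 20 < (10 * 2 ^ l₀) ^ n * t₀) :
    ∃ s, s₀ ≤ s ∧ s * t₀ ≤ 20 * (2 ^ k₀) ^ n * s₀ ∧ 2 ^ k₀ * s ≤ 20 ∧
      ((∃ x, (mu ^ 4 ^ n) ^ 4 / (K * (2 ^ l₀) ^ 2 * 2 ^ k₀) *
        volume.real (Metric.ball (0 : EuclideanSpace ℝ (Fin 3)) 1) ≤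
        volume.real (Metric.ball x 1 ∩ Metric.cthickening s E)) ∨
      (∃ x, (mu ^ 4 ^ n) ^ 4 *
        volume.real (Metric.ball (0 : EuclideanSpace ℝ (Fin 3)) (2 ^ k₀ * s / 50)) ≤
        volume.real (Metric.ball x (2 ^ k₀ * s / 50) ∩ Metric.cthickening s E))) := by
  by_contra hcon
  have hk1 : (1 : ℝ) ≤ 2 ^ k₀ := one_le_pow₀ (by norm_num)
  have hl1 : (1 : ℝ) ≤ 10 * 2 ^ l₀ := by
    have : (1 : ℝ) ≤ 2 ^ l₀ := one_le_pow₀ (by norm_num)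
    linarith
  have hL1 : (1 : ℝ) ≤ L := by
    rcases Nat.eq_zero_or_pos L with h | h
    · subst h
      have : (2 ^ k₀) ^ n * s₀ ≥ 1 * s₀ := by gcongr; exact one_le_pow₀ hk1
      norm_num at hL
      linarith
    · exact_mod_cast h
  have hL6 : mu ^ 2 * (10 ^ 24 * L ^ 6) ≤ 1 := by
    have h1 : (mu * (10 ^ 12 * L ^ 5)) ^ 2 ≤ 1 := pow_le_one₀ (by positivity) hLmu
    have h2 : (L : ℝ) ^ 6 ≤ L ^ 10 := pow_le_pow_right₀ hL1 (by norm_num)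
    calc mu ^ 2 * (10 ^ 24 * (L : ℝ) ^ 6) ≤ mu ^ 2 * (10 ^ 24 * L ^ 10) := by gcongr
      _ = (mu * (10 ^ 12 * L ^ 5)) ^ 2 := by ring
      _ ≤ 1 := h1
  -- As long as no dense ball appears, the boxes keep growing. The density exponent is multiplied by
  -- `4`: the cube lost in one step and one more factor to absorb `10 ^ 12 * L ^ 5`. At `m = n` the
  -- width bound contradicts `hn20`.
  have key : ∀ m ≤ n, (10 * 2 ^ l₀) ^ m * t₀ ≤ 20 ∧
      mu ^ 4 ^ m * ((10 * 2 ^ l₀ * 2 ^ k₀) ^ m * s₀) * ((10 * 2 ^ l₀) ^ m * t₀) * Fintype.card ι ≤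
        ∑ i, volume.real ((P i).box ((10 * 2 ^ l₀ * 2 ^ k₀) ^ m * s₀) ((10 * 2 ^ l₀) ^ m * t₀) ∩
          Metric.cthickening ((10 * 2 ^ l₀ * 2 ^ k₀) ^ m * s₀) E) := by
    intro m
    induction m with
    | zero => intro _; simpa using ⟨ht20, hmass⟩
    | succ m ih =>
      intro hm
      obtain ⟨h1, h2⟩ := ih (by omega)
      set s := (10 * 2 ^ l₀ * 2 ^ k₀) ^ m * s₀ with hs
      set t := (10 * 2 ^ l₀) ^ m * t₀ with ht
      have hss : s₀ ≤ s := le_mul_of_one_le_left hs₀.le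
        (one_le_pow₀ (one_le_mul_of_one_le_of_one_le hl1 hk1))
      have htt : t₀ ≤ t := le_mul_of_one_le_left ht₀.le (one_le_pow₀ hl1)
      -- Each step loses `2 ^ k₀` in eccentricity, so the `n` factors reserved in `hn` suffice.
      have hst : 2 ^ k₀ * s ≤ t := by
        calc 2 ^ k₀ * s = (10 * 2 ^ l₀) ^ m * ((2 ^ k₀) ^ (m + 1) * s₀) := by rw [hs, mul_pow]; ring
          _ ≤ (10 * 2 ^ l₀) ^ m * ((2 ^ k₀) ^ n * s₀) := by gcongr
          _ ≤ t := by rw [ht]; gcongr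
      have hsb : s * t₀ ≤ 20 * (2 ^ k₀) ^ n * s₀ := by
        calc s * t₀ = t * ((2 ^ k₀) ^ m * s₀) := by rw [hs, ht, mul_pow]; ring
          _ ≤ 20 * ((2 ^ k₀) ^ n * s₀) := by
            gcongr
            omega
          _ = _ := by ring
      have hpow : mu ^ 4 ^ n ≤ mu ^ 4 ^ m :=
        pow_le_pow_of_le_one hmu.le hmu1 (Nat.pow_le_pow_right (by norm_num) (by omega))
      have hpow1 : mu ^ 4 ^ n ≤ mu := by
        simpa using pow_le_pow_of_le_one hmu.le hmu1 (Nat.one_le_pow n 4 (by norm_num))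
      rcases dense_ball_or_next_scale P hPp hPq hPv hE hs₀ ht₀ hk₀ hl₀ hL hK hCW hss htt h1 hst
        (pow_pos hmu _) h2 with ⟨x, hx⟩ | ⟨x, hx⟩ | ⟨h3, h4⟩
      · refine absurd ⟨s, hss, hsb, hst.trans h1, Or.inl ⟨x, le_trans ?_ hx⟩⟩ hcon
        refine mul_le_mul_of_nonneg_right ?_ measureReal_nonneg
        rw [div_le_div_iff₀ (by positivity) (by positivity)]
        calc (mu ^ 4 ^ n) ^ 4 * (10 ^ 10 * (45 * K) * L ^ 6 * (2 ^ l₀) ^ 2 * 2 ^ k₀)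
            = (mu ^ 4 ^ n) ^ 2 * ((mu ^ 4 ^ n) ^ 2 * (45 * 10 ^ 10 * L ^ 6)) *
              (K * (2 ^ l₀) ^ 2 * 2 ^ k₀) := by ring
          _ ≤ (mu ^ 4 ^ m) ^ 2 * 1 * (K * (2 ^ l₀) ^ 2 * 2 ^ k₀) := by
            gcongr
            refine le_trans ?_ hL6
            gcongr
            norm_num
          _ = _ := by ring
      · refine absurd ⟨s, hss, hsb, hst.trans h1, Or.inr ⟨x, le_trans ?_ hx⟩⟩ hcon
        refine mul_le_mul_of_nonneg_right ?_ measureReal_nonneg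
        rw [le_div_iff₀ (by positivity)]
        calc (mu ^ 4 ^ n) ^ 4 * (10 ^ 20 * L ^ 6)
            = (mu ^ 4 ^ n) ^ 2 * ((mu ^ 4 ^ n) ^ 2 * (10 ^ 20 * L ^ 6)) := by ring
          _ ≤ (mu ^ 4 ^ m) ^ 2 * 1 := by
            gcongr
            refine le_trans ?_ hL6
            gcongr
            · norm_num
            · norm_num
          _ = _ := by ring
      · have es : (10 * 2 ^ l₀ * 2 ^ k₀) ^ (m + 1) * s₀ = 10 * 2 ^ l₀ * 2 ^ k₀ * s := by
          rw [hs, pow_succ]; ring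
        have et : (10 * 2 ^ l₀) ^ (m + 1) * t₀ = 10 * 2 ^ l₀ * t := by rw [ht, pow_succ]; ring
        rw [es, et]
        refine ⟨h3, le_trans ?_ h4⟩
        have hs' : 0 < s := hs₀.trans_le hss
        have ht' : 0 < t := ht₀.trans_le htt
        refine mul_le_mul_of_nonneg_right (mul_le_mul_of_nonneg_right
          (mul_le_mul_of_nonneg_right ?_ (by positivity)) (by positivity)) (by positivity)
        rw [le_div_iff₀ (by positivity)]
        calc mu ^ 4 ^ (m + 1) * (10 ^ 12 * L ^ 5)
            = (mu ^ 4 ^ m) ^ 3 * (mu ^ 4 ^ m * (10 ^ 12 * L ^ 5)) := by rw [pow_succ 4 m, pow_mul]; ring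
          _ ≤ (mu ^ 4 ^ m) ^ 3 * 1 := by
            gcongr
            refine le_trans ?_ hLmu
            gcongr
            simpa using pow_le_pow_of_le_one hmu.le hmu1 (Nat.one_le_pow m 4 (by norm_num))
          _ = _ := by ring
  exact absurd (key n le_rfl).1 (not_le.2 hn20)

end ShearParam

/-! ### Choice of exponents. -/

theorem exists_forall_mul_rpow_le_one {C c : ℝ} (hC : 0 < C) (hc : 0 < c) :
    ∃ δ₀ > (0 : ℝ), ∀ δ : ℝ, 0 < δ → δ ≤ δ₀ → C * δ ^ c ≤ 1 := by
  refine ⟨C⁻¹ ^ c⁻¹, by positivity, fun δ h0 h1 => ?_⟩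
  have h2 : δ ^ c ≤ C⁻¹ := by
    calc δ ^ c ≤ (C⁻¹ ^ c⁻¹) ^ c := Real.rpow_le_rpow h0.le h1 hc.le
      _ = C⁻¹ := Real.rpow_inv_rpow (by positivity) hc.ne'
  calc C * δ ^ c ≤ C * C⁻¹ := by gcongr
    _ = 1 := mul_inv_cancel₀ hC.ne'

theorem exists_pow_two_near_rpow_neg {δ c : ℝ} (h0 : 0 < δ) (h1 : δ ≤ 1) (hc : 0 ≤ c) :
    ∃ l : ℕ, δ ^ (-c) ≤ 2 ^ l ∧ 2 ^ l ≤ 2 * δ ^ (-c) := by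
  obtain ⟨n, h2, h3⟩ := exists_nat_pow_near (x := δ ^ (-c)) (y := (2 : ℝ))
    (Real.one_le_rpow_of_pos_of_le_one_of_nonpos h0 h1 (by linarith)) (by norm_num)
  exact ⟨n + 1, h3.le, by rw [pow_succ]; linarith⟩

/-- The number of levels `L` grows like `log (1 / δ)`, so any positive power of `δ` beats `L ^ 5`.
-/
theorem exists_log_scale {a : ℝ} (ha : 0 < a) :
    ∃ δ₀ > (0 : ℝ), ∀ δ : ℝ, 0 < δ → δ ≤ δ₀ →
      ∃ L : ℕ, 40 < 2 ^ L * δ ∧ δ ^ a * (10 ^ 12 * L ^ 5) ≤ 1 := by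
  set b := a / 10 with hb
  set C : ℝ := 2 * 41 ^ b / b + 1 with hC
  obtain ⟨δ₁, h1, h1'⟩ := exists_forall_mul_rpow_le_one (C := 10 ^ 12 * C ^ 5) (c := a / 2)
    (by positivity) (by positivity)
  refine ⟨min δ₁ 1, by positivity, fun δ h0 hδ => ?_⟩
  have hδ1 : δ ≤ 1 := hδ.trans (min_le_right _ _)
  have hx : 1 ≤ 41 / δ := by rw [le_div_iff₀ h0]; linarith
  obtain ⟨n, h2, h3⟩ := exists_nat_pow_near (y := (2 : ℝ)) hx (by norm_num)
  refine ⟨n + 1, ?_, ?_⟩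
  · rw [div_lt_iff₀ h0] at h3; linarith
  have hn : (n : ℝ) ≤ 2 * Real.log (41 / δ) := by
    have h4 := Real.log_le_log (by positivity) h2
    rw [Real.log_pow] at h4
    nlinarith [Real.log_two_gt_d9, (Nat.cast_nonneg n : (0 : ℝ) ≤ n)]
  have hlog := Real.log_le_rpow_div (x := 41 / δ) (ε := b) (by positivity) (by positivity)
  rw [Real.div_rpow (by norm_num) h0.le] at hlog
  have hδb : 0 < δ ^ b := by positivity
  have hδb1 : δ ^ b ≤ 1 := Real.rpow_le_one h0.le hδ1 (by positivity)
  have hLb : ((n + 1 : ℕ) : ℝ) * δ ^ b ≤ C := by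
    push_cast
    calc ((n : ℝ) + 1) * δ ^ b ≤ (2 * (41 ^ b / δ ^ b / b) + 1) * δ ^ b := by gcongr; linarith
      _ = 2 * 41 ^ b / b + δ ^ b := by field_simp
      _ ≤ C := by rw [hC]; linarith
  have e : δ ^ a = (δ ^ b) ^ 5 * δ ^ (a / 2) := by
    rw [← Real.rpow_natCast, ← Real.rpow_mul h0.le, ← Real.rpow_add h0]
    congr 1; rw [hb]; push_cast; ring
  calc δ ^ a * (10 ^ 12 * ((n + 1 : ℕ) : ℝ) ^ 5)
      = 10 ^ 12 * (((n + 1 : ℕ) : ℝ) * δ ^ b) ^ 5 * δ ^ (a / 2) := by rw [e]; ring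
    _ ≤ 10 ^ 12 * C ^ 5 * δ ^ (a / 2) := by gcongr
    _ ≤ 1 := h1' δ h0 (hδ.trans (min_le_left _ _))

/-- The witness is `ρ = 2 s`, since the open `2 s`-neighborhood contains the closed `s`-thickening.
-/
theorem discretizedAssouadDimAtLeast_of_dense_ball {E : Set (EuclideanSpace ℝ (Fin 3))}
    {δ ε A s r d : ℝ} (hs : 0 < s) (hδs : δ ≤ s) (hA : 1 ≤ A) (hsep : A * (2 * s) ≤ r) (hr1 : r ≤ 1)
    (hd : (2 * s / r) ^ ε ≤ d) {x : EuclideanSpace ℝ (Fin 3)}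
    (h : d * volume.real (Metric.ball (0 : EuclideanSpace ℝ (Fin 3)) r) ≤
      volume.real (Metric.ball x r ∩ Metric.cthickening s E)) :
    DiscretizedAssouadDimAtLeast E (3 - ε) δ A := by
  have hr : 2 * s ≤ r := by nlinarith
  refine ⟨2 * s, r, by linarith, hr, hr1, hsep, x, ?_⟩
  have hr0 : 0 < r := by linarith
  have hd0 : 0 ≤ d := le_trans (by positivity) hd
  have e : ((3 : ℕ) : ℝ) - (3 - ε) = ε := by push_cast; ring
  rw [e, Measure.addHaar_ball_center]
  have hf : volume (Metric.ball x r ∩ Metric.cthickening s E) ≠ ∞ :=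
    measure_ne_top_of_subset inter_subset_left measure_ball_lt_top.ne
  calc ENNReal.ofReal ((2 * s / r) ^ ε) * volume (Metric.ball (0 : EuclideanSpace ℝ (Fin 3)) r)
      ≤ ENNReal.ofReal d * volume (Metric.ball (0 : EuclideanSpace ℝ (Fin 3)) r) := by gcongr
    _ = ENNReal.ofReal (d * volume.real (Metric.ball (0 : EuclideanSpace ℝ (Fin 3)) r)) := by
      rw [ENNReal.ofReal_mul hd0, measureReal_def, ENNReal.ofReal_toReal measure_ball_lt_top.ne]
    _ ≤ ENNReal.ofReal (volume.real (Metric.ball x r ∩ Metric.cthickening s E)) :=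
      ENNReal.ofReal_le_ofReal h
    _ = volume (Metric.ball x r ∩ Metric.cthickening s E) := by
      rw [measureReal_def, ENNReal.ofReal_toReal hf]
    _ ≤ _ := by
      gcongr
      exact Metric.cthickening_subset_thickening' (by linarith) (by linarith) E

set_option maxHeartbeats 1000000 in
theorem discretizedAssouadDimAtLeast_of_boxes {ε : ℝ} (hε : 0 < ε) (hε1 : ε ≤ 1) :
    ∃ η > (0 : ℝ), ∃ δ₀ > (0 : ℝ), ∀ δ : ℝ, 0 < δ → δ ≤ δ₀ →
      ∀ s t : ℝ, δ ≤ s → δ ≤ t → t ≤ 20 → s ≤ δ ^ ε * t →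
        ∀ (ι : Type) [Fintype ι] [Nonempty ι] (P : ι → ShearParam)
          (E : Set (EuclideanSpace ℝ (Fin 3))),
          (∀ i, |(P i).p| ≤ 1) → (∀ i, |(P i).q| ≤ 1) → (∀ i, |(P i).v| ≤ 1) →
          E ⊆ Metric.closedBall 0 1 →
          (∀ i, ∀ A B : ℝ, 0 < A → 0 < B →
            ({j | (P j).box s t ⊆ (P i).box A B}.ncard : ℝ) ≤
              48 * δ ^ (-(2 * η)) * A * B * Fintype.card ι) →
          δ ^ η / 36 * s * t * Fintype.card ι ≤
            ∑ i, volume.real ((P i).box s t ∩ Metric.cthickening s E) →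
          DiscretizedAssouadDimAtLeast E (3 - ε) δ (δ ^ (-η)) := by
  -- `2 ^ l₀` will be about `δ^(-κ)`. In the unit-ball case `2 κ`, `κ'`, `η'` and `κ' ε / 2` must
  -- together fit into `ε² / 4`, half of the available exponent; the other half absorbs the constant
  -- `384`.
  obtain ⟨κ, hκ⟩ : ∃ x, x = ε ^ 2 / 16 := ⟨_, rfl⟩
  obtain ⟨n, hn⟩ : ∃ x, x = ⌈1 / κ⌉₊ := ⟨_, rfl⟩
  have hκ0 : 0 < κ := by rw [hκ]; positivity
  have hnκ : 1 ≤ κ * n := by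
    have := Nat.le_ceil (1 / κ)
    rw [← hn, div_le_iff₀ hκ0] at this
    linarith
  have hn2 : 2 ≤ n := by
    have h1 : (2 : ℝ) ≤ n := by
      have : κ ≤ 1 / 16 := by rw [hκ]; nlinarith
      nlinarith
    exact_mod_cast h1
  have hn0 : (0 : ℝ) < n := by exact_mod_cast (by omega : 0 < n)
  -- `2 ^ k₀` will be about `δ^(-κ')`, so `n` losses of eccentricity cost about `δ^(-ε/4)`.
  obtain ⟨κ', hκ'⟩ : ∃ x, x = ε / (4 * n) := ⟨_, rfl⟩
  have hκ'0 : 0 < κ' := by rw [hκ']; positivity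
  have hκ'n : κ' * n = ε / 4 := by rw [hκ']; field_simp
  have hκ'le : κ' ≤ ε ^ 2 / 64 := by
    rw [hκ', div_le_iff₀ (by positivity)]
    have : ε ^ 2 / 64 * (4 * n) = κ * n := by rw [hκ]; ring
    rw [this]; linarith
  -- Makes the final density `(δ^η')^(4^(n+1))` equal to `δ^(κ' ε / 2)`, which is what a ball with
  -- `ρ / r ≤ δ^(κ'/2)` requires.
  obtain ⟨η', hη'⟩ : ∃ x, x = κ' * ε / (2 * 4 ^ (n + 1)) := ⟨_, rfl⟩
  have hη'0 : 0 < η' := by rw [hη']; positivity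
  have hη'n : η' * 4 ^ (n + 1) = κ' * ε / 2 := by rw [hη']; field_simp
  have h16 : (16 : ℝ) ≤ 4 ^ (n + 1) := by
    calc (16 : ℝ) = 4 ^ 2 := by norm_num
      _ ≤ 4 ^ (n + 1) := pow_le_pow_right₀ (by norm_num) (by omega)
  have hη'le : η' ≤ κ' / 32 := by nlinarith
  obtain ⟨d₁, hd₁, H₁⟩ := exists_forall_mul_rpow_le_one (C := 36) (c := η' / 2)
    (by norm_num) (by positivity)
  obtain ⟨d₂, hd₂, H₂⟩ := exists_log_scale hη'0
  obtain ⟨d₃, hd₃, H₃⟩ := exists_forall_mul_rpow_le_one (C := 384) (c := ε ^ 2 / 4)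
    (by norm_num) (by positivity)
  obtain ⟨d₄, hd₄, H₄⟩ := exists_forall_mul_rpow_le_one (C := 40 * 2 ^ n) (c := ε / 4)
    (by positivity) (by positivity)
  obtain ⟨d₅, hd₅, H₅⟩ := exists_forall_mul_rpow_le_one (C := 100) (c := κ' / 2)
    (by norm_num) (by positivity)
  obtain ⟨d₆, hd₆, H₆⟩ := exists_forall_mul_rpow_le_one (C := 3) (c := κ)
    (by norm_num) (by positivity)
  refine ⟨η' / 2, by positivity, min (min (min d₁ d₂) (min d₃ d₄)) (min (min d₅ d₆) 1),
    by positivity, ?_⟩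
  intro δ h0 hδ s t hδs hδt ht20 hst ι _ _ P E hPp hPq hPv hE hCW hmass
  simp only [le_min_iff] at hδ
  obtain ⟨⟨⟨hδ1, hδ2⟩, hδ3, hδ4⟩, ⟨hδ5, hδ6⟩, hδ1'⟩ := hδ
  replace H₁ := H₁ δ h0 hδ1
  replace H₃ := H₃ δ h0 hδ3
  replace H₄ := H₄ δ h0 hδ4
  replace H₅ := H₅ δ h0 hδ5
  replace H₆ := H₆ δ h0 hδ6
  obtain ⟨L, hL, hLmu⟩ := H₂ δ h0 hδ2
  have hadd : ∀ a b : ℝ, δ ^ (a + b) = δ ^ a * δ ^ b := fun a b => Real.rpow_add h0 a b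
  have hpos : ∀ a : ℝ, 0 < δ ^ a := fun a => Real.rpow_pos_of_pos h0 a
  have hinv : ∀ a : ℝ, δ ^ (-a) * δ ^ a = 1 := fun a => by rw [← hadd]; simp
  have hanti : ∀ a b : ℝ, a ≤ b → δ ^ b ≤ δ ^ a := fun a b h =>
    Real.rpow_le_rpow_of_exponent_ge h0 hδ1' h
  have hs0 : 0 < s := h0.trans_le hδs
  have ht0 : 0 < t := h0.trans_le hδt
  obtain ⟨l₀, hX, hX2⟩ := exists_pow_two_near_rpow_neg h0 hδ1' hκ0.le
  obtain ⟨k₀, hX', hX'2⟩ := exists_pow_two_near_rpow_neg h0 hδ1' hκ'0.le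
  have hl₀ : 2 ≤ l₀ := by
    have h1 : (3 : ℝ) ≤ 2 ^ l₀ := by
      refine le_trans ?_ hX
      calc (3 : ℝ) = 3 * δ ^ κ * δ ^ (-κ) := by linear_combination -3 * hinv κ
        _ ≤ 1 * δ ^ (-κ) := mul_le_mul_of_nonneg_right H₆ (hpos _).le
        _ = _ := one_mul _
    by_contra hcon
    have h2 : (2 : ℝ) ^ l₀ ≤ 2 ^ 1 := pow_le_pow_right₀ (by norm_num) (by omega)
    linarith
  have h100 : 100 * δ ^ (-(κ' / 2)) ≤ 2 ^ k₀ := by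
    refine le_trans ?_ hX'
    have e : δ ^ (-κ') = δ ^ (-(κ' / 2)) * δ ^ (-(κ' / 2)) := by rw [← hadd]; congr 1; ring
    rw [e]
    gcongr
    calc (100 : ℝ) = 100 * δ ^ (κ' / 2) * δ ^ (-(κ' / 2)) := by
          linear_combination -100 * hinv (κ' / 2)
      _ ≤ 1 * δ ^ (-(κ' / 2)) := mul_le_mul_of_nonneg_right H₅ (hpos _).le
      _ = _ := one_mul _
  have hk₀ : 1 ≤ k₀ := by
    by_contra hcon
    have h2 : k₀ = 0 := by omega
    have h3 : 1 ≤ δ ^ (-(κ' / 2)) :=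
      Real.one_le_rpow_of_pos_of_le_one_of_nonpos h0 hδ1' (by linarith)
    rw [h2, pow_zero] at h100
    linarith
  have hXn : ((2 : ℝ) ^ k₀) ^ n ≤ 2 ^ n * δ ^ (-(ε / 4)) := by
    calc ((2 : ℝ) ^ k₀) ^ n ≤ (2 * δ ^ (-κ')) ^ n := by gcongr
      _ = 2 ^ n * δ ^ (-(ε / 4)) := by
        rw [mul_pow, ← Real.rpow_natCast (δ ^ (-κ')), ← Real.rpow_mul h0.le, neg_mul, hκ'n]
  -- Keeps the boxes eccentric throughout: together with `hs't` it gives `2 s' ≤ δ^(ε/2)` at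
  -- whatever step the iteration stops.
  have hXns : 40 * ((2 : ℝ) ^ k₀) ^ n * s ≤ δ ^ (ε / 2) * t := by
    calc 40 * ((2 : ℝ) ^ k₀) ^ n * s ≤ 40 * (2 ^ n * δ ^ (-(ε / 4))) * (δ ^ ε * t) := by gcongr
      _ = (40 * 2 ^ n * δ ^ (ε / 4)) * (δ ^ (ε / 2) * t) := by
        have e : δ ^ (-(ε / 4)) * δ ^ ε = δ ^ (ε / 4) * δ ^ (ε / 2) := by
          rw [← hadd, ← hadd]; congr 1; ring
        calc _ = 40 * 2 ^ n * (δ ^ (-(ε / 4)) * δ ^ ε) * t := by ring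
          _ = _ := by rw [e]; ring
      _ ≤ 1 * (δ ^ (ε / 2) * t) := by gcongr
      _ = _ := one_mul _
  have hδε : δ ^ (ε / 2) ≤ 1 := Real.rpow_le_one h0.le hδ1' (by positivity)
  have hXs : ((2 : ℝ) ^ k₀) ^ n * s ≤ t := by
    calc ((2 : ℝ) ^ k₀) ^ n * s ≤ 40 * ((2 : ℝ) ^ k₀) ^ n * s := by
          rw [mul_assoc 40]; exact le_mul_of_one_le_left (by positivity) (by norm_num)
      _ ≤ δ ^ (ε / 2) * t := hXns
      _ ≤ t := mul_le_of_le_one_left ht0.le hδε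
  have h20 : 20 < (10 * (2 : ℝ) ^ l₀) ^ n * t := by
    have h1 : (100 : ℝ) ≤ 10 ^ n := by
      calc (100 : ℝ) = 10 ^ 2 := by norm_num
        _ ≤ 10 ^ n := pow_le_pow_right₀ (by norm_num) hn2
    have h2 : δ ^ (-1 : ℝ) ≤ ((2 : ℝ) ^ l₀) ^ n := by
      calc δ ^ (-1 : ℝ) ≤ δ ^ (-κ * n) := hanti _ _ (by linarith)
        _ = (δ ^ (-κ)) ^ n := by rw [Real.rpow_mul h0.le, Real.rpow_natCast]
        _ ≤ _ := by gcongr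
    calc (20 : ℝ) < 100 * (δ ^ (-1 : ℝ) * δ) := by
          rw [Real.rpow_neg_one, inv_mul_cancel₀ h0.ne']; norm_num
      _ ≤ 10 ^ n * (((2 : ℝ) ^ l₀) ^ n * t) := by gcongr
      _ = _ := by rw [mul_pow]; ring
  have e2 : δ ^ (-(2 * (η' / 2))) = δ ^ (-η') := by congr 1; ring
  rw [e2] at hCW
  obtain ⟨s', hs', hs't, hs'20, hball⟩ := ShearParam.exists_dense_ball P hPp hPq hPv hE
    (mu := δ ^ η') (K := 48 * δ ^ (-η')) (L := L) (n := n) hs0 ht0 hk₀ hl₀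
    (hL.trans_le (by gcongr)) (by positivity) hCW ht20 (hpos _)
    (Real.rpow_le_one h0.le hδ1' hη'0.le) hLmu (by
      refine le_trans ?_ hmass
      gcongr
      have e : δ ^ η' = δ ^ (η' / 2) * δ ^ (η' / 2) := by rw [← hadd]; congr 1; ring
      rw [e, le_div_iff₀ (by norm_num)]
      linarith [mul_le_mul_of_nonneg_left H₁ (hpos (η' / 2)).le]) hXs h20
  have hs'0 : 0 < s' := hs0.trans_le hs'
  have h2s : 2 * s' ≤ δ ^ (ε / 2) := by
    refine le_of_mul_le_mul_right ?_ ht0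
    linarith
  have hmu : ((δ ^ η') ^ 4 ^ n) ^ 4 = δ ^ (κ' * ε / 2) := by
    rw [← pow_mul, ← pow_succ, ← Real.rpow_natCast, ← Real.rpow_mul h0.le, ← hη'n]
    push_cast; rfl
  rw [hmu] at hball
  have hA1 : 1 ≤ δ ^ (-(η' / 2)) :=
    Real.one_le_rpow_of_pos_of_le_one_of_nonpos h0 hδ1' (by linarith)
  rcases hball with ⟨x, hx⟩ | ⟨x, hx⟩
  · refine discretizedAssouadDimAtLeast_of_dense_ball hs'0 (hδs.trans hs') hA1 ?_ le_rfl ?_ hx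
    · calc δ ^ (-(η' / 2)) * (2 * s') ≤ δ ^ (-(η' / 2)) * δ ^ (ε / 2) := by gcongr
        _ ≤ δ ^ (-(η' / 2)) * δ ^ (η' / 2) := by
          refine mul_le_mul_of_nonneg_left (hanti _ _ ?_) (hpos _).le
          nlinarith
        _ = 1 := hinv _
    · rw [div_one, le_div_iff₀ (by positivity)]
      have h1 : (2 * s') ^ ε ≤ δ ^ (ε ^ 2 / 2) := by
        calc (2 * s') ^ ε ≤ (δ ^ (ε / 2)) ^ ε := Real.rpow_le_rpow (by positivity) h2s hε.le
          _ = δ ^ (ε ^ 2 / 2) := by rw [← Real.rpow_mul h0.le]; congr 1; ring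
      calc (2 * s') ^ ε * (48 * δ ^ (-η') * (2 ^ l₀) ^ 2 * 2 ^ k₀)
          ≤ δ ^ (ε ^ 2 / 2) * (48 * δ ^ (-η') * (2 * δ ^ (-κ)) ^ 2 * (2 * δ ^ (-κ'))) := by gcongr
        _ = 384 * (δ ^ (ε ^ 2 / 2) * δ ^ (-η') * δ ^ (-κ) * δ ^ (-κ) * δ ^ (-κ')) := by ring
        _ = 384 * (δ ^ (ε ^ 2 / 4) * δ ^ (ε ^ 2 / 4 - η' - κ - κ - κ')) := by
          rw [← hadd, ← hadd, ← hadd, ← hadd, ← hadd]; congr 2; ring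
        _ = (384 * δ ^ (ε ^ 2 / 4)) * δ ^ (ε ^ 2 / 4 - η' - κ - κ - κ') := by ring
        _ ≤ 1 * δ ^ (κ' * ε / 2) := by
          refine mul_le_mul H₃ (hanti _ _ ?_) (hpos _).le zero_le_one
          have : κ' * ε ≤ κ' := mul_le_of_le_one_right hκ'0.le hε1
          rw [hκ]; linarith
        _ = _ := one_mul _
  · refine discretizedAssouadDimAtLeast_of_dense_ball hs'0 (hδs.trans hs') hA1 ?_ (by linarith)
      ?_ hx
    · have h1 : δ ^ (-(η' / 2)) ≤ δ ^ (-(κ' / 2)) := hanti _ _ (by linarith)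
      have h2 : 100 * δ ^ (-(η' / 2)) ≤ 2 ^ k₀ := by linarith
      linarith [mul_le_mul_of_nonneg_right h2 hs'0.le]
    · have e : 2 * s' / (2 ^ k₀ * s' / 50) = 100 / 2 ^ k₀ := by field_simp; norm_num
      rw [e]
      calc (100 / 2 ^ k₀) ^ ε ≤ (δ ^ (κ' / 2)) ^ ε := by
            refine Real.rpow_le_rpow (by positivity) ?_ hε.le
            rw [div_le_iff₀ (by positivity)]
            calc (100 : ℝ) = δ ^ (κ' / 2) * (100 * δ ^ (-(κ' / 2))) := by
                  linear_combination -100 * hinv (κ' / 2)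
              _ ≤ _ := mul_le_mul_of_nonneg_left h100 (hpos _).le
        _ = δ ^ (κ' * ε / 2) := by rw [← Real.rpow_mul h0.le]; congr 1; ring

/-! ### From prisms to sheared boxes. -/

theorem LinearIsometryEquiv.preimage_thickening_image {V : Type*} [NormedAddCommGroup V]
    [NormedSpace ℝ V] (f : V ≃ₗᵢ[ℝ] V) (ρ : ℝ) (E : Set V) :
    f ⁻¹' Metric.thickening ρ (f '' E) = Metric.thickening ρ E := by
  ext x
  simp [Metric.mem_thickening_iff]

section Isometry

variable {V : Type*} [NormedAddCommGroup V] [InnerProductSpace ℝ V] [MeasurableSpace V]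
  [BorelSpace V] [FiniteDimensional ℝ V] (f : V ≃ₗᵢ[ℝ] V)

theorem LinearIsometryEquiv.volume_preimage (S : Set V) : volume (f ⁻¹' S) = volume S :=
  MeasurePreserving.measure_preimage_equiv (f := f.toMeasurableEquiv) f.measurePreserving S

theorem LinearIsometryEquiv.volume_image (S : Set V) : volume (f '' S) = volume S := by
  rw [← f.volume_preimage, preimage_image_eq _ f.injective]

end Isometry

theorem DiscretizedAssouadDimAtLeast.of_image {n : ℕ}
    (f : EuclideanSpace ℝ (Fin n) ≃ₗᵢ[ℝ] EuclideanSpace ℝ (Fin n))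
    {E : Set (EuclideanSpace ℝ (Fin n))} {β δ A : ℝ}
    (h : DiscretizedAssouadDimAtLeast (f '' E) β δ A) : DiscretizedAssouadDimAtLeast E β δ A := by
  obtain ⟨ρ, r, h1, h2, h3, h4, x, h5⟩ := h
  refine ⟨ρ, r, h1, h2, h3, h4, f.symm x, ?_⟩
  rwa [← f.volume_preimage, ← f.volume_preimage (_ ∩ _), preimage_inter, f.preimage_ball,
    f.preimage_thickening_image] at h5

theorem DiscretizedAssouadDimAtLeast.mono {n : ℕ} {E : Set (EuclideanSpace ℝ (Fin n))}
    {β β' δ A : ℝ} (hδ : 0 < δ) (hβ : β' ≤ β) (h : DiscretizedAssouadDimAtLeast E β δ A) :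
    DiscretizedAssouadDimAtLeast E β' δ A := by
  obtain ⟨ρ, r, h1, h2, h3, h4, x, h5⟩ := h
  refine ⟨ρ, r, h1, h2, h3, h4, x, le_trans ?_ h5⟩
  have hρ : 0 < ρ := hδ.trans_le h1
  have hr : 0 < r := hρ.trans_le h2
  gcongr ENNReal.ofReal ?_ * _
  exact Real.rpow_le_rpow_of_exponent_ge (by positivity) ((div_le_one hr).2 h2) (by linarith)

theorem volume_prism {a b c : ℝ} (ha : 0 ≤ a) (hb : 0 ≤ b) (hc : 0 ≤ c)
    {R : Set (EuclideanSpace ℝ (Fin 3))} (hR : IsPrism a b c R) :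
    volume R = ENNReal.ofReal (a * b * c) := by
  obtain ⟨g, rfl⟩ := hR
  have h1 : g '' {x | |x 0| ≤ a / 2 ∧ |x 1| ≤ b / 2 ∧ |x 2| ≤ c / 2} =
      (fun x => x + -g 0) ⁻¹' (g.linearIsometryEquiv ''
        {x | |x 0| ≤ a / 2 ∧ |x 1| ≤ b / 2 ∧ |x 2| ≤ c / 2}) := by
    ext y
    have h2 : ∀ x, g x + -g 0 = g.linearIsometryEquiv x := fun x => by
      have := g.map_vadd 0 x
      simp only [vadd_eq_add, add_zero] at this
      rw [this]; simp
    constructor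
    · rintro ⟨x, hx, rfl⟩
      exact ⟨x, hx, (h2 x).symm⟩
    · rintro ⟨x, hx, hxy⟩
      refine ⟨x, hx, ?_⟩
      rw [← h2] at hxy
      exact add_right_cancel hxy
  rw [h1, measure_preimage_add_right, LinearIsometryEquiv.volume_image]
  have h3 := volume_parallelepiped 1 (by simp) 0 ![a / 2, b / 2, c / 2] (by
    intro k; fin_cases k <;> simp <;> linarith)
  have h4 : {x : EuclideanSpace ℝ (Fin 3) | |x 0| ≤ a / 2 ∧ |x 1| ≤ b / 2 ∧ |x 2| ≤ c / 2} =
      {x : EuclideanSpace ℝ (Fin 3) | ∀ k, |∑ j, (1 : Matrix (Fin 3) (Fin 3) ℝ) k j * x j -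
        (0 : Fin 3 → ℝ) k| ≤ ![a / 2, b / 2, c / 2] k} := by
    ext x
    simp [Fin.forall_fin_succ, Matrix.one_apply]
  rw [h4, h3]
  congr 1
  simp
  ring

/-- In the application column `0` is the thin normal and column `2` the long direction. The largest
normal entry goes first, to solve for that coordinate, and the larger remaining long entry goes
last, to serve as height. -/
theorem exists_perm_pivot (M : Matrix (Fin 3) (Fin 3) ℝ) : ∃ σ : Equiv.Perm (Fin 3),
    (∀ k, |M k 0| ≤ |M (σ 0) 0|) ∧ |M (σ 1) 2| ≤ |M (σ 2) 2| := by
  obtain ⟨i, hi⟩ := Finite.exists_max fun k => |M k 0|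
  rcases le_total |M (Equiv.swap 0 i 1) 2| |M (Equiv.swap 0 i 2) 2| with h | h
  · exact ⟨Equiv.swap 0 i, by simpa using hi, h⟩
  · refine ⟨(Equiv.swap 1 2).trans (Equiv.swap 0 i), ?_, ?_⟩
    · have : Equiv.swap (1 : Fin 3) 2 0 = 0 := by decide
      simpa [this] using hi
    · simpa using h

/-- Solving the inequalities `|⟨n, z⟩| ≤ s / 2`, `|⟨m, z⟩| ≤ t / 2` for the pivot coordinates
`z₀` and `z₁`, when `(n, m, d)` is an orthonormal frame. -/
theorem exists_shear_of_frame {n₀ n₁ n₂ m₀ m₁ m₂ d₀ d₁ d₂ s t : ℝ} (hs : 0 ≤ s) (hst : s ≤ t)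
    (hnn : n₀ ^ 2 + n₁ ^ 2 + n₂ ^ 2 = 1) (hdd : d₀ ^ 2 + d₁ ^ 2 + d₂ ^ 2 = 1)
    (hnd : n₀ * d₀ + n₁ * d₁ + n₂ * d₂ = 0)
    (h00 : n₀ ^ 2 + m₀ ^ 2 + d₀ ^ 2 = 1) (h11 : n₁ ^ 2 + m₁ ^ 2 + d₁ ^ 2 = 1)
    (h22 : n₂ ^ 2 + m₂ ^ 2 + d₂ ^ 2 = 1) (h01 : n₀ * n₁ + m₀ * m₁ + d₀ * d₁ = 0)
    (h02 : n₀ * n₂ + m₀ * m₂ + d₀ * d₂ = 0)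
    (hn1 : |n₁| ≤ |n₀|) (hn2 : |n₂| ≤ |n₀|) (hd : |d₁| ≤ |d₂|) :
    ∃ p q v : ℝ, |p| ≤ 1 ∧ |q| ≤ 1 ∧ |v| ≤ 1 ∧ ∀ z₀ z₁ z₂ : ℝ,
      |n₀ * z₀ + n₁ * z₁ + n₂ * z₂| ≤ s / 2 → |m₀ * z₀ + m₁ * z₁ + m₂ * z₂| ≤ t / 2 →
      |z₀ - p * z₁ - q * z₂| ≤ s ∧ |z₁ - v * z₂| ≤ 6 * t := by
  have ht : 0 ≤ t := hs.trans hst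
  have hn1' := sq_le_sq.2 hn1
  have hn2' := sq_le_sq.2 hn2
  have hd' := sq_le_sq.2 hd
  have hn0 : 1 / 2 ≤ |n₀| := by
    refine abs_le_of_sq_le_sq' ?_ (abs_nonneg _) |>.2
    rw [sq_abs]; linarith
  have hn0' : n₀ ≠ 0 := by rintro rfl; norm_num at hn0
  -- Orthogonality to a normal whose largest entry is `n₀` keeps `d` from concentrating in
  -- coordinate `0`; hence `d₂` is bounded below.
  have hd0 : |d₀| ≤ 2 * |d₂| := by
    have h1 : |n₀| * |d₀| ≤ |n₀| * (2 * |d₂|) := by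
      rw [← abs_mul, show n₀ * d₀ = -(n₁ * d₁) - n₂ * d₂ by linarith]
      refine (abs_sub _ _).trans ?_
      rw [abs_neg, abs_mul, abs_mul]
      linarith [mul_le_mul hn1 hd (abs_nonneg _) (abs_nonneg _),
        mul_le_mul_of_nonneg_right hn2 (abs_nonneg d₂)]
    exact le_of_mul_le_mul_left h1 (by linarith)
  have hd2 : 1 / 3 ≤ |d₂| := by
    refine abs_le_of_sq_le_sq' ?_ (abs_nonneg _) |>.2
    have h1 : d₀ ^ 2 ≤ 4 * d₂ ^ 2 := by
      have := pow_le_pow_left₀ (abs_nonneg d₀) hd0 2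
      rw [mul_pow, sq_abs, sq_abs] at this
      linarith
    rw [sq_abs]; linarith
  -- Up to sign, these minors are the cross-product entries `d₂` and `d₁`. So the slope `-D' / D` is
  -- at most `1` in size, and `|D| ≥ 1 / 3` allows division.
  set D := n₀ * m₁ - n₁ * m₀ with hD
  set D' := n₀ * m₂ - n₂ * m₀ with hD'
  have hDsq : D ^ 2 = d₂ ^ 2 := by
    have : D ^ 2 = (n₀ ^ 2 + m₀ ^ 2) * (n₁ ^ 2 + m₁ ^ 2) - (n₀ * n₁ + m₀ * m₁) ^ 2 := by
      rw [hD]; ring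
    rw [this, show n₀ ^ 2 + m₀ ^ 2 = 1 - d₀ ^ 2 by linarith,
      show n₁ ^ 2 + m₁ ^ 2 = 1 - d₁ ^ 2 by linarith,
      show n₀ * n₁ + m₀ * m₁ = -(d₀ * d₁) by linarith]
    linear_combination -hdd
  have hD'sq : D' ^ 2 = d₁ ^ 2 := by
    have : D' ^ 2 = (n₀ ^ 2 + m₀ ^ 2) * (n₂ ^ 2 + m₂ ^ 2) - (n₀ * n₂ + m₀ * m₂) ^ 2 := by
      rw [hD']; ring
    rw [this, show n₀ ^ 2 + m₀ ^ 2 = 1 - d₀ ^ 2 by linarith,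
      show n₂ ^ 2 + m₂ ^ 2 = 1 - d₂ ^ 2 by linarith,
      show n₀ * n₂ + m₀ * m₂ = -(d₀ * d₂) by linarith]
    linear_combination -hdd
  have hDa : 1 / 3 ≤ |D| := by rwa [(sq_eq_sq_iff_abs_eq_abs D d₂).1 hDsq]
  have hDD : |D'| ≤ |D| := by
    rwa [(sq_eq_sq_iff_abs_eq_abs D d₂).1 hDsq, (sq_eq_sq_iff_abs_eq_abs D' d₁).1 hD'sq]
  have hD0 : D ≠ 0 := by intro h; rw [h] at hDa; norm_num at hDa
  refine ⟨-n₁ / n₀, -n₂ / n₀, -D' / D, ?_, ?_, ?_, fun z₀ z₁ z₂ h1 h2 => ⟨?_, ?_⟩⟩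
  · rw [abs_div, abs_neg]; exact div_le_one_of_le₀ hn1 (abs_nonneg _)
  · rw [abs_div, abs_neg]; exact div_le_one_of_le₀ hn2 (abs_nonneg _)
  · rw [abs_div, abs_neg]; exact div_le_one_of_le₀ hDD (abs_nonneg _)
  · have e : z₀ - -n₁ / n₀ * z₁ - -n₂ / n₀ * z₂ = (n₀ * z₀ + n₁ * z₁ + n₂ * z₂) / n₀ := by
      field_simp; ring
    rw [e, abs_div, div_le_iff₀ (by linarith)]
    linarith [mul_le_mul_of_nonneg_left hn0 hs]
  · have e : z₁ - -D' / D * z₂ = (n₀ * (m₀ * z₀ + m₁ * z₁ + m₂ * z₂) -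
        m₀ * (n₀ * z₀ + n₁ * z₁ + n₂ * z₂)) / D := by
      rw [eq_div_iff hD0]
      have : (z₁ - -D' / D * z₂) * D = z₁ * D + D' * z₂ := by field_simp; ring
      rw [this, hD, hD']; ring
    rw [e, abs_div, div_le_iff₀ (by linarith)]
    have hn0le : |n₀| ≤ 1 := (sq_le_one_iff_abs_le_one _).1 (by linarith [sq_nonneg m₀, sq_nonneg d₀])
    have hm0le : |m₀| ≤ 1 := (sq_le_one_iff_abs_le_one _).1 (by linarith [sq_nonneg n₀, sq_nonneg d₀])
    calc _ ≤ |n₀ * (m₀ * z₀ + m₁ * z₁ + m₂ * z₂)| + |m₀ * (n₀ * z₀ + n₁ * z₁ + n₂ * z₂)| := abs_sub _ _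
      _ ≤ 1 * (t / 2) + 1 * (s / 2) := by rw [abs_mul, abs_mul]; gcongr
      _ ≤ 6 * t * |D| := by linarith [mul_le_mul_of_nonneg_left hDa ht]

/-- A prism in the unit ball is contained in a sheared box, after permuting coordinates. -/
theorem exists_perm_box {s t : ℝ} (hs : 0 ≤ s) (hst : s ≤ t) {R : Set (EuclideanSpace ℝ (Fin 3))}
    (hR : IsPrism s t 1 R) (hR1 : R ⊆ Metric.closedBall 0 1) :
    ∃ (σ : Equiv.Perm (Fin 3)) (P : ShearParam), |P.p| ≤ 1 ∧ |P.q| ≤ 1 ∧ |P.v| ≤ 1 ∧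
      R ⊆ LinearIsometryEquiv.piLpCongrLeft 2 ℝ ℝ σ.symm ⁻¹' P.box s (6 * t) := by
  obtain ⟨g, rfl⟩ := hR
  set f := g.linearIsometryEquiv with hf
  set M : Matrix (Fin 3) (Fin 3) ℝ := fun i k => f (EuclideanSpace.single k 1) i with hM
  have hMM : M.transpose * M = 1 := by
    ext i k
    have h1 : inner ℝ (f (EuclideanSpace.single i 1)) (f (EuclideanSpace.single k 1)) =
        (1 : Matrix (Fin 3) (Fin 3) ℝ) i k := by
      rw [f.inner_map_map]
      simp [Matrix.one_apply, EuclideanSpace.inner_single_left]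
    rw [← h1, Matrix.mul_apply, PiLp.inner_apply]
    exact Finset.sum_congr rfl fun j _ => by rw [Matrix.transpose_apply]; simp [hM, mul_comm]
  have hMM' : M * M.transpose = 1 := mul_eq_one_comm.1 hMM
  have hcoord : ∀ x k, x k = ∑ i, M i k * (g x i - g 0 i) := by
    intro x k
    have h2 : g x = f x + g 0 := by simpa using g.map_vadd 0 x
    have h3 : inner ℝ (f (EuclideanSpace.single k 1)) (f x) = x k := by
      rw [f.inner_map_map]; simp [EuclideanSpace.inner_single_left]
    rw [← h3, h2, PiLp.inner_apply]
    exact Finset.sum_congr rfl fun j _ => by simp [hM, mul_comm]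
  obtain ⟨σ, hσ0, hσ2⟩ := exists_perm_pivot M
  have hcol : ∀ i k, M (σ 0) i * M (σ 0) k + M (σ 1) i * M (σ 1) k + M (σ 2) i * M (σ 2) k =
      (1 : Matrix (Fin 3) (Fin 3) ℝ) i k := by
    intro i k
    rw [← hMM, Matrix.mul_apply, ← Equiv.sum_comp σ, Fin.sum_univ_three]; rfl
  have hrow : ∀ i k, M i 0 * M k 0 + M i 1 * M k 1 + M i 2 * M k 2 =
      (1 : Matrix (Fin 3) (Fin 3) ℝ) i k := by
    intro i k
    rw [← hMM', Matrix.mul_apply, Fin.sum_univ_three]; rfl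
  have h01 : σ 0 ≠ σ 1 := fun h => by simpa using σ.injective h
  have h02 : σ 0 ≠ σ 2 := fun h => by simpa using σ.injective h
  obtain ⟨p, q, v, hp, hq, hv, H⟩ := exists_shear_of_frame (n₀ := M (σ 0) 0) (n₁ := M (σ 1) 0)
    (n₂ := M (σ 2) 0) (m₀ := M (σ 0) 1) (m₁ := M (σ 1) 1) (m₂ := M (σ 2) 1) (d₀ := M (σ 0) 2)
    (d₁ := M (σ 1) 2) (d₂ := M (σ 2) 2) hs hst
    (by simpa [sq] using hcol 0 0) (by simpa [sq] using hcol 2 2) (by simpa using hcol 0 2)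
    (by simpa [sq] using hrow (σ 0) (σ 0)) (by simpa [sq] using hrow (σ 1) (σ 1))
    (by simpa [sq] using hrow (σ 2) (σ 2)) (by simpa [h01] using hrow (σ 0) (σ 1))
    (by simpa [h02] using hrow (σ 0) (σ 2)) (hσ0 _) (hσ0 _) hσ2
  refine ⟨σ, ⟨p, q, g 0 (σ 0) - p * g 0 (σ 1) - q * g 0 (σ 2), v, g 0 (σ 1) - v * g 0 (σ 2)⟩,
    hp, hq, hv, ?_⟩
  rintro _ ⟨x, ⟨hx0, hx1, hx2⟩, rfl⟩
  have hgx := hR1 ⟨x, ⟨hx0, hx1, hx2⟩, rfl⟩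
  have hsum : ∀ k, x k = M (σ 0) k * (g x (σ 0) - g 0 (σ 0)) + M (σ 1) k * (g x (σ 1) - g 0 (σ 1)) +
      M (σ 2) k * (g x (σ 2) - g 0 (σ 2)) := fun k => by
    rw [hcoord, ← Equiv.sum_comp σ, Fin.sum_univ_three]
  rw [hsum] at hx0 hx1
  obtain ⟨h1, h2⟩ := H _ _ _ hx0 hx1
  refine ⟨?_, ?_, ?_⟩
  · refine le_trans (le_of_eq ?_) h1
    simp only [ShearParam.f₀, LinearIsometryEquiv.piLpCongrLeft_apply,
      Equiv.piCongrLeft'_apply, Equiv.symm_symm]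
    congr 1; ring
  · refine le_trans (le_of_eq ?_) h2
    simp only [ShearParam.f₁, LinearIsometryEquiv.piLpCongrLeft_apply,
      Equiv.piCongrLeft'_apply, Equiv.symm_symm]
    congr 1; ring
  · rw [mem_closedBall_zero_iff] at hgx
    exact (PiLp.norm_apply_le (g x) (σ 2)).trans hgx

/-- A fiber of `c` carrying at least its share of the total weight. -/
theorem exists_sum_le_card_mul_sum_fiber {ι κ : Type*} [Fintype ι] [Fintype κ] [Nonempty κ]
    [DecidableEq κ] (c : ι → κ) (y : ι → ℝ) :
    ∃ k, ∑ i, y i ≤ Fintype.card κ * ∑ i : {i // c i = k}, y i := by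
  obtain ⟨k, hk⟩ := Finite.exists_max fun k => ∑ i : {i // c i = k}, y i
  refine ⟨k, ?_⟩
  calc ∑ i, y i = ∑ k, ∑ i : {i // c i = k}, y i := (Fintype.sum_fiberwise c y).symm
    _ ≤ ∑ _k : κ, ∑ i : {i // c i = k}, y i := Finset.sum_le_sum fun k' _ => hk k'
    _ = _ := by simp

theorem ConvexWolffAxioms.ncard_le {ι : Type*} [Fintype ι] {C : ℝ} (hC : 0 ≤ C)
    {R : ι → Set (EuclideanSpace ℝ (Fin 3))} (h : ConvexWolffAxioms C R)
    (f : EuclideanSpace ℝ (Fin 3) ≃ₗᵢ[ℝ] EuclideanSpace ℝ (Fin 3)) (P : ShearParam) {A B : ℝ}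
    (hA : 0 ≤ A) (hB : 0 ≤ B) :
    ({i | R i ⊆ f ⁻¹' P.box A B}.ncard : ℝ) ≤ C * (8 * A * B) * Fintype.card ι := by
  have h1 := h (f ⁻¹' P.box A B) (ShearParam.convex_box.linear_preimage f.toLinearEquiv.toLinearMap)
  rw [f.volume_preimage] at h1
  have hf : volume (P.box A B) ≠ ∞ := ShearParam.volume_box_ne_top hA hB
  have h2 := ENNReal.toReal_mono (by finiteness) h1
  simp only [ENNReal.toReal_mul, ENNReal.toReal_natCast, ENNReal.toReal_ofReal hC] at h2
  refine h2.trans ?_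
  gcongr
  exact ShearParam.measureReal_box_le hA hB

theorem IsDenseShading.le_sum_measureReal {ι : Type*} [Fintype ι] {τ a : ℝ} (hτ : 0 ≤ τ)
    (ha : 0 ≤ a) {R Y : ι → Set (EuclideanSpace ℝ (Fin 3))} (h : IsDenseShading τ R Y)
    (hR : ∀ i, volume (R i) = ENNReal.ofReal a) :
    τ * (a * Fintype.card ι) ≤ ∑ i, volume.real (Y i) := by
  have hY : ∀ i, volume (Y i) ≠ ∞ := fun i =>
    measure_ne_top_of_subset (h.1 i) (by rw [hR]; exact ENNReal.ofReal_ne_top)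
  have h1 := ENNReal.toReal_mono (ENNReal.sum_ne_top.2 fun i _ => hY i) h.2
  rw [ENNReal.toReal_sum fun i _ => hY i, ENNReal.toReal_mul, ENNReal.toReal_ofReal hτ] at h1
  simp only [hR, Finset.sum_const, Finset.card_univ, nsmul_eq_mul, ENNReal.toReal_mul,
    ENNReal.toReal_natCast, ENNReal.toReal_ofReal ha] at h1
  simpa [mul_comm, measureReal_def] using h1

/-! ### The main theorem. -/

theorem mainTheorem8 (ε : ℝ) (hε : 0 < ε) :
    ∃ η > (0 : ℝ), ∃ δ₀ > (0 : ℝ), ∀ δ : ℝ, 0 < δ → δ ≤ δ₀ →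
      ∀ s ∈ Set.Icc δ 1, ∀ t ∈ Set.Icc δ 1, s ≤ δ ^ ε * t →
        ∀ (ι : Type) [Fintype ι] [Nonempty ι] (R Y : ι → Set (EuclideanSpace ℝ (Fin 3))),
          (∀ i, IsPrism s t 1 (R i)) →
          (∀ i, R i ⊆ Metric.closedBall 0 1) →
          ConvexWolffAxioms (δ ^ (-η)) R →
          IsDenseShading (δ ^ η) R Y →
          DiscretizedAssouadDimAtLeast (⋃ i, Y i) (3 - ε) δ (δ ^ (-η)) := by
  -- Taking `min ε 1` only strengthens the dimension bound and weakens the eccentricity hypothesis.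
  obtain ⟨η, hη, δ₀, hδ₀, H⟩ := discretizedAssouadDimAtLeast_of_boxes (ε := min ε 1)
    (lt_min hε one_pos) (min_le_right _ _)
  refine ⟨η, hη, min δ₀ 1, by positivity, fun δ h0 hδ s hs t ht hst ι _ _ R Y hR hR1 hCW hY => ?_⟩
  classical
  have hδ1 : δ ≤ 1 := hδ.trans (min_le_right _ _)
  have hs0 : 0 < s := h0.trans_le hs.1
  have ht0 : 0 < t := h0.trans_le ht.1
  have hle : s ≤ t := hst.trans (mul_le_of_le_one_left ht0.le (Real.rpow_le_one h0.le hδ1 hε.le))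
  have hvol : ∀ i, volume (R i) = ENNReal.ofReal (s * t) := fun i => by
    simpa using volume_prism hs0.le ht0.le zero_le_one (hR i)
  choose σ P hp hq hv hbox using fun i => exists_perm_box hs0.le hle (hR i) (hR1 i)
  have hmass := hY.le_sum_measureReal (by positivity) (by positivity) hvol
  obtain ⟨k, hk⟩ := exists_sum_le_card_mul_sum_fiber σ fun i => volume.real (Y i)
  set J := {i // σ i = k}
  set f := LinearIsometryEquiv.piLpCongrLeft 2 ℝ ℝ k.symm with hf
  have h6 : Fintype.card (Equiv.Perm (Fin 3)) = 6 := by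
    rw [Fintype.card_perm]; rfl
  rw [h6] at hk
  have hboxJ : ∀ j : J, R j ⊆ f ⁻¹' (P j).box s (6 * t) := fun j => by
    have := hbox j; rwa [j.2] at this
  have hN : (0 : ℝ) < Fintype.card ι := by exact_mod_cast Fintype.card_pos
  have hsumJ : δ ^ η * (s * t * Fintype.card ι) ≤ 6 * ∑ j : J, volume.real (Y j) := by
    exact_mod_cast hmass.trans hk
  -- A class holding a sixth of the shading mass contains at least `δ^η / 6` of the prisms.
  -- Renormalising the Wolff bound to this class gives `48 = 8 * 6` and the second factor `δ^(-η)`.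
  have hcard : δ ^ η * Fintype.card ι ≤ 6 * Fintype.card J := by
    have h1 : ∑ j : J, volume.real (Y j) ≤ Fintype.card J * (s * t) := by
      refine (Finset.sum_le_card_nsmul _ _ (s * t) fun j _ => ?_).trans_eq (by simp)
      have h2 := ENNReal.toReal_mono (by rw [hvol]; exact ENNReal.ofReal_ne_top)
        (measure_mono (μ := volume) (hY.1 j))
      rwa [hvol, ENNReal.toReal_ofReal (by positivity)] at h2
    refine le_of_mul_le_mul_right ?_ (mul_pos hs0 ht0)
    linarith
  have hJ : Nonempty J := by
    rw [← Fintype.card_pos_iff]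
    have : (0 : ℝ) < Fintype.card J := by
      have : 0 < δ ^ η * Fintype.card ι := by positivity
      linarith
    exact_mod_cast this
  have hJN : (Fintype.card J : ℝ) ≤ Fintype.card ι := by
    exact_mod_cast Fintype.card_subtype_le _
  refine DiscretizedAssouadDimAtLeast.mono h0 (β := 3 - min ε 1) (by linarith [min_le_left ε 1])
    (DiscretizedAssouadDimAtLeast.of_image f ?_)
  refine H δ h0 (hδ.trans (min_le_left _ _)) s (6 * t) hs.1 (by linarith [ht.1])
    (by linarith [ht.2]) ?_ J (fun j => P j) (f '' ⋃ i, Y i) (fun j => hp j) (fun j => hq j)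
    (fun j => hv j) ?_ ?_ ?_
  · have h1 : δ ^ ε ≤ δ ^ min ε 1 := Real.rpow_le_rpow_of_exponent_ge h0 hδ1 (min_le_left _ _)
    have h2 : 0 < δ ^ min ε 1 := by positivity
    linarith [mul_le_mul_of_nonneg_right h1 ht0.le, mul_pos h2 ht0]
  · rintro _ ⟨x, hx, rfl⟩
    obtain ⟨i, hi⟩ := mem_iUnion.1 hx
    have := hR1 i (hY.1 i hi)
    rw [mem_closedBall_zero_iff] at this ⊢
    rwa [f.norm_map]
  · intro i A B hA hB
    have h1 := hCW.ncard_le (by positivity) f (P i) hA.le hB.le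
    have h2 : {j : J | (P j).box s (6 * t) ⊆ (P i).box A B}.ncard ≤
        {j | R j ⊆ f ⁻¹' (P i).box A B}.ncard := by
      refine Set.ncard_le_ncard_of_injOn (fun j : J => (j : ι)) (fun j hj => ?_)
        Subtype.val_injective.injOn (Set.toFinite _)
      exact (hboxJ j).trans (preimage_mono hj)
    have h3 : (Fintype.card ι : ℝ) ≤ 6 * δ ^ (-η) * Fintype.card J := by
      have e : δ ^ (-η) * δ ^ η = 1 := by rw [← Real.rpow_add h0]; simp
      calc (Fintype.card ι : ℝ) = δ ^ (-η) * (δ ^ η * Fintype.card ι) := by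
            rw [← mul_assoc, e, one_mul]
        _ ≤ δ ^ (-η) * (6 * Fintype.card J) := by gcongr
        _ = _ := by ring
    have e : δ ^ (-(2 * η)) = δ ^ (-η) * δ ^ (-η) := by
      rw [← Real.rpow_add h0]; congr 1; ring
    calc (({j : J | (P j).box s (6 * t) ⊆ (P i).box A B}.ncard : ℕ) : ℝ)
        ≤ δ ^ (-η) * (8 * A * B) * Fintype.card ι := le_trans (by exact_mod_cast h2) h1
      _ ≤ δ ^ (-η) * (8 * A * B) * (6 * δ ^ (-η) * Fintype.card J) := by gcongr
      _ = _ := by rw [e]; ring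
  · calc δ ^ η / 36 * s * (6 * t) * Fintype.card J
        ≤ δ ^ η / 36 * s * (6 * t) * Fintype.card ι := by gcongr
      _ = δ ^ η * (s * t * Fintype.card ι) / 6 := by ring
      _ ≤ ∑ j : J, volume.real (Y j) := by linarith
      _ ≤ _ := by
        -- Monotonicity of outer measure replaces a possibly non-measurable `Y j` by the closed
        -- thickening.
        refine Finset.sum_le_sum fun j _ => ?_
        rw [measureReal_def, ← f.volume_image]
        refine measureReal_mono (subset_inter ?_ ?_) (measure_ne_top_of_subset inter_subset_left
          (ShearParam.volume_box_ne_top hs0.le (by positivity)))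
        · exact image_subset_iff.2 ((hY.1 j).trans (hboxJ j))
        · exact (image_mono (subset_iUnion Y j)).trans (Metric.self_subset_cthickening _)
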